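/- Let $d\ge 2$ be an integer and $\mathbb T^d=(\mathbb R/2\pi\mathbb Z)^d$. Write vector fields on $\mathbb T^d$ as $v=\sum_{k\in\mathbb Z^d}v_k e_k$, with $e_k(x)=(2\pi)^{-d/2}e^{ik\cdot x}$ and $v_k\in\mathbb C^d$. For real $m$ let $\mathbb H^m_{\Sigma 0}$ be the space of real ($v_{-k}=\overline{v_k}$), zero mean ($v_0=0$), divergence free ($k\cdot v_k=0$ for all $k$) vector fields with $\|v\|_m^2:=\sum_{k\ne 0}|k|^{2m}|v_k|^2<\infty$, with inner product $\langle v|w\rangle_m:=\sum_{k\neq 0}|k|^{2m}\,\overline{v_k}\cdot w_k$. Let $\mathscr P(v,w):=-\mathfrak L(v\cdot\partial w)$, where $(v\cdot\partial w)_r=\sum_s v_s\partial_s w_r$ and $\mathfrak L$ is the Leray projection onto divergence free fields. Fix a real $n>\frac d2+1$, a viscosity $\nu\ge 0$, and a constant $G_n>0$ such that the Kato inequality $$|\langle \mathscr P(v,w)|w\rangle_n|\le G_n\|v\|_n\|w\|_n^2\qquad (v\in\mathbb H^n_{\Sigma 0},\ w\in\mathbb H^{n+1}_{\Sigma 0})$$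 holds. Let $u_0\in\mathbb H^{n+2}_{\Sigma 0}$. A solution of the Euler/Navier–Stokes Cauchy problem with zero forcing on $[0,T)$, $T\in(0,+\infty]$, is a function $u\in C([0,T),\mathbb H^{n+2}_{\Sigma 0})\cap C^1([0,T),\mathbb H^{n}_{\Sigma 0})$ with $$\frac{du}{dt}=\nu\Delta u+\mathscr P(u,u)\ \text{ on }[0,T),\qquad u(0)=u_0;$$ it is maximal if it cannot be extended to a solution on a larger interval $[0,T')$. Put $$e_\nu(t)=\begin{cases}(1-e^{-\nu t})/\nu & (\nu>0)\\ t&(\nu=0)\end{cases},\qquad T_c=\begin{cases}+\infty & \text{if }\nu>0,\ \|u_0\|_n\le \nu/G_n,\\ -\frac1\nu\log\left(1-\frac{\nu}{G_n\|u_0\|_n}\right)&\text{if }\nu>0,\ \|u_0\|_n>\nu/G_n,\\ \frac{1}{G_n\|u_0\|_n}&\text{if }\nu=0,\end{cases}$$ where $1/(G_n\|u_0\|_n):=+\infty$ if $u_0=0$. Then a maximal solution exists, and for a maximal solution $u$, of domain $[0,T)$, one has $T\ge T_c$ and, for all $t\in[0,T_c)$, $1-G_n\|u_0\|_n e_\nu(t)>0$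 and $$\|u(t)\|_n\le\frac{\|u_0\|_n e^{-\nu t}}{1-G_n\|u_0\|_n e_\nu(t)}.$$ In particular, if $\|u_0\|_n\le \nu/G_n$, then $T=T_c=+\infty$, so that $u$ is global; if moreover $\nu>0$, then $u$ decays exponentially: there is a constant $C$ such that $\|u(t)\|_n\le Ce^{-\nu t}$ for all $t\ge 0$. -/

import Mathlib

open Filter Topology MeasureTheory

noncomputable section

namespace EulerNS

/-- The torus `𝕋^d`, with `𝕋 = ℝ / 2πℤ`; its `volume` is the product measure `dx`, of total mass
`(2π)^d`. -/
abbrev Torus (d : ℕ) : Type := Fin d → AddCircle (2 * Real.pi)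

instance fact_two_pi_pos : Fact (0 < 2 * Real.pi) := ⟨Real.two_pi_pos⟩

/-- A (complex, formal) vector field on `𝕋^d`, given by its Fourier coefficients `v k ∈ ℂ^d`,
`k ∈ ℤ^d`, with respect to the orthonormal family `e_k(x) = (2π)^(-d/2) exp(i k • x)`.
A distributional vector field is determined by its Fourier coefficients, and we identify the two. -/
abbrev VField (d : ℕ) : Type := (Fin d → ℤ) → EuclideanSpace ℂ (Fin d)

/-- The Euclidean length `|k|` of a wave vector. -/
def kabs {d : ℕ} (k : Fin d → ℤ) : ℝ := Real.sqrt (∑ s, (k s : ℝ) ^ 2)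

/-- `e_k(x) = (2π)^(-d/2) exp(i k • x)`. -/
def expo {d : ℕ} (k : Fin d → ℤ) (x : Torus d) : ℂ :=
  (((2 * Real.pi) ^ (-(d : ℝ) / 2) : ℝ) : ℂ) * ∏ s, fourier (k s) (x s)

/-- The value at `x ∈ 𝕋^d` of the vector field with Fourier coefficients `v`:
`v(x) = ∑_k v_k e_k(x)`. -/
def evalAt {d : ℕ} (v : VField d) (x : Torus d) : EuclideanSpace ℂ (Fin d) :=
  ∑' k, expo k x • v k

/-- The Fourier coefficients `∫ F(x) e_{-k}(x) dx` of a function `F` on the torus. -/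
def coeffs {d : ℕ} (F : Torus d → EuclideanSpace ℂ (Fin d)) : VField d :=
  fun k => ∫ x, expo (-k) x • F x

/-- The partial derivative `∂_s`. -/
def pderiv {d : ℕ} (s : Fin d) (w : VField d) : VField d :=
  fun k => (Complex.I * (k s : ℂ)) • w k

/-- The Laplacian. -/
def lap {d : ℕ} (v : VField d) : VField d :=
  fun k => (-(kabs k ^ 2)) • v k

/-- The Leray projection: `(𝔏v)_k = v_k - (k • v_k) k / |k|²` for `k ≠ 0` and `(𝔏v)_0 = v_0`
(for `k = 0` the formula below also gives `v_0`). -/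
def leray {d : ℕ} (v : VField d) : VField d :=
  fun k => v k - ((∑ s, (k s : ℂ) * v k s) / ((kabs k ^ 2 : ℝ) : ℂ)) •
    WithLp.toLp 2 (fun s => (k s : ℂ))

/-- The function `(v • ∂w)(x) = ∑_s v_s(x) (∂_s w)(x)` on the torus. -/
def advect {d : ℕ} (v w : VField d) (x : Torus d) : EuclideanSpace ℂ (Fin d) :=
  ∑ s, evalAt v x s • evalAt (pderiv s w) x

/-- The fundamental bilinear map `𝒫(v, w) = -𝔏(v • ∂w)`. -/
def bilin {d : ℕ} (v w : VField d) : VField d := -leray (coeffs (advect v w))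

/-- `v` belongs to `H^n_{Σ0}`: it is real, has zero mean, is divergence free, and
`∑_k |k|^(2n) |v_k|² < ∞`. -/
structure MemH {d : ℕ} (n : ℝ) (v : VField d) : Prop where
  real : ∀ k r, v (-k) r = (starRingEnd ℂ) (v k r)
  mean : v 0 = 0
  div : ∀ k, ∑ s, (k s : ℂ) * v k s = 0
  summable : Summable fun k => kabs k ^ (2 * n) * ‖v k‖ ^ 2

/-- The inner product `⟨v | w⟩_n = ∑_k |k|^(2n) conj(v_k) • w_k` (a real number, for real
vector fields). -/
def innerH {d : ℕ} (n : ℝ) (v w : VField d) : ℝ :=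
  ∑' k, kabs k ^ (2 * n) * (inner ℂ (v k) (w k)).re

/-- The norm `‖v‖_n = (∑_k |k|^(2n) |v_k|²)^(1/2)`. -/
def normH {d : ℕ} (n : ℝ) (v : VField d) : ℝ :=
  Real.sqrt (∑' k, kabs k ^ (2 * n) * ‖v k‖ ^ 2)

/-- `G` is a constant for which the Kato inequality
`|⟨𝒫(v,w) | w⟩_n| ≤ G ‖v‖_n ‖w‖_n²` holds for all `v ∈ H^n_{Σ0}`, `w ∈ H^{n+1}_{Σ0}`. -/
def IsKatoConstant (d : ℕ) (n G : ℝ) : Prop :=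
  0 < G ∧ ∀ v w : VField d, MemH n v → MemH (n + 1) w →
    |innerH n (bilin v w) w| ≤ G * normH n v * normH n w ^ 2

/-- The time interval `[0, T)`, for `T ∈ [-∞, +∞]`. -/
def timeIco (T : EReal) : Set ℝ := {t | 0 ≤ t ∧ (t : EReal) < T}

/-- `u ∈ C(I, H^n_{Σ0})`. -/
def ContH {d : ℕ} (n : ℝ) (I : Set ℝ) (u : ℝ → VField d) : Prop :=
  (∀ t ∈ I, MemH n (u t)) ∧
    ∀ t₀ ∈ I, Tendsto (fun t => normH n (u t - u t₀)) (𝓝[I] t₀) (𝓝 0)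

/-- `u` is differentiable on `I` with derivative `u'`, with respect to the norm of `H^n_{Σ0}`. -/
def HasDerivH {d : ℕ} (n : ℝ) (I : Set ℝ) (u u' : ℝ → VField d) : Prop :=
  ∀ t₀ ∈ I, Tendsto (fun t => normH n ((t - t₀)⁻¹ • (u t - u t₀) - u' t₀))
    (𝓝[I \ {t₀}] t₀) (𝓝 0)

/-- `u`, restricted to `[0, T)`, solves the Cauchy problem for the Euler/NS equations with
viscosity `ν`, forcing `f` and datum `u₀`: `u ∈ C([0,T), H^{n+2}_{Σ0}) ∩ C¹([0,T), H^n_{Σ0})`,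
`du/dt = ν Δu + 𝒫(u,u) + f` on `[0, T)` and `u(0) = u₀`. -/
structure IsSolution {d : ℕ} (n ν : ℝ) (f : ℝ → VField d) (u₀ : VField d)
    (T : EReal) (u : ℝ → VField d) : Prop where
  pos : 0 < T
  cont : ContH (n + 2) (timeIco T) u
  eqn : ∃ u' : ℝ → VField d, ContH n (timeIco T) u' ∧ HasDerivH n (timeIco T) u u' ∧
    ∀ t ∈ timeIco T, u' t = ν • lap (u t) + bilin (u t) (u t) + f t
  init : u 0 = u₀

/-- A maximal, i.e. nonextendable, solution, of domain `[0, T)`. -/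
def IsMaximalSolution {d : ℕ} (n ν : ℝ) (f : ℝ → VField d) (u₀ : VField d)
    (T : EReal) (u : ℝ → VField d) : Prop :=
  IsSolution n ν f u₀ T u ∧
    ¬ ∃ (T' : EReal) (v : ℝ → VField d), T < T' ∧ IsSolution n ν f u₀ T' v ∧
      Set.EqOn v u (timeIco T)

/-- `e_ν(t) = (1 - e^{-νt})/ν` if `ν > 0`, and `e_0(t) = t`. -/
def eNu (ν t : ℝ) : ℝ := if ν = 0 then t else (1 - Real.exp (-ν * t)) / ν

/-- The time `T_c` corresponding to the viscosity `ν ≥ 0`, the constant `G > 0` and the norm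
`a = ‖u₀‖_n` of the datum. -/
def Tc (ν G a : ℝ) : EReal :=
  if ν = 0 then
    (if a = 0 then ⊤ else ((1 / (G * a) : ℝ) : EReal))
  else if a ≤ ν / G then ⊤
  else ((-(1 / ν) * Real.log (1 - ν / (G * a)) : ℝ) : EReal)

end EulerNS

end

open EulerNS

/-! The estimate is a Riccati comparison. Pairing the equation with `u` in `H^n`, the Kato
inequality bounds the nonlinear term by `G‖u‖_n³`. Since `|k| ≥ 1` on zero mean fields, the viscous
term is at most `-ν‖u‖_n²`. So `(‖u‖_n²)' ≤ -2ν‖u‖_n² + 2G‖u‖_n³`, and `‖u‖_n` stays below the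
solution `barrier` of `B' = -νB + GB²`, whose denominator is positive exactly up to `T_c`
(`le_barrier`, `pos_of_mem_timeIco_Tc`).

To get `T ≥ T_c`, the data lie in `H^{n+2}` but the local existence time must depend on the `H^n`
norm alone (`exists_local`, `exists_continuation`): a bound in `H^n` then suffices to continue the
solution, and the barrier provides it on every bounded interval short of `T_c`.

Local existence goes through Galerkin truncations. With a diagonal weight `φ`, the antisymmetry of
the advection term turns the energy balance into a commutator with differences `φ_k - φ_l`, which
recovers the lost derivative (`IsEnergyWeight.inner_bilin_le`). For `|k|^p min(|k|/K, 1)` the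
resulting bound is linear in the weighted norm once `‖u‖_n` is controlled, with constants
independent of `K` and of the truncation. Hence the high frequencies of all approximations are
uniformly small in `H^{n+2}`. The low ones converge by `l2_stability`, so the approximations are
Cauchy in `H^{n+2}` uniformly in time. The same stability estimate gives uniqueness, hence a maximal
solution by gluing.

If `‖u₀‖_n < ν/G`, the denominator of the barrier stays away from `0` and decay is immediate. If
`‖u₀‖_n = ν/G > 0`, the barrier is constant and proves no decay. But the energy inequality is then
strict (`IsKatoConstant.innerH_rhs_lt`), so the norm drops below `ν/G` at some later time, and the
first case applies from there. -/

open Filter Topology MeasureTheory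

noncomputable section

namespace EulerNS

variable {d : ℕ}

/-! ### Wave vectors and lattice sums. -/

/-- The wave vector `k` as an element of Euclidean space. -/
def kvec (k : Fin d → ℤ) : EuclideanSpace ℝ (Fin d) := WithLp.toLp 2 fun s => (k s : ℝ)

lemma kabs_eq_norm (k : Fin d → ℤ) : kabs k = ‖kvec k‖ := by
  simp [kabs, kvec, EuclideanSpace.norm_eq]

lemma kabs_nonneg (k : Fin d → ℤ) : 0 ≤ kabs k := Real.sqrt_nonneg _

@[simp] lemma kabs_zero : kabs (0 : Fin d → ℤ) = 0 := by simp [kabs]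

@[simp] lemma kabs_neg (k : Fin d → ℤ) : kabs (-k) = kabs k := by simp [kabs]

lemma kabs_add_le (k l : Fin d → ℤ) : kabs (k + l) ≤ kabs k + kabs l := by
  simp only [kabs_eq_norm]
  have : kvec (k + l) = kvec k + kvec l := by
    ext s; simp [kvec]
  rw [this]; exact norm_add_le _ _

lemma kabs_le_sub_add (k l : Fin d → ℤ) : kabs k ≤ kabs (k - l) + kabs l := by
  simpa using kabs_add_le (k - l) l

lemma abs_kabs_sub_le (k l : Fin d → ℤ) : |kabs k - kabs l| ≤ kabs (k - l) := by
  rw [abs_le]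
  have h1 := kabs_le_sub_add k l
  have h2 := kabs_le_sub_add l k
  rw [← kabs_neg (l - k), neg_sub] at h2
  constructor <;> linarith

lemma abs_apply_le_kabs (k : Fin d → ℤ) (s : Fin d) : |(k s : ℝ)| ≤ kabs k := by
  rw [kabs_eq_norm]
  simpa [kvec] using PiLp.norm_apply_le (kvec k) s

lemma one_le_kabs {k : Fin d → ℤ} (hk : k ≠ 0) : 1 ≤ kabs k := by
  obtain ⟨s, hs⟩ := Function.ne_iff.mp hk
  refine le_trans ?_ (abs_apply_le_kabs k s)
  have : 1 ≤ |k s| := Int.one_le_abs (by simpa using hs)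
  exact_mod_cast this

lemma kabs_pos {k : Fin d → ℤ} (hk : k ≠ 0) : 0 < kabs k := lt_of_lt_of_le one_pos (one_le_kabs hk)

lemma norm_dot_le (l : Fin d → ℤ) (v : EuclideanSpace ℂ (Fin d)) :
    ‖∑ s, (l s : ℂ) * v s‖ ≤ kabs l * ‖v‖ := by
  have h := norm_inner_le_norm (𝕜 := ℂ) (WithLp.toLp 2 (fun s => (l s : ℂ)) : EuclideanSpace ℂ (Fin d)) v
  have h1 : ‖(WithLp.toLp 2 (fun s => (l s : ℂ)) : EuclideanSpace ℂ (Fin d))‖ = kabs l := by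
    simp [EuclideanSpace.norm_eq, kabs]
  rw [h1] at h
  refine le_trans (le_of_eq ?_) h
  simp [PiLp.inner_apply, mul_comm]

lemma finite_kabs_le (N : ℝ) : {k : Fin d → ℤ | kabs k ≤ N}.Finite := by
  refine Set.Finite.subset (Set.Finite.pi' (fun _ : Fin d => Set.finite_Icc (-⌈N⌉) ⌈N⌉)) ?_
  intro k hk s
  have h1 : |(k s : ℝ)| ≤ (⌈N⌉ : ℝ) := (abs_apply_le_kabs k s).trans (le_trans hk (Int.le_ceil N))
  have h2 : |k s| ≤ ⌈N⌉ := by exact_mod_cast h1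
  exact abs_le.mp h2

/-- The wave vectors embed in the lattice spanned by the standard basis, which has rank `d`, so the
general summability criterion for lattices applies. -/
lemma summable_kabs_rpow {r : ℝ} (hr : r < -(d : ℝ)) :
    Summable fun k : Fin d → ℤ => kabs k ^ r := by
  classical
  let b := (EuclideanSpace.basisFun (Fin d) ℝ).toBasis
  let L : Submodule ℤ (EuclideanSpace ℝ (Fin d)) := Submodule.span ℤ (Set.range b)
  have hfin : Module.finrank ℤ L = d := by
    rw [ZLattice.rank ℝ L]; simp
  have hs := ZLattice.summable_norm_rpow L r (by rw [hfin]; exact hr)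
  have hmem : ∀ k : Fin d → ℤ, kvec k ∈ L := by
    intro k
    have : kvec k = ∑ s, k s • b s := by
      ext s
      simp [kvec, b, Pi.single_apply]
    rw [this]
    exact Submodule.sum_mem _ fun s _ => Submodule.smul_mem _ _ (Submodule.subset_span ⟨s, rfl⟩)
  have hinj : Function.Injective (fun k : Fin d → ℤ => (⟨kvec k, hmem k⟩ : L)) := by
    intro k l h
    have h' : kvec k = kvec l := congrArg Subtype.val h
    funext s
    have := congrArg (fun x : EuclideanSpace ℝ (Fin d) => x s) h'
    simpa [kvec] using this
  have := hs.comp_injective hinj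
  refine this.congr fun k => ?_
  simp [kabs_eq_norm]

/-! ### Sobolev norms and the embedding into absolutely convergent Fourier series. -/

/-- Cauchy-Schwarz for series of real numbers. -/
lemma summable_mul_and_tsum_le {ι : Type*} {f g : ι → ℝ} (hf : ∀ i, 0 ≤ f i) (hg : ∀ i, 0 ≤ g i)
    (hf2 : Summable fun i => f i ^ 2) (hg2 : Summable fun i => g i ^ 2) :
    (Summable fun i => f i * g i) ∧
      (∑' i, f i * g i) ≤ √(∑' i, f i ^ 2) * √(∑' i, g i ^ 2) := by
  have h := Real.summable_and_inner_le_Lp_mul_Lq_tsum_of_nonneg (p := 2) (q := 2)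
    Real.HolderConjugate.two_two hf hg (by simpa using hf2) (by simpa using hg2)
  simpa [Real.sqrt_eq_rpow] using h

lemma sq_kabs_rpow (k : Fin d → ℤ) (n : ℝ) : (kabs k ^ n) ^ 2 = kabs k ^ (2 * n) := by
  rw [mul_comm, Real.rpow_mul (kabs_nonneg k)]; norm_num

lemma normH_nonneg (n : ℝ) (v : VField d) : 0 ≤ normH n v := Real.sqrt_nonneg _

lemma normH_sq (n : ℝ) (v : VField d) :
    normH n v ^ 2 = ∑' k, kabs k ^ (2 * n) * ‖v k‖ ^ 2 :=
  Real.sq_sqrt (tsum_nonneg fun k => mul_nonneg (Real.rpow_nonneg (kabs_nonneg k) _) (sq_nonneg _))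

lemma rpow_weight_mono {m n : ℝ} (hmn : m ≤ n) {v : VField d} (h0 : v 0 = 0) (k : Fin d → ℤ) :
    kabs k ^ (2 * m) * ‖v k‖ ^ 2 ≤ kabs k ^ (2 * n) * ‖v k‖ ^ 2 := by
  by_cases hk : k = 0
  · subst hk; simp [h0]
  · gcongr
    exact one_le_kabs hk

lemma MemH.mono {m n : ℝ} (hmn : m ≤ n) {v : VField d} (h : MemH n v) : MemH m v :=
  ⟨h.real, h.mean, h.div, Summable.of_nonneg_of_le
    (fun k => mul_nonneg (Real.rpow_nonneg (kabs_nonneg k) _) (sq_nonneg _))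
    (rpow_weight_mono hmn h.mean) h.summable⟩

lemma MemH.normH_mono {m n : ℝ} (hmn : m ≤ n) {v : VField d} (h : MemH n v) :
    normH m v ≤ normH n v :=
  Real.sqrt_le_sqrt ((h.mono hmn).summable.tsum_le_tsum (rpow_weight_mono hmn h.mean) h.summable)

/-- The constant of the embedding of `H^n` into the fields with summable `|k| |v_k|`. -/
def wienerConst (d : ℕ) (n : ℝ) : ℝ := √(∑' k : Fin d → ℤ, kabs k ^ (2 - 2 * n))

lemma wienerConst_nonneg (d : ℕ) (n : ℝ) : 0 ≤ wienerConst d n := Real.sqrt_nonneg _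

/-- Cauchy-Schwarz for `|k|^(1-n) · (|k|^n |v_k|)`. The condition `n > d/2 + 1` says exactly that `2
- 2n < -d`, so that the first factor is square summable. -/
lemma MemH.summable_kabs_mul {n : ℝ} (hn : (d : ℝ) / 2 + 1 < n) {v : VField d} (h : MemH n v) :
    (Summable fun k => kabs k * ‖v k‖) ∧ ∑' k, kabs k * ‖v k‖ ≤ wienerConst d n * normH n v := by
  have e1 : ∀ k : Fin d → ℤ, (kabs k ^ (1 - n)) ^ 2 = kabs k ^ (2 - 2 * n) := fun k => by
    rw [sq_kabs_rpow]; ring_nf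
  have e2 : ∀ k, (kabs k ^ n * ‖v k‖) ^ 2 = kabs k ^ (2 * n) * ‖v k‖ ^ 2 := fun k => by
    rw [mul_pow, sq_kabs_rpow]
  have e3 : ∀ k, kabs k ^ (1 - n) * (kabs k ^ n * ‖v k‖) = kabs k * ‖v k‖ := fun k => by
    by_cases hk : k = 0
    · subst hk; simp [h.mean]
    · rw [← mul_assoc, ← Real.rpow_add (kabs_pos hk)]; simp
  have := summable_mul_and_tsum_le (f := fun k : Fin d → ℤ => kabs k ^ (1 - n))
    (g := fun k => kabs k ^ n * ‖v k‖) (fun k => Real.rpow_nonneg (kabs_nonneg k) _)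
    (fun k => mul_nonneg (Real.rpow_nonneg (kabs_nonneg k) _) (norm_nonneg _))
    (by simp only [e1]; exact summable_kabs_rpow (by linarith))
    (by simp only [e2]; exact h.summable)
  simp only [e1, e2, e3] at this
  exact this

lemma MemH.norm_le_kabs_mul {n : ℝ} {v : VField d} (h : MemH n v) (k : Fin d → ℤ) :
    ‖v k‖ ≤ kabs k * ‖v k‖ := by
  by_cases hk : k = 0
  · subst hk; simp [h.mean]
  · exact le_mul_of_one_le_left (norm_nonneg _) (one_le_kabs hk)

lemma MemH.summable_norm {n : ℝ} (hn : (d : ℝ) / 2 + 1 < n) {v : VField d} (h : MemH n v) :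
    (Summable fun k => ‖v k‖) ∧ ∑' k, ‖v k‖ ≤ wienerConst d n * normH n v := by
  have h1 := h.summable_kabs_mul hn
  have h2 : Summable fun k => ‖v k‖ :=
    Summable.of_nonneg_of_le (fun _ => norm_nonneg _) h.norm_le_kabs_mul h1.1
  exact ⟨h2, (h2.tsum_le_tsum h.norm_le_kabs_mul h1.1).trans h1.2⟩

/-! ### The advection term as a convolution of Fourier coefficients. -/

/-- The normalization `(2π)^(-d/2)` of the Fourier basis. -/
def fourierNormalization (d : ℕ) : ℝ := (2 * Real.pi) ^ (-(d : ℝ) / 2)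

lemma fourierNormalization_pos (d : ℕ) : 0 < fourierNormalization d :=
  Real.rpow_pos_of_pos Real.two_pi_pos _

lemma norm_expo (k : Fin d → ℤ) (x : Torus d) : ‖expo k x‖ = fourierNormalization d := by
  have h : ‖(((2 * Real.pi) ^ (-(d : ℝ) / 2) : ℝ) : ℂ)‖ = fourierNormalization d := by
    rw [Complex.norm_real]; exact Real.norm_of_nonneg (fourierNormalization_pos d).le
  rw [expo, norm_mul, norm_prod, h]
  simp [fourier_apply, Circle.norm_coe]

lemma continuous_expo (k : Fin d → ℤ) : Continuous (expo k : Torus d → ℂ) := by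
  unfold expo; fun_prop

lemma integral_fourier (j : ℤ) :
    ∫ x : AddCircle (2 * Real.pi), (fourier j x : ℂ) = if j = 0 then ((2 * Real.pi : ℝ) : ℂ) else 0 := by
  have h := congrFun (fourierCoeff_fourier (T := 2 * Real.pi) j) 0
  rw [fourierCoeff] at h
  rw [AddCircle.volume_eq_smul_haarAddCircle, integral_smul_measure]
  simp only [neg_zero, fourier_zero, one_smul] at h
  rw [h, ENNReal.toReal_ofReal Real.two_pi_pos.le]
  by_cases hj : j = 0
  · subst hj; simp
  · simp [hj, Ne.symm hj]

/-- Three factors `(2π)^(-d/2)` against the total mass `(2π)^d` leave one of them. -/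
lemma integral_expo_mul (k h l : Fin d → ℤ) :
    ∫ x : Torus d, expo (-k) x * (expo h x * expo l x) =
      if h = k - l then (fourierNormalization d : ℂ) else 0 := by
  have e : ∀ x : Torus d, expo (-k) x * (expo h x * expo l x) =
      (fourierNormalization d : ℂ) ^ 3 * ∏ s, fourier (-k s + h s + l s) (x s) := by
    intro x
    have : ∏ s, (fourier (-k s + h s + l s) (x s) : ℂ) =
        (∏ s, fourier (-k s) (x s)) * (∏ s, fourier (h s) (x s)) * ∏ s, fourier (l s) (x s) := by
      rw [← Finset.prod_mul_distrib, ← Finset.prod_mul_distrib]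
      exact Finset.prod_congr rfl fun s _ => by rw [fourier_add, fourier_add]
    rw [this]; simp only [expo, fourierNormalization, Pi.neg_apply]; ring
  simp only [e]
  rw [integral_const_mul, integral_fintype_prod_volume_eq_prod
    (fun s (y : AddCircle (2 * Real.pi)) => (fourier (-k s + h s + l s) y : ℂ))]
  simp only [integral_fourier]
  by_cases hk : h = k - l
  · subst hk
    have h3 : fourierNormalization d ^ 2 * (2 * Real.pi) ^ d = 1 := by
      rw [fourierNormalization, ← Real.rpow_natCast, ← Real.rpow_mul Real.two_pi_pos.le,
        ← Real.rpow_natCast (2 * Real.pi) d, ← Real.rpow_add Real.two_pi_pos]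
      simp
    have : ∀ s, -k s + (k - l) s + l s = 0 := fun s => by
      rw [Pi.sub_apply]; omega
    simp only [this, if_true, Finset.prod_const, Finset.card_univ, Fintype.card_fin]
    calc _ = ((fourierNormalization d * (fourierNormalization d ^ 2 * (2 * Real.pi) ^ d) : ℝ) : ℂ) := by
            push_cast; ring
      _ = _ := by rw [h3, mul_one]
  · rw [if_neg hk]
    obtain ⟨s, hs⟩ := Function.ne_iff.mp hk
    rw [Finset.prod_eq_zero (Finset.mem_univ s), mul_zero]
    rw [if_neg]
    simp only [Pi.sub_apply] at hs
    omega

/-- The term `(l • v_{k-l}) w_l` of the convolution representing `v • ∂w`. -/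
def convTerm (v w : VField d) (k l : Fin d → ℤ) : EuclideanSpace ℂ (Fin d) :=
  (∑ s, (l s : ℂ) * v (k - l) s) • w l

lemma norm_convTerm_le (v w : VField d) (k l : Fin d → ℤ) :
    ‖convTerm v w k l‖ ≤ ‖v (k - l)‖ * (kabs l * ‖w l‖) := by
  rw [convTerm, norm_smul]
  calc _ ≤ (kabs l * ‖v (k - l)‖) * ‖w l‖ := by gcongr; exact norm_dot_le _ _
    _ = _ := by ring

/-- The bijection `(k, l) ↦ (k - l, l)`. -/
def subEquiv (d : ℕ) : (Fin d → ℤ) × (Fin d → ℤ) ≃ (Fin d → ℤ) × (Fin d → ℤ) where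
  toFun p := (p.1 - p.2, p.2)
  invFun p := (p.1 + p.2, p.2)
  left_inv p := by simp
  right_inv p := by simp

lemma summable_sub_mul {a b : (Fin d → ℤ) → ℝ} (ha : Summable a) (hb : Summable b)
    (ha0 : ∀ k, 0 ≤ a k) (hb0 : ∀ k, 0 ≤ b k) :
    Summable fun p : (Fin d → ℤ) × (Fin d → ℤ) => a (p.1 - p.2) * b p.2 :=
  (subEquiv d).summable_iff.mpr (ha.mul_of_nonneg hb ha0 hb0)

lemma tsum_sub_mul {a b : (Fin d → ℤ) → ℝ} (ha : Summable a) (hb : Summable b)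
    (ha0 : ∀ k, 0 ≤ a k) (hb0 : ∀ k, 0 ≤ b k) :
    ∑' p : (Fin d → ℤ) × (Fin d → ℤ), a (p.1 - p.2) * b p.2 = (∑' k, a k) * ∑' k, b k := by
  rw [ha.tsum_mul_tsum hb (ha.mul_of_nonneg hb ha0 hb0)]
  exact (subEquiv d).tsum_eq (fun p => a p.1 * b p.2)

lemma summable_convTerm {v w : VField d} (hv : Summable fun k => ‖v k‖)
    (hw : Summable fun k => kabs k * ‖w k‖) (k : Fin d → ℤ) : Summable (convTerm v w k) := by
  have := summable_sub_mul hv hw (fun _ => norm_nonneg _)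
    (fun k => mul_nonneg (kabs_nonneg k) (norm_nonneg _))
  exact Summable.of_norm_bounded (this.prod_factor k) (norm_convTerm_le v w k)

lemma summable_expo_smul {v : VField d} (hv : Summable fun k => ‖v k‖) (x : Torus d) :
    Summable fun k => ‖expo k x • v k‖ := by
  simp only [norm_smul, norm_expo]
  exact hv.mul_left _

lemma summable_norm_pderiv {w : VField d} (hw : Summable fun k => kabs k * ‖w k‖) (s : Fin d) :
    Summable fun k => ‖pderiv s w k‖ := by
  refine Summable.of_nonneg_of_le (fun _ => norm_nonneg _) (fun k => ?_) hw
  rw [pderiv, norm_smul]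
  gcongr
  simpa using abs_apply_le_kabs k s

lemma hasSum_smul_of_summable_norm {ι κ F : Type*} [NormedAddCommGroup F] [NormedSpace ℂ F]
    [CompleteSpace F] {f : ι → ℂ} {g : κ → F} {a : ℂ} {b : F} (hf : HasSum f a) (hg : HasSum g b)
    (hf' : Summable fun i => ‖f i‖) (hg' : Summable fun i => ‖g i‖) :
    HasSum (fun p : ι × κ => f p.1 • g p.2) (a • b) := by
  have h12 : Summable fun p : ι × κ => f p.1 • g p.2 :=
    Summable.of_norm_bounded (hf'.mul_of_nonneg hg' (fun _ => norm_nonneg _)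
      (fun _ => norm_nonneg _)) fun p => le_of_eq (norm_smul _ _)
  exact hf.smul hg h12

lemma advect_eq_tsum {v w : VField d} (hv : Summable fun k => ‖v k‖)
    (hw : Summable fun k => kabs k * ‖w k‖) (x : Torus d) :
    advect v w x = ∑' p : (Fin d → ℤ) × (Fin d → ℤ), (expo p.1 x * expo p.2 x) •
      (Complex.I • ((∑ s, (p.2 s : ℂ) * v p.1 s) • w p.2)) := by
  have key : ∀ s, HasSum (fun p : (Fin d → ℤ) × (Fin d → ℤ) =>
      (expo p.1 x * v p.1 s) • (expo p.2 x • pderiv s w p.2))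
      (evalAt v x s • evalAt (pderiv s w) x) := by
    intro s
    have h1 : HasSum (fun k => expo k x * v k s) (evalAt v x s) := by
      have := (summable_expo_smul hv x).of_norm.hasSum
      have h := this.mapL (EuclideanSpace.proj s : EuclideanSpace ℂ (Fin d) →L[ℂ] ℂ)
      simp only [PiLp.proj_apply, PiLp.smul_apply, smul_eq_mul] at h
      exact h
    have h1n : Summable fun k => ‖expo k x * v k s‖ := by
      refine Summable.of_nonneg_of_le (fun _ => norm_nonneg _) (fun k => ?_) (summable_expo_smul hv x)
      simpa only [PiLp.smul_apply, smul_eq_mul] using PiLp.norm_apply_le (expo k x • v k) s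
    have h2n := summable_expo_smul (summable_norm_pderiv hw s) x
    have h2 : HasSum (fun k => expo k x • pderiv s w k) (evalAt (pderiv s w) x) :=
      h2n.of_norm.hasSum
    exact hasSum_smul_of_summable_norm (f := fun k => expo k x * v k s)
      (g := fun k => expo k x • pderiv s w k) h1 h2 h1n h2n
  have hs := hasSum_sum (s := Finset.univ) fun s _ => key s
  rw [advect, ← hs.tsum_eq]
  refine tsum_congr fun p => ?_
  simp only [pderiv, smul_smul, Finset.mul_sum, ← Finset.sum_smul]
  congr 1
  exact Finset.sum_congr rfl fun s _ => by ring

/-- The double series for `v • ∂w` converges absolutely and uniformly in `x`, so it may be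
integrated term by term. Orthogonality then keeps only the pairs `(k - l, l)`. -/
lemma coeffs_advect {v w : VField d} (hv : Summable fun k => ‖v k‖)
    (hw : Summable fun k => kabs k * ‖w k‖) (k : Fin d → ℤ) :
    coeffs (advect v w) k =
      ((fourierNormalization d : ℂ) * Complex.I) • ∑' l, convTerm v w k l := by
  set A : (Fin d → ℤ) × (Fin d → ℤ) → EuclideanSpace ℂ (Fin d) := fun p =>
    Complex.I • ((∑ s, (p.2 s : ℂ) * v p.1 s) • w p.2) with hA
  have hAn : ∀ p, ‖A p‖ ≤ ‖v p.1‖ * (kabs p.2 * ‖w p.2‖) := by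
    intro p
    simp only [hA, norm_smul, Complex.norm_I, one_mul]
    calc _ ≤ (kabs p.2 * ‖v p.1‖) * ‖w p.2‖ := by gcongr; exact norm_dot_le _ _
      _ = _ := by ring
  have hAs : Summable fun p => ‖A p‖ := Summable.of_nonneg_of_le (fun _ => norm_nonneg _) hAn
    (hv.mul_of_nonneg hw (fun _ => norm_nonneg _)
      (fun k => mul_nonneg (kabs_nonneg k) (norm_nonneg _)))
  set F : (Fin d → ℤ) × (Fin d → ℤ) → Torus d → EuclideanSpace ℂ (Fin d) := fun p x =>
    (expo (-k) x * (expo p.1 x * expo p.2 x)) • A p with hF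
  have hcont : ∀ p, Continuous (F p) := fun p => by
    have := continuous_expo (-k); have := continuous_expo p.1; have := continuous_expo p.2
    simp only [hF]; fun_prop
  have hFn : ∀ p x, ‖F p x‖ = fourierNormalization d ^ 3 * ‖A p‖ := fun p x => by
    simp only [hF, norm_smul, norm_mul, norm_expo]; ring
  have hsum : Summable fun p => ∫ x, ‖F p x‖ := by
    simp only [hFn, integral_const]
    exact (hAs.mul_left _).const_smul _
  have hFint : ∀ p, Integrable (F p) := fun p =>
    (hcont p).integrable_of_hasCompactSupport (HasCompactSupport.of_compactSpace _)
  have h1 : coeffs (advect v w) k = ∑' p, ∫ x, F p x := by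
    rw [integral_tsum_of_summable_integral_norm hFint hsum, coeffs]
    refine integral_congr_ae (Eventually.of_forall fun x => ?_)
    simp only [advect_eq_tsum hv hw x, hF]
    rw [← tsum_const_smul'' ]
    refine tsum_congr fun p => ?_
    rw [smul_smul]
  have h2 : ∀ p, ∫ x, F p x = if p.1 = k - p.2 then (fourierNormalization d : ℂ) • A p else 0 := by
    intro p
    simp only [hF]
    rw [integral_smul_const, integral_expo_mul]
    split_ifs <;> simp
  rw [h1]
  simp only [h2]
  have hinj : Function.Injective (fun l : Fin d → ℤ => (k - l, l)) := fun a b h => (Prod.mk.inj h).2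
  rw [← hinj.tsum_eq (f := fun p : (Fin d → ℤ) × (Fin d → ℤ) =>
    if p.1 = k - p.2 then (fourierNormalization d : ℂ) • A p else 0)]
  · simp only [if_true]
    rw [← tsum_const_smul'']
    refine tsum_congr fun l => ?_
    simp only [hA, convTerm, smul_smul]
    ring_nf
  · intro p hp
    simp only [Function.mem_support, ne_eq, ite_eq_right_iff, Classical.not_imp] at hp
    exact ⟨p.2, Prod.ext hp.1.symm rfl⟩

/-- The Leray projection of the `k`-th Fourier coefficient. -/
def lerayAt (k : Fin d → ℤ) : EuclideanSpace ℂ (Fin d) →ₗ[ℂ] EuclideanSpace ℂ (Fin d) where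
  toFun x := x - ((∑ s, (k s : ℂ) * x s) / ((kabs k ^ 2 : ℝ) : ℂ)) •
    WithLp.toLp 2 (fun s => (k s : ℂ))
  map_add' x y := by
    simp only [PiLp.add_apply, mul_add, Finset.sum_add_distrib, add_div, add_smul]; abel
  map_smul' c x := by
    simp only [PiLp.smul_apply, smul_eq_mul, RingHom.id_apply, smul_sub, smul_smul]
    congr 2
    rw [← mul_div_assoc, Finset.mul_sum]
    congr 1
    exact Finset.sum_congr rfl fun s _ => by ring

lemma lerayAt_zero (x : EuclideanSpace ℂ (Fin d)) : lerayAt 0 x = x := by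
  simp [lerayAt]

lemma sum_mul_lerayAt (k : Fin d → ℤ) (x : EuclideanSpace ℂ (Fin d)) :
    ∑ s, (k s : ℂ) * lerayAt k x s = 0 := by
  by_cases hk : k = 0
  · subst hk; simp
  have h2 : ((kabs k ^ 2 : ℝ) : ℂ) = ∑ s, (k s : ℂ) * (k s : ℂ) := by
    rw [kabs, Real.sq_sqrt (Finset.sum_nonneg fun _ _ => sq_nonneg _)]
    push_cast
    exact Finset.sum_congr rfl fun s _ => by ring
  have h0 : ((kabs k ^ 2 : ℝ) : ℂ) ≠ 0 := by
    have := kabs_pos hk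
    exact_mod_cast (pow_pos this 2).ne'
  simp only [lerayAt, LinearMap.coe_mk, AddHom.coe_mk, PiLp.sub_apply, PiLp.smul_apply, smul_eq_mul,
    mul_sub, Finset.sum_sub_distrib]
  rw [sub_eq_zero]
  have : ∀ s, (k s : ℂ) * ((∑ s, (k s : ℂ) * x s) / ((kabs k ^ 2 : ℝ) : ℂ) * (k s : ℂ)) =
    (∑ s, (k s : ℂ) * x s) / ((kabs k ^ 2 : ℝ) : ℂ) * ((k s : ℂ) * (k s : ℂ)) := fun s => by ring
  simp only [this, ← Finset.mul_sum, ← h2]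
  field_simp

/-- The triangle inequality gives the crude constant `2`; any fixed constant serves the estimates
below. -/
lemma norm_lerayAt_le (k : Fin d → ℤ) (x : EuclideanSpace ℂ (Fin d)) :
    ‖lerayAt k x‖ ≤ 2 * ‖x‖ := by
  by_cases hk : k = 0
  · subst hk; rw [lerayAt_zero]; linarith [norm_nonneg x]
  have h0 := kabs_pos hk
  have h1 : ‖(WithLp.toLp 2 (fun s => (k s : ℂ)) : EuclideanSpace ℂ (Fin d))‖ = kabs k := by
    simp [EuclideanSpace.norm_eq, kabs]
  have h2 : ‖((kabs k ^ 2 : ℝ) : ℂ)‖ = kabs k ^ 2 := by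
    rw [Complex.norm_real, Real.norm_of_nonneg (sq_nonneg _)]
  have h3 : ‖((∑ s, (k s : ℂ) * x s) / ((kabs k ^ 2 : ℝ) : ℂ)) •
      (WithLp.toLp 2 (fun s => (k s : ℂ)) : EuclideanSpace ℂ (Fin d))‖ ≤ ‖x‖ := by
    rw [norm_smul, norm_div, h1, h2]
    calc _ ≤ kabs k * ‖x‖ / kabs k ^ 2 * kabs k := by gcongr; exact norm_dot_le _ _
      _ = ‖x‖ := by field_simp
  calc ‖lerayAt k x‖ ≤ ‖x‖ + ‖x‖ := (norm_sub_le _ _).trans (by gcongr)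
    _ = _ := by ring

/-- The projection changes `x` by a multiple of `k`, which is orthogonal to `w`. -/
lemma inner_lerayAt (k : Fin d → ℤ) {w : EuclideanSpace ℂ (Fin d)}
    (hw : ∑ s, (k s : ℂ) * w s = 0) (x : EuclideanSpace ℂ (Fin d)) :
    inner ℂ (lerayAt k x) w = inner ℂ x w := by
  have : inner ℂ (WithLp.toLp 2 (fun s => (k s : ℂ)) : EuclideanSpace ℂ (Fin d)) w = 0 := by
    rw [← hw]; simp [PiLp.inner_apply, mul_comm]
  simp only [lerayAt, LinearMap.coe_mk, AddHom.coe_mk, inner_sub_left, inner_smul_left, this,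
    mul_zero, sub_zero]

lemma bilin_apply {v w : VField d} (hv : Summable fun k => ‖v k‖)
    (hw : Summable fun k => kabs k * ‖w k‖) (k : Fin d → ℤ) :
    bilin v w k = -((fourierNormalization d : ℂ) * Complex.I) •
      lerayAt k (∑' l, convTerm v w k l) := by
  have : bilin v w k = -lerayAt k (coeffs (advect v w) k) := rfl
  rw [this, coeffs_advect hv hw, map_smul, neg_smul]

/-! ### Weighted `ℓ²` spaces and the linear structure of `H^n`. -/

/-- The Hilbert space of square summable families of coefficients. -/
abbrev L2 (d : ℕ) : Type := lp (fun _ : Fin d → ℤ => EuclideanSpace ℂ (Fin d)) 2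

/-- `∑_k φ(k)² |v_k|² < ∞`. -/
def SumW (φ : (Fin d → ℤ) → ℝ) (v : VField d) : Prop := Summable fun k => φ k ^ 2 * ‖v k‖ ^ 2

lemma sumW_iff_memℓp {φ : (Fin d → ℤ) → ℝ} {v : VField d} :
    SumW φ v ↔ Memℓp (fun k => φ k • v k) 2 := by
  rw [memℓp_gen_iff (by norm_num), SumW]
  refine summable_congr fun k => ?_
  simp [norm_smul, mul_pow]

open Classical in
/-- The family `φ(k) v_k` as an element of the Hilbert space of square summable families. -/
def embW (φ : (Fin d → ℤ) → ℝ) (v : VField d) : L2 d :=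
  if h : Memℓp (fun k => φ k • v k) 2 then ⟨fun k => φ k • v k, h⟩ else 0

lemma embW_apply {φ : (Fin d → ℤ) → ℝ} {v : VField d} (h : SumW φ v) (k : Fin d → ℤ) :
    embW φ v k = φ k • v k := by
  rw [embW, dif_pos (sumW_iff_memℓp.mp h)]

lemma SumW.add {φ : (Fin d → ℤ) → ℝ} {v w : VField d} (hv : SumW φ v) (hw : SumW φ w) :
    SumW φ (v + w) := by
  rw [sumW_iff_memℓp] at *
  convert hv.add hw using 1
  funext k; simp

lemma SumW.smul {φ : (Fin d → ℤ) → ℝ} {v : VField d} (hv : SumW φ v) (c : ℝ) :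
    SumW φ (c • v) := by
  rw [sumW_iff_memℓp] at *
  convert hv.const_smul c using 1
  funext k; exact smul_comm (φ k) c (v k)

lemma SumW.neg {φ : (Fin d → ℤ) → ℝ} {v : VField d} (hv : SumW φ v) : SumW φ (-v) := by
  simpa using hv.smul (-1)

lemma SumW.sub {φ : (Fin d → ℤ) → ℝ} {v w : VField d} (hv : SumW φ v) (hw : SumW φ w) :
    SumW φ (v - w) := by
  rw [sub_eq_add_neg]; exact hv.add hw.neg

lemma embW_add {φ : (Fin d → ℤ) → ℝ} {v w : VField d} (hv : SumW φ v) (hw : SumW φ w) :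
    embW φ (v + w) = embW φ v + embW φ w := by
  ext1; funext k
  simp [embW_apply hv, embW_apply hw, embW_apply (hv.add hw)]

lemma embW_sub {φ : (Fin d → ℤ) → ℝ} {v w : VField d} (hv : SumW φ v) (hw : SumW φ w) :
    embW φ (v - w) = embW φ v - embW φ w := by
  ext1; funext k
  simp [embW_apply hv, embW_apply hw, embW_apply (hv.sub hw), smul_sub]

lemma embW_smul {φ : (Fin d → ℤ) → ℝ} {v : VField d} (hv : SumW φ v) (c : ℝ) :
    embW φ (c • v) = c • embW φ v := by
  ext1; funext k
  rw [embW_apply (hv.smul c), lp.coeFn_smul, Pi.smul_apply, Pi.smul_apply, embW_apply hv]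
  exact smul_comm _ _ _

lemma norm_sq_L2 (x : L2 d) : ‖x‖ ^ 2 = ∑' k, ‖x k‖ ^ 2 := by
  have := lp.norm_rpow_eq_tsum (p := 2) (by norm_num) x
  simpa using this

/-- No summability is assumed: without it `embW` and the `tsum` both take the default value `0`.
This is what makes `norm_emb` unconditional. -/
lemma norm_embW_sq (φ : (Fin d → ℤ) → ℝ) (v : VField d) :
    ‖embW φ v‖ ^ 2 = ∑' k, φ k ^ 2 * ‖v k‖ ^ 2 := by
  by_cases h : SumW φ v
  · rw [norm_sq_L2]
    refine tsum_congr fun k => ?_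
    simp [embW_apply h, norm_smul, mul_pow]
  · rw [tsum_eq_zero_of_not_summable h, embW, dif_neg (fun h' => h (sumW_iff_memℓp.mpr h'))]
    simp

lemma re_inner_eq (x y : EuclideanSpace ℂ (Fin d)) : (inner ℂ x y).re = inner ℝ x y := by
  simp [PiLp.inner_apply]

lemma inner_embW {φ : (Fin d → ℤ) → ℝ} {v w : VField d} (hv : SumW φ v) (hw : SumW φ w) :
    inner ℝ (embW φ v) (embW φ w) = ∑' k, φ k ^ 2 * (inner ℂ (v k) (w k)).re := by
  rw [lp.inner_eq_tsum]
  refine tsum_congr fun k => ?_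
  rw [embW_apply hv, embW_apply hw, real_inner_smul_left, real_inner_smul_right, re_inner_eq]
  ring

lemma norm_embW_mono {φ ψ : (Fin d → ℤ) → ℝ} {v : VField d} (hψ : SumW ψ v)
    (h : ∀ k, φ k ^ 2 * ‖v k‖ ^ 2 ≤ ψ k ^ 2 * ‖v k‖ ^ 2) :
    SumW φ v ∧ ‖embW φ v‖ ≤ ‖embW ψ v‖ := by
  have h1 : SumW φ v :=
    Summable.of_nonneg_of_le (fun k => mul_nonneg (sq_nonneg _) (sq_nonneg _)) h hψ
  refine ⟨h1, ?_⟩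
  rw [← sq_le_sq₀ (norm_nonneg _) (norm_nonneg _), norm_embW_sq, norm_embW_sq]
  exact h1.tsum_le_tsum h hψ

/-- The Sobolev weight `|k|^n`. -/
def sobW (n : ℝ) (k : Fin d → ℤ) : ℝ := kabs k ^ n

lemma sobW_sq (n : ℝ) (k : Fin d → ℤ) : sobW n k ^ 2 = kabs k ^ (2 * n) := sq_kabs_rpow k n

lemma norm_emb (n : ℝ) (v : VField d) : ‖embW (sobW n) v‖ = normH n v := by
  rw [← Real.sqrt_sq (norm_nonneg _), norm_embW_sq, normH]
  simp only [sobW_sq]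

lemma sumW_sobW_iff {n : ℝ} {v : VField d} :
    SumW (sobW n) v ↔ Summable fun k => kabs k ^ (2 * n) * ‖v k‖ ^ 2 := by
  simp only [SumW, sobW_sq]

lemma MemH.sumW {n : ℝ} {v : VField d} (h : MemH n v) : SumW (sobW n) v :=
  sumW_sobW_iff.mpr h.summable

lemma inner_emb {n : ℝ} {v w : VField d} (hv : MemH n v) (hw : MemH n w) :
    inner ℝ (embW (sobW n) v) (embW (sobW n) w) = innerH n v w := by
  rw [inner_embW hv.sumW hw.sumW, innerH]
  simp only [sobW_sq]

lemma MemH.zero (n : ℝ) : MemH n (0 : VField d) :=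
  ⟨fun k r => by simp, rfl, fun k => by simp, by simp⟩

lemma MemH.add {n : ℝ} {v w : VField d} (hv : MemH n v) (hw : MemH n w) : MemH n (v + w) :=
  ⟨fun k r => by simp [hv.real, hw.real], by simp [hv.mean, hw.mean],
    fun k => by simp [mul_add, Finset.sum_add_distrib, hv.div, hw.div],
    sumW_sobW_iff.mp (hv.sumW.add hw.sumW)⟩

lemma MemH.smul {n : ℝ} {v : VField d} (hv : MemH n v) (c : ℝ) : MemH n (c • v) :=
  ⟨fun k r => by simp [hv.real], by simp [hv.mean],
    fun k => by
      have := congrArg (fun z => (c : ℂ) * z) (hv.div k)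
      simp only [Finset.mul_sum, mul_zero] at this
      rw [← this]
      exact Finset.sum_congr rfl fun s _ => by simp; ring,
    sumW_sobW_iff.mp (hv.sumW.smul c)⟩

lemma MemH.neg {n : ℝ} {v : VField d} (hv : MemH n v) : MemH n (-v) := by
  simpa using hv.smul (-1)

lemma MemH.sub {n : ℝ} {v w : VField d} (hv : MemH n v) (hw : MemH n w) : MemH n (v - w) := by
  rw [sub_eq_add_neg]; exact hv.add hw.neg

lemma normH_add_le {n : ℝ} {v w : VField d} (hv : MemH n v) (hw : MemH n w) :
    normH n (v + w) ≤ normH n v + normH n w := by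
  simp only [← norm_emb, embW_add hv.sumW hw.sumW]; exact norm_add_le _ _

lemma normH_sub_le {n : ℝ} {v w : VField d} (hv : MemH n v) (hw : MemH n w) :
    normH n (v - w) ≤ normH n v + normH n w := by
  simp only [← norm_emb, embW_sub hv.sumW hw.sumW]; exact norm_sub_le _ _

lemma normH_smul {n : ℝ} {v : VField d} (hv : MemH n v) (c : ℝ) :
    normH n (c • v) = |c| * normH n v := by
  simp only [← norm_emb, embW_smul hv.sumW, norm_smul, Real.norm_eq_abs]

lemma normH_zero (n : ℝ) : normH n (0 : VField d) = 0 := by simp [normH]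

lemma normH_sub_comm (n : ℝ) (v w : VField d) : normH n (v - w) = normH n (w - v) := by
  simp only [normH, Pi.sub_apply, norm_sub_rev]

lemma MemH.eq_zero_of_normH_eq_zero {n : ℝ} {v : VField d} (hv : MemH n v) (h : normH n v = 0) :
    v = 0 := by
  have h1 : ∑' k, kabs k ^ (2 * n) * ‖v k‖ ^ 2 = 0 := by rw [← normH_sq, h]; simp
  have h2 := (hasSum_zero_iff_of_nonneg (fun k => mul_nonneg
    (Real.rpow_nonneg (kabs_nonneg k) (2 * n)) (sq_nonneg ‖v k‖))).mp (h1 ▸ hv.summable.hasSum)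
  funext k
  by_cases hk : k = 0
  · subst hk; simp [hv.mean]
  · have := congrFun h2 k
    simpa [(Real.rpow_pos_of_pos (kabs_pos hk) (2 * n)).ne'] using this

/-! ### Algebraic properties of `𝒫`: bilinearity, reality, zero mean, zero divergence. -/

lemma MemH.bilin_apply {n : ℝ} (hn : (d : ℝ) / 2 + 1 < n) {v w : VField d} (hv : MemH n v)
    (hw : MemH n w) (k : Fin d → ℤ) :
    bilin v w k = -((fourierNormalization d : ℂ) * Complex.I) •
      lerayAt k (∑' l, convTerm v w k l) :=
  EulerNS.bilin_apply (hv.summable_norm hn).1 (hw.summable_kabs_mul hn).1 k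

lemma MemH.summable_convTerm {n : ℝ} (hn : (d : ℝ) / 2 + 1 < n) {v w : VField d} (hv : MemH n v)
    (hw : MemH n w) (k : Fin d → ℤ) : Summable (convTerm v w k) :=
  EulerNS.summable_convTerm (hv.summable_norm hn).1 (hw.summable_kabs_mul hn).1 k

lemma bilin_add_left {n : ℝ} (hn : (d : ℝ) / 2 + 1 < n) {v v' w : VField d} (hv : MemH n v)
    (hv' : MemH n v') (hw : MemH n w) : bilin (v + v') w = bilin v w + bilin v' w := by
  funext k
  rw [Pi.add_apply, (hv.add hv').bilin_apply hn hw, hv.bilin_apply hn hw, hv'.bilin_apply hn hw,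
    ← smul_add, ← map_add,
    ← (hv.summable_convTerm hn hw k).tsum_add (hv'.summable_convTerm hn hw k)]
  congr 3
  funext l
  simp [convTerm, mul_add, Finset.sum_add_distrib, add_smul]

lemma bilin_add_right {n : ℝ} (hn : (d : ℝ) / 2 + 1 < n) {v w w' : VField d} (hv : MemH n v)
    (hw : MemH n w) (hw' : MemH n w') : bilin v (w + w') = bilin v w + bilin v w' := by
  funext k
  rw [Pi.add_apply, hv.bilin_apply hn (hw.add hw'), hv.bilin_apply hn hw, hv.bilin_apply hn hw',
    ← smul_add, ← map_add,
    ← (hv.summable_convTerm hn hw k).tsum_add (hv.summable_convTerm hn hw' k)]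
  congr 3
  funext l
  simp [convTerm]

lemma bilin_smul_left {n : ℝ} (hn : (d : ℝ) / 2 + 1 < n) {v w : VField d} (hv : MemH n v)
    (hw : MemH n w) (c : ℝ) : bilin (c • v) w = c • bilin v w := by
  funext k
  have h : ∀ l, convTerm (c • v) w k l = (c : ℂ) • convTerm v w k l := fun l => by
    simp only [convTerm, Pi.smul_apply, PiLp.smul_apply, Complex.real_smul, smul_smul,
      Finset.mul_sum]
    congr 1
    exact Finset.sum_congr rfl fun s _ => by ring
  rw [Pi.smul_apply, (hv.smul c).bilin_apply hn hw, hv.bilin_apply hn hw]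
  simp only [h]
  rw [tsum_const_smul'', map_smul, smul_comm]
  exact Complex.coe_smul c _

lemma bilin_smul_right {n : ℝ} (hn : (d : ℝ) / 2 + 1 < n) {v w : VField d} (hv : MemH n v)
    (hw : MemH n w) (c : ℝ) : bilin v (c • w) = c • bilin v w := by
  funext k
  have h : ∀ l, convTerm v (c • w) k l = (c : ℂ) • convTerm v w k l := fun l => by
    simp only [convTerm, Pi.smul_apply]
    rw [smul_comm, Complex.coe_smul]
  rw [Pi.smul_apply, hv.bilin_apply hn (hw.smul c), hv.bilin_apply hn hw]
  simp only [h]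
  rw [tsum_const_smul'', map_smul, smul_comm]
  exact Complex.coe_smul c _

lemma bilin_sub_left {n : ℝ} (hn : (d : ℝ) / 2 + 1 < n) {v v' w : VField d} (hv : MemH n v)
    (hv' : MemH n v') (hw : MemH n w) : bilin (v - v') w = bilin v w - bilin v' w := by
  rw [eq_sub_iff_add_eq, ← bilin_add_left hn (hv.sub hv') hv' hw, sub_add_cancel]

lemma bilin_sub_right {n : ℝ} (hn : (d : ℝ) / 2 + 1 < n) {v w w' : VField d} (hv : MemH n v)
    (hw : MemH n w) (hw' : MemH n w') : bilin v (w - w') = bilin v w - bilin v w' := by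
  rw [eq_sub_iff_add_eq, ← bilin_add_right hn hv (hw.sub hw') hw', sub_add_cancel]

lemma bilin_sub_bilin {n : ℝ} (hn : (d : ℝ) / 2 + 1 < n) {v w : VField d} (hv : MemH n v)
    (hw : MemH n w) : bilin v v - bilin w w = bilin v (v - w) + bilin (v - w) w := by
  rw [bilin_sub_right hn hv hv hw, bilin_sub_left hn hv hw hw]; abel

/-- Coefficientwise complex conjugation. -/
def conjV (x : EuclideanSpace ℂ (Fin d)) : EuclideanSpace ℂ (Fin d) :=
  WithLp.toLp 2 fun s => (starRingEnd ℂ) (x s)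

@[simp] lemma conjV_apply (x : EuclideanSpace ℂ (Fin d)) (s : Fin d) :
    conjV x s = (starRingEnd ℂ) (x s) := rfl

lemma tsum_apply_V {ι : Type*} {f : ι → EuclideanSpace ℂ (Fin d)} (hf : Summable f) (s : Fin d) :
    (∑' i, f i) s = ∑' i, f i s := by
  have := (EuclideanSpace.proj s : EuclideanSpace ℂ (Fin d) →L[ℂ] ℂ).map_tsum hf
  simpa only [PiLp.proj_apply] using this

lemma lerayAt_neg_conjV (k : Fin d → ℤ) (x : EuclideanSpace ℂ (Fin d)) :
    lerayAt (-k) (conjV x) = conjV (lerayAt k x) := by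
  ext s
  simp [lerayAt, map_sum, neg_div, sub_eq_add_neg]

lemma bilin_real {n : ℝ} (hn : (d : ℝ) / 2 + 1 < n) {v w : VField d} (hv : MemH n v)
    (hw : MemH n w) (k : Fin d → ℤ) (r : Fin d) :
    bilin v w (-k) r = (starRingEnd ℂ) (bilin v w k r) := by
  -- Substitute `l ↦ -l`. The minus sign comes from the factor `l`, that is from the derivative, and
  -- cancels against the conjugation of `i`.
  have h : ∑' l, convTerm v w (-k) l = -conjV (∑' l, convTerm v w k l) := by
    ext s
    rw [tsum_apply_V (hv.summable_convTerm hn hw _), PiLp.neg_apply, conjV_apply,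
      tsum_apply_V (hv.summable_convTerm hn hw _), Complex.conj_tsum, ← tsum_neg,
      ← (Equiv.neg (Fin d → ℤ)).tsum_eq]
    refine tsum_congr fun l => ?_
    have e : -k - -l = -(k - l) := by abel
    simp only [convTerm, Equiv.neg_apply, e, hv.real, PiLp.smul_apply, smul_eq_mul, hw.real,
      map_mul, map_sum, Pi.neg_apply, Int.cast_neg, neg_mul, Finset.sum_neg_distrib, map_intCast]
  rw [hv.bilin_apply hn hw, hv.bilin_apply hn hw, h, map_neg, lerayAt_neg_conjV]
  simp

lemma bilin_mean {n : ℝ} (hn : (d : ℝ) / 2 + 1 < n) {v w : VField d} (hv : MemH n v)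
    (hw : MemH n w) : bilin v w 0 = 0 := by
  rw [hv.bilin_apply hn hw]
  -- At `k = 0` the factor is `l • v_{-l}`, which vanishes since `v` is divergence free.
  have : ∀ l, convTerm v w 0 l = 0 := fun l => by
    have h := hv.div (0 - l)
    have h' : ∑ s, (l s : ℂ) * v (0 - l) s = 0 := by
      rw [← neg_eq_zero, ← h, ← Finset.sum_neg_distrib]
      exact Finset.sum_congr rfl fun s _ => by simp
    rw [convTerm, h', zero_smul]
  simp [this]

lemma bilin_div {n : ℝ} (hn : (d : ℝ) / 2 + 1 < n) {v w : VField d} (hv : MemH n v)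
    (hw : MemH n w) (k : Fin d → ℤ) : ∑ s, (k s : ℂ) * bilin v w k s = 0 := by
  rw [hv.bilin_apply hn hw]
  have := sum_mul_lerayAt k (∑' l, convTerm v w k l)
  have h2 := congrArg (fun z => -((fourierNormalization d : ℂ) * Complex.I) * z) this
  simp only [Finset.mul_sum, mul_zero] at h2
  rw [← h2]
  exact Finset.sum_congr rfl fun s _ => by simp only [PiLp.smul_apply, smul_eq_mul]; ring

/-! ### Young's inequality and Sobolev estimates for `𝒫`. -/

lemma norm_bilin_le {n : ℝ} (hn : (d : ℝ) / 2 + 1 < n) {v w : VField d} (hv : MemH n v)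
    (hw : MemH n w) (k : Fin d → ℤ) :
    ‖bilin v w k‖ ≤ 2 * fourierNormalization d * ∑' l, ‖v (k - l)‖ * (kabs l * ‖w l‖) := by
  rw [hv.bilin_apply hn hw, norm_smul]
  have h1 : ‖-((fourierNormalization d : ℂ) * Complex.I)‖ = fourierNormalization d := by
    simp [abs_of_pos (fourierNormalization_pos d)]
  have hs : Summable fun l => ‖v (k - l)‖ * (kabs l * ‖w l‖) :=
    (summable_sub_mul (hv.summable_norm hn).1 (hw.summable_kabs_mul hn).1 (fun _ => norm_nonneg _)
      (fun k => mul_nonneg (kabs_nonneg k) (norm_nonneg _))).prod_factor k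
  have h2 : ‖∑' l, convTerm v w k l‖ ≤ ∑' l, ‖v (k - l)‖ * (kabs l * ‖w l‖) :=
    tsum_of_norm_bounded hs.hasSum (norm_convTerm_le v w k)
  rw [h1]
  calc _ ≤ fourierNormalization d * (2 * ‖∑' l, convTerm v w k l‖) := by
        gcongr
        · exact (fourierNormalization_pos d).le
        · exact norm_lerayAt_le _ _
    _ ≤ fourierNormalization d * (2 * ∑' l, ‖v (k - l)‖ * (kabs l * ‖w l‖)) := by
        gcongr; exact (fourierNormalization_pos d).le
    _ = _ := by ring

/-- Young's inequality `ℓ¹ * ℓ² ⊆ ℓ²`. -/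
lemma young {a b : (Fin d → ℤ) → ℝ} (ha : Summable a) (hb : Summable fun k => b k ^ 2)
    (ha0 : ∀ k, 0 ≤ a k) (hb0 : ∀ k, 0 ≤ b k) :
    (∀ k, Summable fun l => a (k - l) * b l) ∧
    (Summable fun k => (∑' l, a (k - l) * b l) ^ 2) ∧
    ∑' k, (∑' l, a (k - l) * b l) ^ 2 ≤ (∑' k, a k) ^ 2 * ∑' k, b k ^ 2 := by
  have hP := summable_sub_mul ha hb ha0 (fun k => sq_nonneg _)
  have hA : ∀ k, Summable fun l => a (k - l) := fun k =>
    (Equiv.subLeft k).summable_iff.mpr ha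
  have hAt : ∀ k, ∑' l, a (k - l) = ∑' k, a k := fun k => (Equiv.subLeft k).tsum_eq a
  have e1 : ∀ k l, √(a (k - l)) ^ 2 = a (k - l) := fun k l => Real.sq_sqrt (ha0 _)
  have e2 : ∀ k l, (√(a (k - l)) * b l) ^ 2 = a (k - l) * b l ^ 2 := fun k l => by
    rw [mul_pow, e1]
  -- Splitting `a b = √a · (√a b)` makes Cauchy-Schwarz in `l` yield one full factor `‖a‖₁`;
  -- summation over `k` yields the other.
  have e3 : ∀ k l, √(a (k - l)) * (√(a (k - l)) * b l) = a (k - l) * b l := fun k l => by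
    rw [← mul_assoc, Real.mul_self_sqrt (ha0 _)]
  have key : ∀ k, (Summable fun l => a (k - l) * b l) ∧
      (∑' l, a (k - l) * b l) ^ 2 ≤ (∑' k, a k) * ∑' l, a (k - l) * b l ^ 2 := by
    intro k
    have := summable_mul_and_tsum_le (f := fun l => √(a (k - l))) (g := fun l => √(a (k - l)) * b l)
      (fun l => Real.sqrt_nonneg _) (fun l => mul_nonneg (Real.sqrt_nonneg _) (hb0 _))
      (by simp only [e1]; exact hA k) (by simp only [e2]; exact hP.prod_factor k)
    simp only [e1, e2, e3, hAt] at this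
    refine ⟨this.1, ?_⟩
    have h0 : 0 ≤ ∑' l, a (k - l) * b l := tsum_nonneg fun l => mul_nonneg (ha0 _) (hb0 _)
    calc _ ≤ (√(∑' k, a k) * √(∑' l, a (k - l) * b l ^ 2)) ^ 2 := by gcongr; exact this.2
      _ = _ := by
        rw [mul_pow, Real.sq_sqrt (tsum_nonneg ha0),
          Real.sq_sqrt (tsum_nonneg fun l => mul_nonneg (ha0 _) (sq_nonneg _))]
  have hS : Summable fun k => (∑' k, a k) * ∑' l, a (k - l) * b l ^ 2 := hP.prod.mul_left _
  have h2 : Summable fun k => (∑' l, a (k - l) * b l) ^ 2 :=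
    Summable.of_nonneg_of_le (fun k => sq_nonneg _) (fun k => (key k).2) hS
  refine ⟨fun k => (key k).1, h2, ?_⟩
  calc _ ≤ ∑' k, (∑' k, a k) * ∑' l, a (k - l) * b l ^ 2 := h2.tsum_le_tsum (fun k => (key k).2) hS
    _ = (∑' k, a k) * ∑' p : (Fin d → ℤ) × (Fin d → ℤ), a (p.1 - p.2) * b p.2 ^ 2 := by
        rw [tsum_mul_left, hP.tsum_prod]
    _ = _ := by rw [tsum_sub_mul ha hb ha0 (fun k => sq_nonneg _)]; ring

lemma young_symm {a b : (Fin d → ℤ) → ℝ} (ha : Summable a) (hb : Summable fun k => b k ^ 2)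
    (ha0 : ∀ k, 0 ≤ a k) (hb0 : ∀ k, 0 ≤ b k) :
    (∀ k, Summable fun l => b (k - l) * a l) ∧
    (Summable fun k => (∑' l, b (k - l) * a l) ^ 2) ∧
    ∑' k, (∑' l, b (k - l) * a l) ^ 2 ≤ (∑' k, a k) ^ 2 * ∑' k, b k ^ 2 := by
  have h := young ha hb ha0 hb0
  have e : ∀ k, ∑' l, b (k - l) * a l = ∑' l, a (k - l) * b l := fun k => by
    rw [← (Equiv.subLeft k).tsum_eq]
    exact tsum_congr fun l => by simp [mul_comm]
  simp only [e]
  refine ⟨fun k => ?_, h.2⟩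
  refine (Equiv.subLeft k).summable_iff.mp ((h.1 k).congr fun l => ?_)
  simp [mul_comm]

lemma rpow_add_le_two_rpow {p r s : ℝ} (hp : 0 ≤ p) (hr : 0 ≤ r) (hs : 0 ≤ s) :
    (r + s) ^ p ≤ 2 ^ p * (r ^ p + s ^ p) := by
  have hm : 0 ≤ max r s := le_max_of_le_left hr
  calc (r + s) ^ p ≤ (2 * max r s) ^ p := by
        gcongr
        linarith [le_max_left r s, le_max_right r s]
    _ = 2 ^ p * (max r s) ^ p := Real.mul_rpow (by norm_num) hm
    _ ≤ _ := by
        gcongr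
        rcases max_cases r s with ⟨h, -⟩ | ⟨h, -⟩ <;> rw [h]
        · linarith [Real.rpow_nonneg hs p]
        · linarith [Real.rpow_nonneg hr p]

/-- The constant in the estimate of `𝒫` on `H^n × H^{n+1}`. -/
def bilinConst (d : ℕ) (n : ℝ) : ℝ := 4 * fourierNormalization d * 2 ^ n * wienerConst d n

lemma bilinConst_nonneg (d : ℕ) (n : ℝ) : 0 ≤ bilinConst d n := by
  have := (fourierNormalization_pos d).le
  have := wienerConst_nonneg d n
  unfold bilinConst; positivity

/-- The weight splits as `|k|^n ≤ 2^n (|k-l|^n + |l|^n)`. Young's inequality applies to each part,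
with the unweighted factor (`|l| |w_l|`, respectively `|v_{k-l}|`) in `ℓ¹` and the weighted one in
`ℓ²`. -/
lemma bilin_sobolev {n : ℝ} (hn : (d : ℝ) / 2 + 1 < n) {v w : VField d} (hv : MemH n v)
    (hw : MemH (n + 1) w) :
    MemH n (bilin v w) ∧ normH n (bilin v w) ≤ bilinConst d n * normH n v * normH (n + 1) w := by
  have hw' : MemH n w := hw.mono (by linarith)
  have hn0 : 0 ≤ n := by have : (0 : ℝ) ≤ d := Nat.cast_nonneg d; linarith
  have hc := (fourierNormalization_pos d).le
  have hW := wienerConst_nonneg d n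
  obtain ⟨s1, t1⟩ := hv.summable_norm hn
  obtain ⟨s2, t2⟩ := hw'.summable_kabs_mul hn
  have e1 : ∀ k, (kabs k ^ n * ‖v k‖) ^ 2 = kabs k ^ (2 * n) * ‖v k‖ ^ 2 := fun k => by
    rw [mul_pow, sq_kabs_rpow]
  have e2 : ∀ k, (kabs k ^ n * (kabs k * ‖w k‖)) ^ 2 = kabs k ^ (2 * (n + 1)) * ‖w k‖ ^ 2 := by
    intro k
    rw [← sq_kabs_rpow, Real.rpow_add_one' (kabs_nonneg k) (by linarith)]
    ring
  have ka := fun k : Fin d → ℤ => Real.rpow_nonneg (kabs_nonneg k) n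
  obtain ⟨p1, p2, p3⟩ := young_symm (a := fun k => kabs k * ‖w k‖) (b := fun k => kabs k ^ n * ‖v k‖)
    s2 (by simp only [e1]; exact hv.summable) (fun k => mul_nonneg (kabs_nonneg k) (norm_nonneg _))
    (fun k => mul_nonneg (ka k) (norm_nonneg _))
  obtain ⟨q1, q2, q3⟩ := young (a := fun k => ‖v k‖) (b := fun k => kabs k ^ n * (kabs k * ‖w k‖))
    s1 (by simp only [e2]; exact hw.summable) (fun k => norm_nonneg _)
    (fun k => mul_nonneg (ka k) (mul_nonneg (kabs_nonneg k) (norm_nonneg _)))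
  simp only [e1] at p3
  simp only [e2] at q3
  rw [← normH_sq] at p3 q3
  set X : (Fin d → ℤ) → ℝ := fun k => ∑' l, kabs (k - l) ^ n * ‖v (k - l)‖ * (kabs l * ‖w l‖) with hX
  set Y : (Fin d → ℤ) → ℝ := fun k => ∑' l, ‖v (k - l)‖ * (kabs l ^ n * (kabs l * ‖w l‖)) with hY
  set c := 2 * fourierNormalization d * 2 ^ n with hcdef
  have hc0 : 0 ≤ c := by positivity
  have hpt : ∀ k, kabs k ^ n * ‖bilin v w k‖ ≤ c * (X k + Y k) := by
    intro k
    have h3 : kabs k ^ n * ∑' l, ‖v (k - l)‖ * (kabs l * ‖w l‖) ≤ 2 ^ n * (X k + Y k) := by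
      rw [hX, hY, ← tsum_mul_left, ← (p1 k).tsum_add (q1 k), ← tsum_mul_left]
      refine Summable.tsum_le_tsum (fun l => ?_) ?_ (((p1 k).add (q1 k)).mul_left _)
      · have := (Real.rpow_le_rpow (kabs_nonneg k) (kabs_le_sub_add k l) hn0).trans
          (rpow_add_le_two_rpow hn0 (kabs_nonneg (k - l)) (kabs_nonneg l))
        have h0 : 0 ≤ ‖v (k - l)‖ * (kabs l * ‖w l‖) :=
          mul_nonneg (norm_nonneg _) (mul_nonneg (kabs_nonneg l) (norm_nonneg _))
        calc _ ≤ 2 ^ n * (kabs (k - l) ^ n + kabs l ^ n) * (‖v (k - l)‖ * (kabs l * ‖w l‖)) := by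
              gcongr
          _ = _ := by ring
      · exact ((summable_sub_mul s1 s2 (fun _ => norm_nonneg _)
          (fun k => mul_nonneg (kabs_nonneg k) (norm_nonneg _))).prod_factor k).mul_left _
    calc _ ≤ kabs k ^ n * (2 * fourierNormalization d * ∑' l, ‖v (k - l)‖ * (kabs l * ‖w l‖)) := by
          gcongr
          · exact ka k
          · exact norm_bilin_le hn hv hw' k
      _ = 2 * fourierNormalization d * (kabs k ^ n * ∑' l, ‖v (k - l)‖ * (kabs l * ‖w l‖)) := by ring
      _ ≤ 2 * fourierNormalization d * (2 ^ n * (X k + Y k)) := by gcongr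
      _ = _ := by rw [hcdef]; ring
  have hpt2 : ∀ k, kabs k ^ (2 * n) * ‖bilin v w k‖ ^ 2 ≤ c ^ 2 * (2 * X k ^ 2 + 2 * Y k ^ 2) := by
    intro k
    rw [← sq_kabs_rpow, ← mul_pow]
    calc _ ≤ (c * (X k + Y k)) ^ 2 := by
          exact pow_le_pow_left₀ (mul_nonneg (ka k) (norm_nonneg _)) (hpt k) 2
      _ = c ^ 2 * (X k + Y k) ^ 2 := by ring
      _ ≤ _ := by gcongr; nlinarith [sq_nonneg (X k - Y k)]
  have hsum : Summable fun k => c ^ 2 * (2 * X k ^ 2 + 2 * Y k ^ 2) :=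
    ((p2.mul_left 2).add (q2.mul_left 2)).mul_left _
  have hmem : Summable fun k => kabs k ^ (2 * n) * ‖bilin v w k‖ ^ 2 :=
    Summable.of_nonneg_of_le (fun k => mul_nonneg (Real.rpow_nonneg (kabs_nonneg k) _)
      (sq_nonneg _)) hpt2 hsum
  refine ⟨⟨bilin_real hn hv hw', bilin_mean hn hv hw', bilin_div hn hv hw', hmem⟩, ?_⟩
  have hwn : normH n w ≤ normH (n + 1) w := hw.normH_mono (by linarith)
  have b0 := normH_nonneg n v
  have b1 := normH_nonneg n w
  have b2 := normH_nonneg (n + 1) w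
  have g1 : (∑' k, kabs k * ‖w k‖) ^ 2 * normH n v ^ 2 ≤
      (wienerConst d n * normH (n + 1) w) ^ 2 * normH n v ^ 2 := by
    gcongr
    · exact tsum_nonneg fun k => mul_nonneg (kabs_nonneg k) (norm_nonneg _)
    · exact t2.trans (by gcongr)
  have g2 : (∑' k, ‖v k‖) ^ 2 * normH (n + 1) w ^ 2 ≤
      (wienerConst d n * normH n v) ^ 2 * normH (n + 1) w ^ 2 := by
    gcongr
  rw [← sq_le_sq₀ (normH_nonneg _ _) (by
    have := bilinConst_nonneg d n; positivity), normH_sq]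
  calc _ ≤ ∑' k, c ^ 2 * (2 * X k ^ 2 + 2 * Y k ^ 2) := hmem.tsum_le_tsum hpt2 hsum
    _ = c ^ 2 * (2 * ∑' k, X k ^ 2 + 2 * ∑' k, Y k ^ 2) := by
        rw [tsum_mul_left, (p2.mul_left 2).tsum_add (q2.mul_left 2), tsum_mul_left, tsum_mul_left]
    _ ≤ c ^ 2 * (2 * ((wienerConst d n * normH (n + 1) w) ^ 2 * normH n v ^ 2) +
          2 * ((wienerConst d n * normH n v) ^ 2 * normH (n + 1) w ^ 2)) := by
        gcongr
        · exact p3.trans g1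
        · exact q3.trans g2
    _ = _ := by rw [hcdef, bilinConst]; ring

/-- The derivative falls on `w`, whose gradient has an `ℓ¹` Fourier series, so only the `L²` norm of
`v` is needed. The constant is enlarged at the end merely to reuse `bilinConst`. -/
lemma bilin_L2 {n : ℝ} (hn : (d : ℝ) / 2 + 1 < n) {v w : VField d} (hv : MemH n v)
    (hw : MemH (n + 1) w) : normH 0 (bilin v w) ≤ bilinConst d n * normH n w * normH 0 v := by
  have hw' : MemH n w := hw.mono (by linarith)
  have hn0 : 0 ≤ n := by have : (0 : ℝ) ≤ d := Nat.cast_nonneg d; linarith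
  have hc := (fourierNormalization_pos d).le
  have hW := wienerConst_nonneg d n
  obtain ⟨s2, t2⟩ := hw'.summable_kabs_mul hn
  have hv0 : MemH 0 v := hv.mono hn0
  have e0 : ∀ u : VField d, normH 0 u ^ 2 = ∑' k, ‖u k‖ ^ 2 := fun u => by simp [normH_sq]
  have hvs : Summable fun k => ‖v k‖ ^ 2 := by simpa using hv0.summable
  have hbs : Summable fun k => ‖bilin v w k‖ ^ 2 := by
    simpa using ((bilin_sobolev hn hv hw).1.mono hn0).summable
  obtain ⟨p1, p2, p3⟩ := young_symm (a := fun k => kabs k * ‖w k‖) (b := fun k => ‖v k‖)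
    s2 hvs (fun k => mul_nonneg (kabs_nonneg k) (norm_nonneg _)) (fun k => norm_nonneg _)
  have b1 := normH_nonneg n w
  have b2 := normH_nonneg 0 v
  have h2n : (1 : ℝ) ≤ 2 ^ n := Real.one_le_rpow (by norm_num) hn0
  have hle : normH 0 (bilin v w) ≤
      2 * fourierNormalization d * (wienerConst d n * normH n w) * normH 0 v := by
    rw [← sq_le_sq₀ (normH_nonneg _ _) (by positivity), e0]
    calc _ ≤ ∑' k, (2 * fourierNormalization d) ^ 2 *
            (∑' l, ‖v (k - l)‖ * (kabs l * ‖w l‖)) ^ 2 := by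
          refine hbs.tsum_le_tsum (fun k => ?_) (p2.mul_left _)
          rw [← mul_pow]
          gcongr
          exact norm_bilin_le hn hv hw' k
      _ = (2 * fourierNormalization d) ^ 2 * ∑' k, (∑' l, ‖v (k - l)‖ * (kabs l * ‖w l‖)) ^ 2 :=
          tsum_mul_left
      _ ≤ (2 * fourierNormalization d) ^ 2 * ((∑' k, kabs k * ‖w k‖) ^ 2 * ∑' k, ‖v k‖ ^ 2) := by
          gcongr
      _ ≤ (2 * fourierNormalization d) ^ 2 * ((wienerConst d n * normH n w) ^ 2 * normH 0 v ^ 2) := by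
          rw [e0]
          gcongr
          exact tsum_nonneg fun k => mul_nonneg (kabs_nonneg k) (norm_nonneg _)
      _ = _ := by ring
  refine hle.trans ?_
  have : 2 * fourierNormalization d * (wienerConst d n * normH n w) * normH 0 v * 1 ≤
      2 * fourierNormalization d * (wienerConst d n * normH n w) * normH 0 v * (2 * 2 ^ n) := by
    gcongr; linarith
  rw [bilinConst]
  linarith

/-! ### Antisymmetry of the advection term and the commutator estimate. -/

/-- The contribution of the pair `(k, l)` to the energy balance `⟨𝒫(v,w) | w⟩`. -/
def energyTerm (v w : VField d) (k l : Fin d → ℤ) : ℝ :=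
  (inner ℂ (-Complex.I • convTerm v w k l) (w k)).re

/-- As `v` is divergence free, `k • v_{k-l} = l • v_{k-l}`; as it is real, `v_{l-k}` is the
conjugate of `v_{k-l}`. So the swap conjugates both the coefficient and the inner product, and the
factor `i` in front turns this into a change of sign of the real part. -/
lemma energyTerm_swap {n : ℝ} {v w : VField d} (hv : MemH n v) (k l : Fin d → ℤ) :
    energyTerm v w l k = -energyTerm v w k l := by
  have h1 : ∑ s, (k s : ℂ) * v (l - k) s = (starRingEnd ℂ) (∑ s, (l s : ℂ) * v (k - l) s) := by
    have e : l - k = -(k - l) := by abel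
    have h := hv.div (k - l)
    simp only [Pi.sub_apply, Int.cast_sub, sub_mul, Finset.sum_sub_distrib, sub_eq_zero] at h
    rw [← h, map_sum, e]
    exact Finset.sum_congr rfl fun s _ => by rw [hv.real (k - l)]; simp
  simp only [energyTerm, convTerm, h1, smul_smul, inner_smul_left]
  have hz : inner ℂ (w k) (w l) = (starRingEnd ℂ) (inner ℂ (w l) (w k)) :=
    (inner_conj_symm _ _).symm
  rw [hz]
  generalize ∑ s, (l s : ℂ) * v (k - l) s = D
  generalize inner ℂ (w l) (w k) = z
  simp [Complex.mul_re, Complex.mul_im]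
  ring

lemma abs_energyTerm_le (v w : VField d) (k l : Fin d → ℤ) :
    |energyTerm v w k l| ≤ ‖v (k - l)‖ * (kabs l * ‖w l‖) * ‖w k‖ := by
  refine (Complex.abs_re_le_norm _).trans ((norm_inner_le_norm _ _).trans ?_)
  gcongr
  rw [norm_smul]
  simpa using norm_convTerm_le v w k l

lemma re_inner_bilin {n : ℝ} (hn : (d : ℝ) / 2 + 1 < n) {v w : VField d} (hv : MemH n v)
    (hw : MemH n w) (k : Fin d → ℤ) :
    (inner ℂ (bilin v w k) (w k)).re = fourierNormalization d * ∑' l, energyTerm v w k l := by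
  have hs := (hv.summable_convTerm hn hw k).const_smul (-Complex.I)
  have h1 : ∑' l, energyTerm v w k l =
      (inner ℂ (∑' l, -Complex.I • convTerm v w k l) (w k)).re := by
    rw [re_inner_eq, real_inner_comm]
    have := (innerSL ℝ (w k)).map_tsum hs
    simp only [innerSL_apply_apply] at this
    rw [this]
    refine tsum_congr fun l => ?_
    rw [energyTerm, re_inner_eq, real_inner_comm]
  rw [h1, tsum_const_smul'', hv.bilin_apply hn hw]
  rw [inner_smul_left, inner_lerayAt k (hw.div k), inner_smul_left]
  simp

lemma tsum_antisymm_eq_zero {ι : Type*} {f : ι × ι → ℝ} (h : ∀ a b, f (b, a) = -f (a, b)) :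
    ∑' p, f p = 0 := by
  have h1 := (Equiv.prodComm ι ι).tsum_eq f
  have h2 : ∀ p : ι × ι, f (Equiv.prodComm ι ι p) = -f p := fun p => h p.1 p.2
  simp only [h2, tsum_neg] at h1
  linarith

lemma summable_sub_mul_fst {a b : (Fin d → ℤ) → ℝ} (ha : Summable a) (hb : Summable b)
    (ha0 : ∀ k, 0 ≤ a k) (hb0 : ∀ k, 0 ≤ b k) :
    (Summable fun p : (Fin d → ℤ) × (Fin d → ℤ) => a (p.1 - p.2) * b p.1) ∧
      ∑' p : (Fin d → ℤ) × (Fin d → ℤ), a (p.1 - p.2) * b p.1 = (∑' k, a k) * ∑' k, b k := by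
  have ha' : Summable fun k => a (-k) := (Equiv.neg _).summable_iff.mpr ha
  have h1 := summable_sub_mul ha' hb (fun k => ha0 _) hb0
  have h2 := tsum_sub_mul ha' hb (fun k => ha0 _) hb0
  have e : ∀ p : (Fin d → ℤ) × (Fin d → ℤ), a (-(p.1 - p.2)) * b p.2 =
      (fun p : (Fin d → ℤ) × (Fin d → ℤ) => a (p.1 - p.2) * b p.1) (Equiv.prodComm _ _ p) :=
    fun p => by simp
  simp only [e] at h1 h2
  refine ⟨(Equiv.prodComm _ _).summable_iff.mp h1, ?_⟩
  have h3 := (Equiv.prodComm (Fin d → ℤ) (Fin d → ℤ)).tsum_eq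
    (fun p : (Fin d → ℤ) × (Fin d → ℤ) => a (p.1 - p.2) * b p.1)
  have h4 := (Equiv.neg (Fin d → ℤ)).tsum_eq a
  simp only [Equiv.neg_apply] at h4
  rw [← h3, h2, h4]

/-- The trilinear estimate `∑ a_{k-l} y_l x_k ≤ ‖a‖₁ (‖x‖₂² + ‖y‖₂²) / 2`. -/
lemma trilinear {a x y : (Fin d → ℤ) → ℝ} (ha : Summable a) (hx : Summable fun k => x k ^ 2)
    (hy : Summable fun k => y k ^ 2) (ha0 : ∀ k, 0 ≤ a k) (hx0 : ∀ k, 0 ≤ x k)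
    (hy0 : ∀ k, 0 ≤ y k) :
    (Summable fun p : (Fin d → ℤ) × (Fin d → ℤ) => a (p.1 - p.2) * y p.2 * x p.1) ∧
      ∑' p : (Fin d → ℤ) × (Fin d → ℤ), a (p.1 - p.2) * y p.2 * x p.1 ≤
        (∑' k, a k) * ((∑' k, x k ^ 2 + ∑' k, y k ^ 2) / 2) := by
  have h1 := summable_sub_mul ha hy ha0 (fun k => sq_nonneg _)
  have h2 := summable_sub_mul_fst ha hx ha0 (fun k => sq_nonneg _)
  have hs := (h2.1.add h1).div_const 2
  -- From `2xy ≤ x² + y²`; each resulting double sum factors after a shear of the index.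
  have hle : ∀ p : (Fin d → ℤ) × (Fin d → ℤ), a (p.1 - p.2) * y p.2 * x p.1 ≤
      (a (p.1 - p.2) * x p.1 ^ 2 + a (p.1 - p.2) * y p.2 ^ 2) / 2 := fun p => by
    have := mul_nonneg (ha0 (p.1 - p.2)) (sq_nonneg (x p.1 - y p.2))
    nlinarith
  have hsum := Summable.of_nonneg_of_le
    (fun p => mul_nonneg (mul_nonneg (ha0 (p.1 - p.2)) (hy0 p.2)) (hx0 p.1)) hle hs
  refine ⟨hsum, (hsum.tsum_le_tsum hle hs).trans (le_of_eq ?_)⟩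
  rw [tsum_div_const, h2.1.tsum_add h1, h2.2, tsum_sub_mul ha hy ha0 (fun k => sq_nonneg _)]
  ring

/-- `⟨𝒫(v,w) | w⟩_{L²} = 0`. -/
lemma innerH_zero_bilin {n : ℝ} (hn : (d : ℝ) / 2 + 1 < n) {v w : VField d} (hv : MemH n v)
    (hw : MemH n w) : innerH 0 (bilin v w) w = 0 := by
  have hd : (0 : ℝ) ≤ d := Nat.cast_nonneg d
  have hx : Summable fun k => ‖w k‖ ^ 2 := by
    simpa using (hw.mono (m := 0) (by linarith)).summable
  have hy : Summable fun k => (kabs k * ‖w k‖) ^ 2 := by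
    have := (hw.mono (m := 1) (by linarith)).summable
    refine this.congr fun k => ?_
    rw [mul_pow, mul_one]; norm_num
  have hs : Summable fun p : (Fin d → ℤ) × (Fin d → ℤ) => energyTerm v w p.1 p.2 :=
    Summable.of_norm_bounded (trilinear (hv.summable_norm hn).1 hx hy (fun _ => norm_nonneg _)
      (fun _ => norm_nonneg _) (fun k => mul_nonneg (kabs_nonneg k) (norm_nonneg _))).1
      fun p => abs_energyTerm_le v w p.1 p.2
  simp only [innerH, mul_zero, Real.rpow_zero, one_mul, re_inner_bilin hn hv hw]
  rw [tsum_mul_left, ← hs.tsum_prod, tsum_antisymm_eq_zero, mul_zero]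
  exact fun a b => energyTerm_swap hv a b

/-- A weight for which the commutator estimate for `𝒫` holds. -/
structure IsEnergyWeight (C : ℝ) (φ : (Fin d → ℤ) → ℝ) : Prop where
  nonneg : ∀ k, 0 ≤ φ k
  sub_le : ∀ k l, |φ k - φ l| * kabs l ≤ C * (kabs (k - l) * φ l + kabs l * φ (k - l))

/-- By antisymmetry `∑ φ_k φ_l E_{kl} = 0`, so `φ_k²` may be replaced by `φ_k (φ_k - φ_l)`. The
weight inequality then moves the derivative from `u_l` to `u_{k-l}`, or the weight from `u_l` to
`u_{k-l}`, and both resulting sums are trilinear sums with `|k| |u_k|` in `ℓ¹`. Finite support makes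
every rearrangement legitimate. -/
lemma IsEnergyWeight.inner_bilin_le {n C : ℝ} (hn : (d : ℝ) / 2 + 1 < n) (hC : 0 ≤ C)
    {φ : (Fin d → ℤ) → ℝ} (hφ : IsEnergyWeight C φ) {u : VField d} (hu : MemH n u)
    (hfin : {k | u k ≠ 0}.Finite) :
    |∑' k, φ k ^ 2 * (inner ℂ (bilin u u k) (u k)).re| ≤
      2 * fourierNormalization d * C * wienerConst d n * normH n u *
        ∑' k, φ k ^ 2 * ‖u k‖ ^ 2 := by
  have hc := (fourierNormalization_pos d).le
  have fin2 : ∀ g : (Fin d → ℤ) × (Fin d → ℤ) → ℝ,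
      Summable fun p : (Fin d → ℤ) × (Fin d → ℤ) => g p * energyTerm u u p.1 p.2 := by
    intro g
    refine summable_of_hasFiniteSupport ((hfin.prod hfin).subset fun p hp => ?_)
    simp only [Set.mem_prod, Set.mem_ofPred_eq]
    constructor <;> intro h0 <;> apply hp <;> simp [energyTerm, convTerm, h0]
  obtain ⟨s1, t1⟩ := hu.summable_kabs_mul hn
  have hφu : Summable fun k => (φ k * ‖u k‖) ^ 2 :=
    summable_of_hasFiniteSupport (hfin.subset fun k hk h0 => hk (by simp [h0]))
  have e0 : ∀ k, (φ k * ‖u k‖) ^ 2 = φ k ^ 2 * ‖u k‖ ^ 2 := fun k => mul_pow _ _ _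
  have hnn : ∀ k, 0 ≤ φ k * ‖u k‖ := fun k => mul_nonneg (hφ.nonneg k) (norm_nonneg _)
  obtain ⟨q1, q2⟩ := trilinear (a := fun k => kabs k * ‖u k‖) s1 hφu hφu
    (fun k => mul_nonneg (kabs_nonneg k) (norm_nonneg _)) hnn hnn
  -- The involution `l ↦ k - l` carries one of the two terms of the weight inequality to the other,
  -- so their sums agree.
  let σ : (Fin d → ℤ) × (Fin d → ℤ) ≃ (Fin d → ℤ) × (Fin d → ℤ) :=
    { toFun := fun p => (p.1, p.1 - p.2)
      invFun := fun p => (p.1, p.1 - p.2)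
      left_inv := fun p => by simp
      right_inv := fun p => by simp }
  set M : (Fin d → ℤ) × (Fin d → ℤ) → ℝ := fun p =>
    kabs (p.1 - p.2) * ‖u (p.1 - p.2)‖ * (φ p.2 * ‖u p.2‖) * (φ p.1 * ‖u p.1‖) with hM
  have hMσ : Summable fun p => M (σ p) := σ.summable_iff.mpr q1
  have hMσt : ∑' p, M (σ p) = ∑' p, M p := σ.tsum_eq M
  have step : ∑' k, φ k ^ 2 * (inner ℂ (bilin u u k) (u k)).re =
      fourierNormalization d *
        ∑' p : (Fin d → ℤ) × (Fin d → ℤ), φ p.1 * (φ p.1 - φ p.2) * energyTerm u u p.1 p.2 := by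
    have hz : ∑' p : (Fin d → ℤ) × (Fin d → ℤ), φ p.1 * φ p.2 * energyTerm u u p.1 p.2 = 0 :=
      tsum_antisymm_eq_zero fun a b => by
        simp only [energyTerm_swap hu a b]; ring
    have h2 : ∑' p : (Fin d → ℤ) × (Fin d → ℤ), φ p.1 * (φ p.1 - φ p.2) * energyTerm u u p.1 p.2 =
        ∑' p : (Fin d → ℤ) × (Fin d → ℤ), φ p.1 ^ 2 * energyTerm u u p.1 p.2 := by
      rw [← sub_zero (∑' p : (Fin d → ℤ) × (Fin d → ℤ), φ p.1 ^ 2 * energyTerm u u p.1 p.2), ← hz,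
        ← (fin2 fun p => φ p.1 ^ 2).tsum_sub (fin2 fun p => φ p.1 * φ p.2)]
      exact tsum_congr fun p => by ring
    rw [h2, (fin2 fun p => φ p.1 ^ 2).tsum_prod, ← tsum_mul_left]
    refine tsum_congr fun k => ?_
    simp only [re_inner_bilin hn hu hu, tsum_mul_left]
    ring
  have hbd : ∀ p : (Fin d → ℤ) × (Fin d → ℤ),
      ‖φ p.1 * (φ p.1 - φ p.2) * energyTerm u u p.1 p.2‖ ≤ C * (M p + M (σ p)) := by
    intro p
    have h1 := abs_energyTerm_le u u p.1 p.2
    have h2 := hφ.sub_le p.1 p.2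
    have n1 := hφ.nonneg p.1
    rw [Real.norm_eq_abs, abs_mul, abs_mul, abs_of_nonneg n1]
    calc _ ≤ φ p.1 * |φ p.1 - φ p.2| * (‖u (p.1 - p.2)‖ * (kabs p.2 * ‖u p.2‖) * ‖u p.1‖) := by
          gcongr
      _ = (|φ p.1 - φ p.2| * kabs p.2) * (φ p.1 * (‖u (p.1 - p.2)‖ * ‖u p.2‖ * ‖u p.1‖)) := by ring
      _ ≤ (C * (kabs (p.1 - p.2) * φ p.2 + kabs p.2 * φ (p.1 - p.2))) *
            (φ p.1 * (‖u (p.1 - p.2)‖ * ‖u p.2‖ * ‖u p.1‖)) := by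
          gcongr
      _ = _ := by simp [hM, σ]; ring
  have hs2 : HasSum (fun p => C * (M p + M (σ p))) (C * (∑' p, M p + ∑' p, M p)) := by
    have := (q1.hasSum.add hMσ.hasSum).mul_left C
    rwa [hMσt] at this
  have hfinal := tsum_of_norm_bounded hs2 hbd
  rw [step, abs_mul, abs_of_nonneg hc]
  rw [Real.norm_eq_abs] at hfinal
  simp only [e0, add_self_div_two] at q2
  set Q := ∑' k, φ k ^ 2 * ‖u k‖ ^ 2 with hQ
  have hQ0 : 0 ≤ Q := tsum_nonneg fun k => mul_nonneg (sq_nonneg _) (sq_nonneg _)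
  have q3 : ∑' p, M p ≤ wienerConst d n * normH n u * Q := q2.trans (by gcongr)
  calc _ ≤ fourierNormalization d * (C * (∑' p, M p + ∑' p, M p)) := by gcongr
    _ ≤ fourierNormalization d * (C * (wienerConst d n * normH n u * Q +
          wienerConst d n * normH n u * Q)) := by gcongr
    _ = _ := by ring

/-! ### The tail weights satisfy the commutator condition uniformly in `K`. -/

/-- The weight `|k|^p min(|k|/K, 1)`. -/
def tailW (p K : ℝ) (k : Fin d → ℤ) : ℝ := kabs k ^ p * min (kabs k / K) 1

lemma tailW_nonneg (p : ℝ) {K : ℝ} (hK : 0 < K) (k : Fin d → ℤ) : 0 ≤ tailW p K k :=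
  mul_nonneg (Real.rpow_nonneg (kabs_nonneg k) _)
    (le_min (div_nonneg (kabs_nonneg k) hK.le) zero_le_one)

/-- Nonzero wave vectors have `|k| ≥ 1`, so the cut-off is inactive for `K = 1` and the Sobolev
energy estimates are a special case. The condition on `p` matters only at `k = 0`. -/
lemma tailW_one {p : ℝ} (hp : p ≠ 0) (k : Fin d → ℤ) : tailW p 1 k = sobW p k := by
  by_cases hk : k = 0
  · subst hk; simp [tailW, sobW, Real.zero_rpow hp]
  · rw [tailW, sobW, div_one, min_eq_right (one_le_kabs hk), mul_one]

/-- Bernoulli's inequality for `(r/s)^q`, multiplied by `s^q`; the case `r = 0` is direct. -/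
lemma rpow_sub_rpow_le {q r s : ℝ} (hq : 1 ≤ q) (hr : 0 ≤ r) (hrs : r ≤ s) :
    s ^ q - r ^ q ≤ q * s ^ (q - 1) * (s - r) := by
  rcases hr.eq_or_lt with h0 | h0
  · subst h0
    rcases hrs.eq_or_lt with h | h
    · subst h; simp [Real.zero_rpow (by linarith : q ≠ 0)]
    · rw [Real.zero_rpow (by linarith), sub_zero, sub_zero, mul_assoc, Real.rpow_sub_one h.ne',
        div_mul_cancel₀ _ h.ne']
      have := Real.rpow_nonneg h.le q
      nlinarith
  have hs : 0 < s := h0.trans_le hrs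
  have hb := one_add_mul_self_le_rpow_one_add (s := r / s - 1) (by
    have := div_nonneg hr hs.le; linarith) hq
  rw [add_sub_cancel, Real.div_rpow hr hs.le, le_div_iff₀ (Real.rpow_pos_of_pos hs q)] at hb
  rw [Real.rpow_sub_one hs.ne']
  have e : q * (s ^ q / s) * (s - r) = q * (1 - r / s) * s ^ q := by field_simp
  rw [e]
  nlinarith

/-- The ratio `min(t/K, 1)/t` is nonincreasing; the statement avoids the division. -/
lemma quasiconcave_min {K r s : ℝ} (hr : 0 ≤ r) (hrs : r ≤ s) :
    r * min (s / K) 1 ≤ s * min (r / K) 1 := by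
  rcases le_total (r / K) 1 with h | h
  · rw [min_eq_left h]
    calc r * min (s / K) 1 ≤ r * (s / K) := by gcongr; exact min_le_left _ _
      _ = _ := by ring
  · rw [min_eq_right h]
    calc r * min (s / K) 1 ≤ r * 1 := by gcongr; exact min_le_right _ _
      _ ≤ _ := by linarith

lemma tailProfile_mono {p K r s : ℝ} (hp : 0 ≤ p) (hK : 0 < K) (hr : 0 ≤ r) (hrs : r ≤ s) :
    r ^ p * min (r / K) 1 ≤ s ^ p * min (s / K) 1 := by
  have : 0 ≤ r / K := div_nonneg hr hK.le
  have : 0 ≤ s ^ p := Real.rpow_nonneg (hr.trans hrs) p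
  gcongr

lemma tailProfile_two_mul {p K r : ℝ} (hr : 0 ≤ r) :
    (2 * r) ^ p * min (2 * r / K) 1 ≤ 2 * 2 ^ p * (r ^ p * min (r / K) 1) := by
  rw [Real.mul_rpow (by norm_num) hr]
  rcases hr.eq_or_lt with h | h
  · subst h; simp
  have h1 : min (2 * r / K) 1 ≤ 2 * min (r / K) 1 := by
    have := quasiconcave_min (K := K) (s := 2 * r) hr (by linarith)
    nlinarith
  calc _ ≤ 2 ^ p * r ^ p * (2 * min (r / K) 1) := by gcongr
    _ = _ := by ring

/-- With the extra factor `s`, `quasiconcave_min` allows the cut-off at `r` to be replaced by the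
one at `s`, in the favourable direction whichever of `r`, `s` is larger. What remains is a
difference of `(p+1)`-st powers, and `r ≤ 2s` gives the factor `2^p`. -/
lemma tailProfile_sub_le {p K r s : ℝ} (hp : 0 ≤ p) (hK : 0 < K) (hr : 0 ≤ r) (hs : 0 ≤ s)
    (h2 : r ≤ 2 * s) :
    |r ^ p * min (r / K) 1 - s ^ p * min (s / K) 1| * s ≤
      (p + 1) * 2 ^ p * (|r - s| * (s ^ p * min (s / K) 1)) := by
  have hsm : 0 ≤ min (s / K) 1 := le_min (div_nonneg hs hK.le) zero_le_one
  have hrm : 0 ≤ min (r / K) 1 := le_min (div_nonneg hr hK.le) zero_le_one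
  have h2p : (1 : ℝ) ≤ 2 ^ p := Real.one_le_rpow (by norm_num) hp
  have er : r ^ (p + 1) = r ^ p * r := Real.rpow_add_one' hr (by linarith)
  have es : s ^ (p + 1) = s ^ p * s := Real.rpow_add_one' hs (by linarith)
  have hrp := Real.rpow_nonneg hr p
  have hsp := Real.rpow_nonneg hs p
  rcases le_total r s with h | h
  · rw [abs_of_nonpos (sub_nonpos.mpr (tailProfile_mono hp hK hr h)), abs_of_nonpos (sub_nonpos.mpr h)]
    have h1 := quasiconcave_min (K := K) hr h
    have hb := rpow_sub_rpow_le (q := p + 1) (by linarith) hr h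
    rw [er, es, add_sub_cancel_right] at hb
    have hq : r ^ p * (r * min (s / K) 1) ≤ r ^ p * (s * min (r / K) 1) := by gcongr
    have hb' := mul_le_mul_of_nonneg_right hb hsm
    have hX : 0 ≤ (p + 1) * s ^ p * (s - r) * min (s / K) 1 := by
      have := sub_nonneg.mpr h; positivity
    have hX2 := mul_le_mul_of_nonneg_right h2p hX
    nlinarith
  · rw [abs_of_nonneg (sub_nonneg.mpr (tailProfile_mono hp hK hs h)), abs_of_nonneg (sub_nonneg.mpr h)]
    have h1 := quasiconcave_min (K := K) hs h
    have hb := rpow_sub_rpow_le (q := p + 1) (by linarith) hs h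
    rw [er, es, add_sub_cancel_right] at hb
    have hrs : r ^ p ≤ 2 ^ p * s ^ p := by
      rw [← Real.mul_rpow (by norm_num) hs]; gcongr
    have hq : r ^ p * (s * min (r / K) 1) ≤ r ^ p * (r * min (s / K) 1) := by gcongr
    have hb2 : r ^ p * r - s ^ p * s ≤ (p + 1) * (2 ^ p * s ^ p) * (r - s) := by
      refine hb.trans ?_
      have := sub_nonneg.mpr h
      gcongr
    have hb' := mul_le_mul_of_nonneg_right hb2 hsm
    nlinarith

/-- The constant in the commutator estimate for the weights `|k|^p min(|k|/K, 1)`. -/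
def weightConst (p : ℝ) : ℝ := (p + 2) * 2 ^ p

/-- If `|l| ≤ |k-l|`, then `|k| ≤ 2|k-l|` and doubling bounds both weights by the one at `k-l`. If
`|k-l| ≤ |l|`, then `|k| ≤ 2|l|` and the difference estimate applies. The constant does not involve
`K`. -/
lemma isEnergyWeight_tailW {p K : ℝ} (hp : 0 ≤ p) (hK : 0 < K) :
    IsEnergyWeight (weightConst p) (tailW p K : (Fin d → ℤ) → ℝ) := by
  refine ⟨tailW_nonneg p hK, fun k l => ?_⟩
  have h2p : (0 : ℝ) < 2 ^ p := Real.rpow_pos_of_pos (by norm_num) p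
  have hk := kabs_nonneg k
  have hl := kabs_nonneg l
  have hh := kabs_nonneg (k - l)
  have wl := tailW_nonneg p hK l
  have wk := tailW_nonneg p hK k
  have wh := tailW_nonneg p hK (k - l)
  have htri := kabs_le_sub_add k l
  have habs := abs_kabs_sub_le k l
  rcases le_total (kabs l) (kabs (k - l)) with h | h
  · have h1 : tailW p K l ≤ tailW p K (k - l) := tailProfile_mono hp hK hl h
    have h2 : tailW p K k ≤ 2 * 2 ^ p * tailW p K (k - l) :=
      (tailProfile_mono hp hK hk (by linarith)).trans (tailProfile_two_mul (p := p) hh)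
    have h3 : |tailW p K k - tailW p K l| ≤ 2 * 2 ^ p * tailW p K (k - l) := by
      have : (1 : ℝ) ≤ 2 ^ p := Real.one_le_rpow (by norm_num) hp
      have := mul_le_mul_of_nonneg_right this wh
      rw [abs_le]; constructor <;> linarith
    calc _ ≤ 2 * 2 ^ p * tailW p K (k - l) * kabs l := by gcongr
      _ ≤ weightConst p * (kabs l * tailW p K (k - l)) := by
          rw [weightConst]
          have : 0 ≤ p * 2 ^ p * (kabs l * tailW p K (k - l)) := by positivity
          linarith
      _ ≤ _ := by
          have : 0 ≤ weightConst p := by unfold weightConst; positivity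
          gcongr
          have : 0 ≤ kabs (k - l) * tailW p K l := by positivity
          linarith
  · have h1 := tailProfile_sub_le (r := kabs k) (s := kabs l) hp hK hk hl (by linarith)
    calc _ ≤ (p + 1) * 2 ^ p * (|kabs k - kabs l| * tailW p K l) := h1
      _ ≤ weightConst p * (kabs (k - l) * tailW p K l) := by
          rw [weightConst]
          gcongr
          linarith
      _ ≤ _ := by
          have : 0 ≤ weightConst p := by unfold weightConst; positivity
          gcongr
          have : 0 ≤ kabs l * tailW p K (k - l) := by positivity
          linarith

/-! ### Gronwall's inequality and dissipative equations in finite dimension. -/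

lemma hasDerivWithinAt_Ici_of_Icc {F : Type*} [NormedAddCommGroup F] [NormedSpace ℝ F]
    {f : ℝ → F} {f' : F} {a b t : ℝ} (h : HasDerivWithinAt f f' (Set.Icc a b) t)
    (ht : t ∈ Set.Ico a b) : HasDerivWithinAt f f' (Set.Ici t) t :=
  h.mono_of_mem_nhdsWithin (Icc_mem_nhdsGE_of_mem ht)

/-- Gronwall's inequality for a differentiable function on an interval. -/
lemma le_mul_exp_of_deriv_le {f f' : ℝ → ℝ} {a b K ε : ℝ} (hK : 1 ≤ K) (hε : 0 ≤ ε)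
    (hf : ∀ t ∈ Set.Icc a b, HasDerivWithinAt f (f' t) (Set.Icc a b) t)
    (hle : ∀ t ∈ Set.Icc a b, f' t ≤ K * f t + ε) {t : ℝ} (ht : t ∈ Set.Icc a b) :
    f t ≤ (f a + ε) * Real.exp (K * (t - a)) := by
  have h := le_gronwallBound_of_liminf_deriv_right_le (δ := f a) (K := K) (ε := ε) (a := a) (b := b)
    (f := f) (f' := f') (fun x hx => (hf x hx).continuousWithinAt)
    (fun x hx r hr => by
      have := (hasDerivWithinAt_Ici_of_Icc (hf x (Set.Ico_subset_Icc_self hx)) hx).liminf_right_slope_le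
        hr
      simpa [slope_def_field, div_eq_inv_mul] using this)
    le_rfl (fun x hx => hle x (Set.Ico_subset_Icc_self hx)) t ht
  rw [gronwallBound_of_K_ne_0 (by linarith)] at h
  refine h.trans ?_
  have h1 : ε / K ≤ ε := div_le_self hε hK
  have h2 : 0 ≤ ε / K := div_nonneg hε (by linarith)
  have h3 := Real.exp_pos (K * (t - a))
  nlinarith

/-- A smooth dissipative vector field on a finite dimensional space has global solutions. -/
theorem exists_solution_of_dissipative {F : Type*} [NormedAddCommGroup F] [InnerProductSpace ℝ F]
    [FiniteDimensional ℝ F] {X : F → F} (hX : ContDiff ℝ 1 X) (hdis : ∀ x, inner ℝ x (X x) ≤ 0)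
    (x₀ : F) {τ : ℝ} (hτ : 0 ≤ τ) :
    ∃ α : ℝ → F, α 0 = x₀ ∧
      ∀ t ∈ Set.Icc 0 τ, HasDerivWithinAt α (X (α t)) (Set.Icc 0 τ) t := by
  -- The cut-off makes the field bounded and globally Lipschitz, so Picard-Lindelöf covers all of
  -- `[0, τ]`. It equals `1` on a ball that the solution never leaves, because dissipativity keeps
  -- its norm at most `‖x₀‖`.
  let χ : ContDiffBump (0 : F) := ⟨‖x₀‖ + 1, ‖x₀‖ + 2, by positivity, by linarith⟩
  have hsm : ContDiff ℝ 1 fun x => χ x • X x := χ.contDiff.smul hX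
  have hcs : HasCompactSupport fun x => χ x • X x := χ.hasCompactSupport.smul_right
  obtain ⟨K, hK⟩ := ContDiff.lipschitzWith_of_hasCompactSupport hcs hsm one_ne_zero
  obtain ⟨L, hL⟩ := hcs.exists_bound_of_continuous hsm.continuous
  have hL0 : 0 ≤ L := (norm_nonneg _).trans (hL 0)
  have hPL : IsPicardLindelof (fun _ x => χ x • X x) (tmin := 0) (tmax := τ) ⟨0, le_rfl, hτ⟩ x₀
      ⟨L * τ, by positivity⟩ 0 ⟨L, hL0⟩ K :=
    { lipschitzOnWith := fun _ _ => hK.lipschitzOnWith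
      continuousOn := fun _ _ => continuousOn_const
      norm_le := fun _ _ x _ => hL x
      mul_max_le := by simp [max_eq_left hτ]; exact le_rfl }
  obtain ⟨α, h0, hα⟩ := hPL.exists_eq_forall_mem_Icc_hasDerivWithinAt₀
  refine ⟨α, h0, fun t ht => ?_⟩
  have hb : ∀ t ∈ Set.Icc 0 τ, ‖α t‖ ^ 2 ≤ ‖x₀‖ ^ 2 := by
    intro t ht
    refine image_le_of_deriv_right_le_deriv_boundary (B := fun _ => ‖x₀‖ ^ 2) (B' := fun _ => 0)
      (f := fun t => ‖α t‖ ^ 2)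
      (fun s hs => ((hα s hs).norm_sq).continuousWithinAt)
      (fun s hs => hasDerivWithinAt_Ici_of_Icc (hα s (Set.Ico_subset_Icc_self hs)).norm_sq hs)
      (by rw [← h0]) continuousOn_const (fun s _ => hasDerivWithinAt_const _ _ _) (fun s _ => ?_) ht
    rw [real_inner_smul_right]
    have := mul_nonpos_of_nonneg_of_nonpos (χ.nonneg' (α s)) (hdis (α s))
    linarith
  have h1 : χ (α t) = 1 := by
    apply χ.one_of_mem_closedBall
    have := abs_le_of_sq_le_sq (hb t ht) (norm_nonneg _)
    simp only [abs_norm] at this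
    simp only [mem_closedBall_zero_iff]
    change _ ≤ ‖x₀‖ + 1
    linarith
  have := hα t ht
  rwa [h1, one_smul] at this

/-! ### The Laplacian, Fourier truncation and the Galerkin system. -/

lemma lap_weight (n : ℝ) {v : VField d} (h0 : v 0 = 0) (k : Fin d → ℤ) :
    kabs k ^ (2 * n) * ‖lap v k‖ ^ 2 = kabs k ^ (2 * (n + 2)) * ‖v k‖ ^ 2 := by
  by_cases hk : k = 0
  · subst hk; simp [h0, lap]
  · have hp := kabs_pos hk
    have : kabs k ^ (2 * (n + 2)) = kabs k ^ (2 * n) * (kabs k ^ 2) ^ 2 := by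
      rw [show 2 * (n + 2) = 2 * n + (4 : ℕ) by push_cast; ring, Real.rpow_add_natCast hp.ne']
      ring
    rw [this, lap, norm_smul, norm_neg, Real.norm_of_nonneg (sq_nonneg _)]
    ring

lemma MemH.lap {n : ℝ} {v : VField d} (hv : MemH (n + 2) v) :
    MemH n (lap v) ∧ normH n (EulerNS.lap v) = normH (n + 2) v := by
  have h := lap_weight n hv.mean
  refine ⟨⟨fun k r => ?_, ?_, fun k => ?_, ?_⟩, ?_⟩
  · simp [EulerNS.lap, hv.real]
  · simp [EulerNS.lap, hv.mean]
  · have := congrArg (fun z => ((-(kabs k ^ 2) : ℝ) : ℂ) * z) (hv.div k)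
    simp only [Finset.mul_sum, mul_zero] at this
    rw [← this]
    exact Finset.sum_congr rfl fun s _ => by
      simp only [EulerNS.lap, PiLp.smul_apply, Complex.real_smul]; ring
  · simp only [h]; exact hv.summable
  · simp only [normH, h]

lemma lap_add (v w : VField d) : lap (v + w) = lap v + lap w := by
  funext k; simp [lap]

lemma lap_sub (v w : VField d) : lap (v - w) = lap v - lap w := by
  funext k; simp [lap, sub_eq_add_neg, add_comm]

lemma lap_smul (c : ℝ) (v : VField d) : lap (c • v) = c • lap v := by
  funext k; exact smul_comm (-(kabs k ^ 2)) c (v k)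

lemma re_inner_lap (v : VField d) (k : Fin d → ℤ) :
    (inner ℂ (lap v k) (v k)).re = -(kabs k ^ 2 * ‖v k‖ ^ 2) := by
  rw [re_inner_eq, lap, real_inner_smul_left, real_inner_self_eq_norm_sq]; ring

/-- Fourier truncation to the frequencies `|k| ≤ N`. -/
def trunc (N : ℝ) (v : VField d) : VField d := fun k => if kabs k ≤ N then v k else 0

lemma trunc_add (N : ℝ) (v w : VField d) : trunc N (v + w) = trunc N v + trunc N w := by
  funext k; by_cases h : kabs k ≤ N <;> simp [trunc, h]

lemma trunc_smul (N c : ℝ) (v : VField d) : trunc N (c • v) = c • trunc N v := by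
  funext k; by_cases h : kabs k ≤ N <;> simp [trunc, h]

lemma norm_trunc_le (N : ℝ) (v : VField d) (k : Fin d → ℤ) : ‖trunc N v k‖ ≤ ‖v k‖ := by
  unfold trunc; split_ifs <;> simp

lemma MemH.trunc {n : ℝ} {v : VField d} (hv : MemH n v) (N : ℝ) : MemH n (trunc N v) := by
  refine ⟨fun k r => ?_, ?_, fun k => ?_, ?_⟩
  · by_cases h : kabs k ≤ N <;> simp [EulerNS.trunc, h, hv.real]
  · simp [EulerNS.trunc, hv.mean]
  · by_cases h : kabs k ≤ N <;> simp [EulerNS.trunc, h, hv.div]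
  · refine Summable.of_nonneg_of_le (fun k => mul_nonneg (Real.rpow_nonneg (kabs_nonneg k) _)
      (sq_nonneg _)) (fun k => ?_) hv.summable
    have := Real.rpow_nonneg (kabs_nonneg k) (2 * n)
    gcongr
    exact norm_trunc_le N v k

lemma norm_embW_trunc_le {φ : (Fin d → ℤ) → ℝ} {v : VField d} (hv : SumW φ v) (N : ℝ) :
    SumW φ (trunc N v) ∧ ‖embW φ (trunc N v)‖ ≤ ‖embW φ v‖ := by
  have h : ∀ k, φ k ^ 2 * ‖trunc N v k‖ ^ 2 ≤ φ k ^ 2 * ‖v k‖ ^ 2 := fun k => by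
    gcongr; exact norm_trunc_le N v k
  have h1 : SumW φ (trunc N v) :=
    Summable.of_nonneg_of_le (fun k => mul_nonneg (sq_nonneg _) (sq_nonneg _)) h hv
  refine ⟨h1, ?_⟩
  rw [← sq_le_sq₀ (norm_nonneg _) (norm_nonneg _), norm_embW_sq, norm_embW_sq]
  exact h1.tsum_le_tsum h hv

lemma normH_trunc_le {n : ℝ} {v : VField d} (hv : MemH n v) (N : ℝ) :
    normH n (trunc N v) ≤ normH n v := by
  simpa only [norm_emb] using (norm_embW_trunc_le hv.sumW N).2

/-- The truncation error gains one derivative. -/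
lemma normH_sub_trunc_le {n N : ℝ} (hN : 0 < N) {v : VField d} (hv : MemH (n + 1) v) :
    normH n (v - trunc N v) ≤ N⁻¹ * normH (n + 1) v := by
  have hv' : MemH n v := hv.mono (by linarith)
  have h1 := (hv'.sub (hv'.trunc N)).summable
  rw [← sq_le_sq₀ (normH_nonneg _ _) (mul_nonneg (inv_nonneg.mpr hN.le) (normH_nonneg _ _)),
    mul_pow, normH_sq, normH_sq, ← tsum_mul_left]
  refine h1.tsum_le_tsum (fun k => ?_) (hv.summable.mul_left _)
  by_cases hk : kabs k ≤ N
  · simp only [Pi.sub_apply, trunc, hk, if_true, sub_self, norm_zero]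
    have := Real.rpow_nonneg (kabs_nonneg k) (2 * (n + 1))
    simp only [ne_eq, OfNat.ofNat_ne_zero, not_false_eq_true, zero_pow, mul_zero]
    positivity
  · have hk' := not_le.mp hk
    have hp : 0 < kabs k := hN.trans hk'
    have e : kabs k ^ (2 * (n + 1)) = kabs k ^ (2 * n) * kabs k ^ 2 := by
      rw [show 2 * (n + 1) = 2 * n + (2 : ℕ) by push_cast; ring, Real.rpow_add_natCast hp.ne']
    simp only [Pi.sub_apply, trunc, hk, if_false, sub_zero]
    have h3 : 1 ≤ N⁻¹ ^ 2 * kabs k ^ 2 := by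
      rw [← mul_pow]
      refine one_le_pow₀ ?_
      rw [← inv_mul_cancel₀ hN.ne']
      gcongr
    have h4 : 0 ≤ kabs k ^ (2 * n) * ‖v k‖ ^ 2 := by positivity
    rw [e]
    nlinarith

/-- Trigonometric polynomials in `H^n_{Σ0}` with frequencies `|k| ≤ N`. -/
structure IsTrig (N : ℝ) (v : VField d) : Prop where
  mem : MemH 0 v
  eq_zero : ∀ k, N < kabs k → v k = 0

lemma IsTrig.finite {N : ℝ} {v : VField d} (h : IsTrig N v) : {k | v k ≠ 0}.Finite :=
  (finite_kabs_le N).subset fun k hk => not_lt.mp fun hlt => hk (h.eq_zero k hlt)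

lemma IsTrig.sumW {N : ℝ} {v : VField d} (h : IsTrig N v) (φ : (Fin d → ℤ) → ℝ) : SumW φ v :=
  summable_of_hasFiniteSupport (h.finite.subset fun k hk h0 => hk (by simp [h0]))

lemma IsTrig.memH {N : ℝ} {v : VField d} (h : IsTrig N v) (n : ℝ) : MemH n v :=
  ⟨h.mem.real, h.mem.mean, h.mem.div, sumW_sobW_iff.mp (h.sumW _)⟩

lemma MemH.isTrig_trunc {n : ℝ} {v : VField d} (hv : MemH n v) (N : ℝ) :
    IsTrig N (EulerNS.trunc N v) := by
  have h := hv.trunc N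
  have h0 : ∀ k, N < kabs k → EulerNS.trunc N v k = 0 := fun k hk => if_neg (not_le.mpr hk)
  refine ⟨⟨h.real, h.mean, h.div, ?_⟩, h0⟩
  refine summable_of_hasFiniteSupport ((finite_kabs_le N).subset fun k hk => ?_)
  by_contra hlt
  exact hk (by simp [h0 k (not_le.mp hlt)])

/-- The finite dimensional space of trigonometric polynomials with frequencies `|k| ≤ N`. -/
def trigSpace (d : ℕ) (N : ℝ) : Submodule ℝ (L2 d) where
  carrier := {x | IsTrig N (x : VField d)}
  add_mem' {x y} hx hy := by
    refine ⟨?_, fun k hk => ?_⟩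
    · rw [lp.coeFn_add]; exact MemH.add hx.mem hy.mem
    · rw [lp.coeFn_add, Pi.add_apply, hx.eq_zero k hk, hy.eq_zero k hk, add_zero]
  zero_mem' := ⟨by rw [lp.coeFn_zero]; exact MemH.zero 0, fun k _ => by rw [lp.coeFn_zero]; rfl⟩
  smul_mem' c x hx := by
    refine ⟨?_, fun k hk => ?_⟩
    · rw [lp.coeFn_smul]; exact MemH.smul hx.mem c
    · rw [lp.coeFn_smul, Pi.smul_apply, hx.eq_zero k hk, smul_zero]

lemma IsTrig.memℓp {N : ℝ} {v : VField d} (h : IsTrig N v) : Memℓp v 2 := by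
  have := sumW_iff_memℓp.mp (h.sumW fun _ => 1)
  simpa using this

/-- A trigonometric polynomial as an element of `trigSpace`. -/
def IsTrig.toSpace {N : ℝ} {v : VField d} (h : IsTrig N v) : trigSpace d N :=
  ⟨⟨v, h.memℓp⟩, h⟩

instance (N : ℝ) : FiniteDimensional ℝ (trigSpace d N) := by
  have : Finite {k : Fin d → ℤ | kabs k ≤ N} := finite_kabs_le N
  have : Fintype {k : Fin d → ℤ | kabs k ≤ N} := Fintype.ofFinite _
  let f : trigSpace d N →ₗ[ℝ] ({k : Fin d → ℤ | kabs k ≤ N} → EuclideanSpace ℂ (Fin d)) :=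
    { toFun := fun x k => (x : L2 d) k
      map_add' := fun x y => by funext k; simp
      map_smul' := fun c x => by funext k; simp }
  refine FiniteDimensional.of_injective f fun x y hxy => ?_
  ext1; ext1; funext k
  by_cases hk : kabs k ≤ N
  · exact congrFun hxy ⟨k, hk⟩
  · rw [x.2.eq_zero k (not_le.mp hk), y.2.eq_zero k (not_le.mp hk)]

/-- The field underlying an element of `trigSpace`. -/
def trigField {N : ℝ} (x : trigSpace d N) : VField d := ((x : L2 d) : VField d)

lemma isTrig_trigField {N : ℝ} (x : trigSpace d N) : IsTrig N (trigField x) := x.2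

lemma trigField_add {N : ℝ} (x y : trigSpace d N) :
    trigField (x + y) = trigField x + trigField y := lp.coeFn_add _ _

lemma trigField_smul {N : ℝ} (c : ℝ) (x : trigSpace d N) :
    trigField (c • x) = c • trigField x := lp.coeFn_smul _ _

lemma trigField_injective {N : ℝ} : Function.Injective (trigField : trigSpace d N → VField d) :=
  fun _ _ h => Subtype.ext (Subtype.ext h)

lemma IsTrig.lap {N : ℝ} {v : VField d} (h : IsTrig N v) : IsTrig N (lap v) :=
  ⟨(MemH.lap (h.memH _)).1, fun k hk => by simp [EulerNS.lap, h.eq_zero k hk]⟩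

/-- The truncated bilinear map. -/
def truncBilin (N : ℝ) (v w : VField d) : VField d := trunc N (bilin v w)

lemma IsTrig.truncBilin {N : ℝ} {v w : VField d} (hv : IsTrig N v) (hw : IsTrig N w) :
    IsTrig N (truncBilin N v w) :=
  -- Trigonometric polynomials lie in every `H^n`; `d/2 + 2` is just one admissible exponent.
  MemH.isTrig_trunc (bilin_sobolev (n := (d : ℝ) / 2 + 2) (by linarith) (hv.memH _)
    (hw.memH _)).1 N

/-- The Laplacian on `trigSpace`. -/
def trigLap (d : ℕ) (N : ℝ) : trigSpace d N →ₗ[ℝ] trigSpace d N where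
  toFun x := (isTrig_trigField x).lap.toSpace
  map_add' x y := trigField_injective (by
    change lap (trigField x + trigField y) = lap (trigField x) + lap (trigField y)
    exact lap_add _ _)
  map_smul' c x := trigField_injective (by
    change lap (c • trigField x) = c • lap (trigField x)
    exact lap_smul _ _)

/-- The truncated bilinear map on `trigSpace`. -/
def trigBilin (d : ℕ) (N : ℝ) : trigSpace d N →ₗ[ℝ] trigSpace d N →ₗ[ℝ] trigSpace d N :=
  have hn : (d : ℝ) / 2 + 1 < (d : ℝ) / 2 + 2 := by linarith
  LinearMap.mk₂ ℝ
    (fun x y => ((isTrig_trigField x).truncBilin (isTrig_trigField y)).toSpace)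
    (fun x y z => trigField_injective (by
      change trunc N (bilin (trigField x + trigField y) (trigField z)) =
        trunc N (bilin (trigField x) (trigField z)) + trunc N (bilin (trigField y) (trigField z))
      rw [bilin_add_left hn ((isTrig_trigField x).memH _) ((isTrig_trigField y).memH _)
        ((isTrig_trigField z).memH _), trunc_add]))
    (fun c x y => trigField_injective (by
      change trunc N (bilin (c • trigField x) (trigField y)) =
        c • trunc N (bilin (trigField x) (trigField y))
      rw [bilin_smul_left hn ((isTrig_trigField x).memH _) ((isTrig_trigField y).memH _),
        trunc_smul]))
    (fun x y z => trigField_injective (by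
      change trunc N (bilin (trigField x) (trigField y + trigField z)) =
        trunc N (bilin (trigField x) (trigField y)) + trunc N (bilin (trigField x) (trigField z))
      rw [bilin_add_right hn ((isTrig_trigField x).memH _) ((isTrig_trigField y).memH _)
        ((isTrig_trigField z).memH _), trunc_add]))
    (fun c x y => trigField_injective (by
      change trunc N (bilin (trigField x) (c • trigField y)) =
        c • trunc N (bilin (trigField x) (trigField y))
      rw [bilin_smul_right hn ((isTrig_trigField x).memH _) ((isTrig_trigField y).memH _),
        trunc_smul]))

/-- The weighted embedding on `trigSpace`. -/
def trigEmb (N : ℝ) (φ : (Fin d → ℤ) → ℝ) : trigSpace d N →ₗ[ℝ] L2 d where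
  toFun x := embW φ (trigField x)
  map_add' x y := by
    rw [trigField_add, embW_add ((isTrig_trigField x).sumW φ) ((isTrig_trigField y).sumW φ)]
  map_smul' c x := by
    rw [trigField_smul, embW_smul ((isTrig_trigField x).sumW φ)]; rfl

/-- The right-hand side of the Galerkin system. -/
def galerkinRHS (ν N : ℝ) (v : VField d) : VField d := ν • lap v + truncBilin N v v

lemma IsTrig.add {N : ℝ} {v w : VField d} (hv : IsTrig N v) (hw : IsTrig N w) : IsTrig N (v + w) :=
  ⟨hv.mem.add hw.mem, fun k hk => by simp [hv.eq_zero k hk, hw.eq_zero k hk]⟩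

lemma IsTrig.smul {N : ℝ} {v : VField d} (hv : IsTrig N v) (c : ℝ) : IsTrig N (c • v) :=
  ⟨hv.mem.smul c, fun k hk => by simp [hv.eq_zero k hk]⟩

lemma IsTrig.galerkinRHS {N : ℝ} {v : VField d} (hv : IsTrig N v) (ν : ℝ) :
    IsTrig N (galerkinRHS ν N v) := (hv.lap.smul ν).add (hv.truncBilin hv)

/-- The truncation disappears: the pairing is diagonal in `k`, and `v_k = 0` for `|k| > N`. -/
lemma inner_galerkinRHS {N ν : ℝ} {v : VField d} (hv : IsTrig N v) (φ : (Fin d → ℤ) → ℝ) :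
    inner ℝ (embW φ v) (embW φ (galerkinRHS ν N v)) =
      -(ν * ∑' k, φ k ^ 2 * (kabs k ^ 2 * ‖v k‖ ^ 2)) +
        ∑' k, φ k ^ 2 * (inner ℂ (bilin v v k) (v k)).re := by
  have fin : ∀ f : (Fin d → ℤ) → ℝ, (∀ k, v k = 0 → f k = 0) → Summable f := fun f hf =>
    summable_of_hasFiniteSupport (hv.finite.subset fun k hk h0 => hk (hf k h0))
  rw [real_inner_comm, inner_embW ((hv.galerkinRHS ν).sumW φ) (hv.sumW φ), ← tsum_mul_left,
    ← tsum_neg, ← Summable.tsum_add (fin _ fun k h => by simp [h]) (fin _ fun k h => by simp [h])]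
  refine tsum_congr fun k => ?_
  by_cases h0 : v k = 0
  · simp [h0]
  · have hk : kabs k ≤ N := not_lt.mp fun h => h0 (hv.eq_zero k h)
    have e1 : (inner ℂ (galerkinRHS ν N v k) (v k)).re =
        ν * (inner ℂ (lap v k) (v k)).re + (inner ℂ (bilin v v k) (v k)).re := by
      have : galerkinRHS ν N v k = ν • lap v k + bilin v v k := by
        simp only [galerkinRHS, Pi.add_apply, Pi.smul_apply, truncBilin, trunc, hk, if_true]
      rw [this, re_inner_eq, re_inner_eq, re_inner_eq, inner_add_left, real_inner_smul_left]
    rw [e1, re_inner_lap]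
    ring

lemma innerH_zero_eq (v w : VField d) : innerH 0 v w = ∑' k, (inner ℂ (v k) (w k)).re := by
  simp [innerH]

lemma inner_trig {N : ℝ} (x y : trigSpace d N) :
    inner ℝ x y = inner ℝ (embW (fun _ => 1) (trigField x)) (embW (fun _ => 1) (trigField y)) := by
  rw [Submodule.coe_inner]
  congr 1
  · ext1; funext k
    rw [embW_apply ((isTrig_trigField x).sumW _), one_smul]; rfl
  · ext1; funext k
    rw [embW_apply ((isTrig_trigField y).sumW _), one_smul]; rfl

/-- Global existence for the Galerkin approximations. -/
theorem exists_galerkin {n ν τ : ℝ} (hν : 0 ≤ ν) (hτ : 0 ≤ τ) (N : ℝ) {u₀ : VField d}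
    (hu₀ : MemH n u₀) :
    ∃ u : ℝ → VField d, u 0 = trunc N u₀ ∧ (∀ t, IsTrig N (u t)) ∧
      ∀ φ : (Fin d → ℤ) → ℝ, ∀ t ∈ Set.Icc 0 τ, HasDerivWithinAt (fun t => embW φ (u t))
        (embW φ (galerkinRHS ν N (u t))) (Set.Icc 0 τ) t := by
  have hn' : (d : ℝ) / 2 + 1 < (d : ℝ) / 2 + 2 := by linarith
  let A : trigSpace d N →L[ℝ] trigSpace d N := (trigLap d N).toContinuousLinearMap
  let B : trigSpace d N →L[ℝ] trigSpace d N →L[ℝ] trigSpace d N :=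
    LinearMap.toContinuousLinearMap
      ((LinearMap.toContinuousLinearMap (𝕜 := ℝ) (E := trigSpace d N)
        (F' := trigSpace d N)).toLinearMap ∘ₗ trigBilin d N)
  let X : trigSpace d N → trigSpace d N := fun x => ν • A x + B x x
  have hX : ContDiff ℝ 1 X := by fun_prop
  have hXf : ∀ x, trigField (X x) = galerkinRHS ν N (trigField x) := fun x => by
    simp only [X]
    rw [trigField_add, trigField_smul]; rfl
  have hdis : ∀ x, inner ℝ x (X x) ≤ 0 := by
    intro x
    have hx := isTrig_trigField x
    rw [inner_trig, hXf, inner_galerkinRHS hx]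
    simp only [one_pow, one_mul]
    rw [← innerH_zero_eq, innerH_zero_bilin hn' (hx.memH _) (hx.memH _), add_zero]
    have : 0 ≤ ∑' k, kabs k ^ 2 * ‖trigField x k‖ ^ 2 := tsum_nonneg fun k => by positivity
    have := mul_nonneg hν this
    linarith
  obtain ⟨α, h0, hα⟩ := exists_solution_of_dissipative hX hdis (hu₀.isTrig_trunc N).toSpace hτ
  refine ⟨fun t => trigField (α t), by simp only [h0]; rfl, fun t => isTrig_trigField _, fun φ t ht => ?_⟩
  -- In finite dimension every weighted embedding is continuous, so one solution curve is
  -- differentiable for all weights at once.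
  have := (LinearMap.toContinuousLinearMap (trigEmb N φ)).hasFDerivAt.comp_hasDerivWithinAt t (hα t ht)
  have e : (LinearMap.toContinuousLinearMap (trigEmb N φ)) (X (α t)) =
      embW φ (galerkinRHS ν N (trigField (α t))) := by
    rw [← hXf]; rfl
  rw [e] at this
  exact this

/-- The energy inequality for the Galerkin system. -/
lemma galerkin_energy {n ν N C : ℝ} (hn : (d : ℝ) / 2 + 1 < n) (hν : 0 ≤ ν) (hC : 0 ≤ C)
    {φ : (Fin d → ℤ) → ℝ} (hφ : IsEnergyWeight C φ) {v : VField d} (hv : IsTrig N v) :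
    2 * inner ℝ (embW φ v) (embW φ (galerkinRHS ν N v)) ≤
      4 * fourierNormalization d * C * wienerConst d n * normH n v * ‖embW φ v‖ ^ 2 := by
  have h1 := (abs_le.mp (hφ.inner_bilin_le hn hC (hv.memH n) hv.finite)).2
  have h2 : 0 ≤ ∑' k, φ k ^ 2 * (kabs k ^ 2 * ‖v k‖ ^ 2) := tsum_nonneg fun k => by positivity
  have h3 := mul_nonneg hν h2
  rw [inner_galerkinRHS hv, norm_embW_sq]
  linarith

/-! ### Lipschitz dependence of the right-hand side and stability in `L²`. -/

/-- The right-hand side `ν Δv + 𝒫(v, v)` of the Euler/Navier-Stokes equations. -/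
def rhs (ν : ℝ) (v : VField d) : VField d := ν • lap v + bilin v v

lemma MemH.rhs {n : ℝ} (hn : (d : ℝ) / 2 + 1 < n) {v : VField d} (hv : MemH (n + 2) v) (ν : ℝ) :
    MemH n (rhs ν v) :=
  (hv.lap.1.smul ν).add
    (bilin_sobolev hn (hv.mono (by linarith)) (hv.mono (by linarith))).1

lemma normH_bilin_sub_le {n D : ℝ} (hn : (d : ℝ) / 2 + 1 < n) {v w : VField d}
    (hv : MemH (n + 2) v) (hw : MemH (n + 2) w) (hvD : normH (n + 2) v ≤ D)
    (hwD : normH (n + 2) w ≤ D) :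
    normH n (bilin v v - bilin w w) ≤ 2 * bilinConst d n * D * normH (n + 2) (v - w) := by
  have v0 : MemH n v := hv.mono (by linarith)
  have w0 : MemH n w := hw.mono (by linarith)
  have w1 : MemH (n + 1) w := hw.mono (by linarith)
  have z2 := hv.sub hw
  have z0 : MemH n (v - w) := z2.mono (by linarith)
  have z1 : MemH (n + 1) (v - w) := z2.mono (by linarith)
  have a := bilin_sobolev hn v0 z1
  have b := bilin_sobolev hn z0 w1
  have hc := bilinConst_nonneg d n
  have m1 : normH n v ≤ D := (hv.normH_mono (by linarith)).trans hvD
  have m2 : normH (n + 1) w ≤ D := (hw.normH_mono (by linarith)).trans hwD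
  have m3 : normH n (v - w) ≤ normH (n + 2) (v - w) := z2.normH_mono (by linarith)
  have m4 : normH (n + 1) (v - w) ≤ normH (n + 2) (v - w) := z2.normH_mono (by linarith)
  have hD : 0 ≤ D := (normH_nonneg _ _).trans m1
  rw [bilin_sub_bilin hn v0 w0]
  calc _ ≤ normH n (bilin v (v - w)) + normH n (bilin (v - w) w) := normH_add_le a.1 b.1
    _ ≤ bilinConst d n * D * normH (n + 2) (v - w) + bilinConst d n * normH (n + 2) (v - w) * D := by
        refine add_le_add (a.2.trans ?_) (b.2.trans ?_)
        · have := normH_nonneg (n + 1) (v - w)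
          gcongr
        · have := normH_nonneg (n + 1) w
          have := normH_nonneg (n + 2) (v - w)
          gcongr
    _ = _ := by ring

/-- The right-hand side is locally Lipschitz from `H^{n+2}` to `H^n`. -/
lemma normH_rhs_sub_le {n D ν : ℝ} (hn : (d : ℝ) / 2 + 1 < n) (hν : 0 ≤ ν) {v w : VField d}
    (hv : MemH (n + 2) v) (hw : MemH (n + 2) w) (hvD : normH (n + 2) v ≤ D)
    (hwD : normH (n + 2) w ≤ D) :
    normH n (rhs ν v - rhs ν w) ≤ (ν + 2 * bilinConst d n * D) * normH (n + 2) (v - w) := by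
  have e : rhs ν v - rhs ν w = ν • lap (v - w) + (bilin v v - bilin w w) := by
    rw [lap_sub, smul_sub, rhs, rhs]; abel
  have b : MemH n (bilin v v - bilin w w) :=
    (bilin_sobolev hn (hv.mono (by linarith)) (hv.mono (by linarith))).1.sub
      (bilin_sobolev hn (hw.mono (by linarith)) (hw.mono (by linarith))).1
  rw [e]
  have l := (hv.sub hw).lap
  refine (normH_add_le (l.1.smul ν) b).trans ?_
  rw [normH_smul l.1, l.2, abs_of_nonneg hν, add_mul]
  gcongr
  exact normH_bilin_sub_le hn hv hw hvD hwD

lemma innerH_add_left {n : ℝ} {u v w : VField d} (hu : MemH n u) (hv : MemH n v) (hw : MemH n w) :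
    innerH n (u + v) w = innerH n u w + innerH n v w := by
  rw [← inner_emb (hu.add hv) hw, embW_add hu.sumW hv.sumW, inner_add_left, inner_emb hu hw,
    inner_emb hv hw]

lemma innerH_smul_left {n : ℝ} {u w : VField d} (hu : MemH n u) (hw : MemH n w) (c : ℝ) :
    innerH n (c • u) w = c * innerH n u w := by
  rw [← inner_emb (hu.smul c) hw, embW_smul hu.sumW, real_inner_smul_left, inner_emb hu hw]

lemma innerH_le {n : ℝ} {u w : VField d} (hu : MemH n u) (hw : MemH n w) :
    innerH n u w ≤ normH n u * normH n w := by
  rw [← inner_emb hu hw, ← norm_emb, ← norm_emb]; exact real_inner_le_norm _ _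

lemma innerH_lap {n : ℝ} {v : VField d} (hv : MemH (n + 2) v) :
    innerH n (lap v) v = -normH (n + 1) v ^ 2 := by
  rw [innerH, normH_sq, ← tsum_neg]
  refine tsum_congr fun k => ?_
  rw [re_inner_lap]
  by_cases hk : k = 0
  · subst hk; simp [hv.mean]
  · rw [show 2 * (n + 1) = 2 * n + (2 : ℕ) by push_cast; ring,
      Real.rpow_add_natCast (kabs_pos hk).ne']
    ring

/-- Continuous dependence in `L²`, with residuals. -/
theorem l2_stability {n ν a b R ε : ℝ} (hn : (d : ℝ) / 2 + 1 < n) (hν : 0 ≤ ν) (hR : 0 ≤ R)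
    {u v f g : ℝ → VField d}
    (hu : ∀ t ∈ Set.Icc a b, MemH (n + 2) (u t)) (hv : ∀ t ∈ Set.Icc a b, MemH (n + 2) (v t))
    (hf : ∀ t ∈ Set.Icc a b, MemH 0 (f t)) (hg : ∀ t ∈ Set.Icc a b, MemH 0 (g t))
    (hdu : ∀ t ∈ Set.Icc a b, HasDerivWithinAt (fun t => embW (sobW 0) (u t))
      (embW (sobW 0) (rhs ν (u t) + f t)) (Set.Icc a b) t)
    (hdv : ∀ t ∈ Set.Icc a b, HasDerivWithinAt (fun t => embW (sobW 0) (v t))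
      (embW (sobW 0) (rhs ν (v t) + g t)) (Set.Icc a b) t)
    (hvR : ∀ t ∈ Set.Icc a b, normH n (v t) ≤ R)
    (hε : ∀ t ∈ Set.Icc a b, normH 0 (f t - g t) ≤ ε) {t : ℝ} (ht : t ∈ Set.Icc a b) :
    normH 0 (u t - v t) ^ 2 ≤ (normH 0 (u a - v a) ^ 2 + ε ^ 2) *
      Real.exp ((2 * bilinConst d n * R + 1) * (t - a)) := by
  have hd : (0 : ℝ) ≤ d := Nat.cast_nonneg d
  have hc := bilinConst_nonneg d n
  have key : ∀ t ∈ Set.Icc a b, normH 0 (u t - v t) ^ 2 =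
      ‖embW (sobW 0) (u t) - embW (sobW 0) (v t)‖ ^ 2 := fun t ht => by
    rw [← norm_emb, embW_sub ((hu t ht).mono (by linarith)).sumW ((hv t ht).mono (by linarith)).sumW]
  have ha : a ∈ Set.Icc a b := ⟨le_rfl, ht.1.trans ht.2⟩
  rw [key t ht, key a ha]
  refine le_mul_exp_of_deriv_le (f := fun t => ‖embW (sobW 0) (u t) - embW (sobW 0) (v t)‖ ^ 2)
    (by nlinarith [mul_nonneg hc hR]) (sq_nonneg _)
    (fun s hs => ((hdu s hs).sub (hdv s hs)).norm_sq) (fun s hs => ?_) ht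
  have u2 := hu s hs
  have v2 := hv s hs
  have w2 := u2.sub v2
  set w := u s - v s with hw
  have u0 : MemH n (u s) := u2.mono (by linarith)
  have v0 : MemH n (v s) := v2.mono (by linarith)
  have w0 : MemH n w := w2.mono (by linarith)
  have wz : MemH 0 w := w2.mono (by linarith)
  have fg := (hf s hs).sub (hg s hs)
  have b1 : MemH 0 (bilin (u s) w) := (bilin_sobolev hn u0 (w2.mono (by linarith))).1.mono (by linarith)
  have b2 : MemH 0 (bilin w (v s)) := (bilin_sobolev hn w0 (v2.mono (by linarith))).1.mono (by linarith)
  have l0 : MemH 0 (lap w) := (w2.mono (by linarith : (0 : ℝ) + 2 ≤ n + 2)).lap.1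
  have hru : MemH 0 (rhs ν (u s)) := (u2.rhs hn ν).mono (by linarith)
  have hrv : MemH 0 (rhs ν (v s)) := (v2.rhs hn ν).mono (by linarith)
  -- With `w = u - v`, the term `𝒫(u, w)` is orthogonal to `w` in `L²`, and `𝒫(w, v)` costs only the
  -- `H^n` norm of `v`; no bound on `u` is needed.
  have e : (rhs ν (u s) + f s) - (rhs ν (v s) + g s) =
      ν • lap w + bilin (u s) w + bilin w (v s) + (f s - g s) := by
    have := bilin_sub_bilin hn u0 v0
    rw [add_assoc (ν • lap w), ← this, hw, lap_sub, smul_sub, rhs, rhs]; abel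
  have ew : embW (sobW 0) (u s) - embW (sobW 0) (v s) = embW (sobW 0) w := by
    rw [hw, embW_sub (u0.mono (by linarith)).sumW (v0.mono (by linarith)).sumW]
  simp only [Pi.sub_apply]
  rw [ew, ← embW_sub (hru.add (hf s hs)).sumW (hrv.add (hg s hs)).sumW, e, real_inner_comm,
    inner_emb ((((l0.smul ν).add b1).add b2).add fg) wz, norm_emb,
    innerH_add_left (((l0.smul ν).add b1).add b2) fg wz,
    innerH_add_left ((l0.smul ν).add b1) b2 wz, innerH_add_left (l0.smul ν) b1 wz,
    innerH_smul_left l0 wz, innerH_zero_bilin hn u0 w0,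
    innerH_lap (w2.mono (by linarith : (0 : ℝ) + 2 ≤ n + 2))]
  have i1 : innerH 0 (bilin w (v s)) w ≤ bilinConst d n * R * normH 0 w * normH 0 w := by
    refine (innerH_le b2 wz).trans ?_
    have := normH_nonneg 0 w
    gcongr
    refine (bilin_L2 hn w0 (v2.mono (by linarith))).trans ?_
    gcongr
    exact hvR s hs
  have i2 : innerH 0 (f s - g s) w ≤ ε * normH 0 w := by
    refine (innerH_le fg wz).trans ?_
    have := normH_nonneg 0 w
    gcongr
    exact hε s hs
  have i3 : 0 ≤ ν * normH (0 + 1) w ^ 2 := by positivity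
  -- The residual contributes `2ε‖w‖ ≤ ε² + ‖w‖²`, whence the `+ 1` in the exponent.
  nlinarith [sq_nonneg (ε - normH 0 w)]

/-! ### Limits, high-frequency tails and differentiation of uniform limits. -/

/-- A limit in the weighted `ℓ²` space of elements of `H^m` comes from an element of `H^m`. -/
lemma exists_limit {m : ℝ} {v : ℕ → VField d} (hv : ∀ j, MemH m (v j)) {U : L2 d}
    (hU : Tendsto (fun j => embW (sobW m) (v j)) atTop (𝓝 U)) :
    ∃ w : VField d, MemH m w ∧ embW (sobW m) w = U ∧
      ∀ k, Tendsto (fun j => v j k) atTop (𝓝 (w k)) := by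
  have hcoef : ∀ k, Tendsto (fun j => embW (sobW m) (v j) k) atTop (𝓝 (U k)) := fun k => by
    rw [tendsto_iff_norm_sub_tendsto_zero] at hU ⊢
    refine squeeze_zero (fun _ => norm_nonneg _) (fun j => ?_) hU
    exact lp.norm_apply_le_norm (by norm_num) (embW (sobW m) (v j) - U) k
  -- The weight may vanish at `k = 0`, so the zero mode is set by hand.
  set w : VField d := fun k => if k = 0 then 0 else (sobW m k)⁻¹ • U k with hw
  have hlim : ∀ k, Tendsto (fun j => v j k) atTop (𝓝 (w k)) := by
    intro k
    by_cases hk : k = 0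
    · subst hk
      simp only [(hv _).mean, hw, if_true]
      exact tendsto_const_nhds
    · have hp : sobW m k ≠ 0 := (Real.rpow_pos_of_pos (kabs_pos hk) m).ne'
      have := (hcoef k).const_smul (sobW m k)⁻¹
      simp only [embW_apply (hv _).sumW, inv_smul_smul₀ hp] at this
      simpa only [hw, hk, if_false] using this
  have hsw : ∀ k, sobW m k • w k = U k := fun k => by
    have h1 := (hlim k).const_smul (sobW m k)
    simp only [← embW_apply (hv _).sumW] at h1
    exact tendsto_nhds_unique h1 (hcoef k)
  have happ : ∀ k r, Tendsto (fun j => v j k r) atTop (𝓝 (w k r)) := fun k r =>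
    ((EuclideanSpace.proj r : EuclideanSpace ℂ (Fin d) →L[ℂ] ℂ).continuous.tendsto _).comp (hlim k)
  have hsum : SumW (sobW m) w := by
    rw [sumW_iff_memℓp]
    simp only [hsw]
    exact lp.memℓp U
  refine ⟨w, ⟨fun k r => ?_, by simp [hw], fun k => ?_, sumW_sobW_iff.mp hsum⟩, ?_, hlim⟩
  · refine tendsto_nhds_unique (happ (-k) r) ?_
    simp only [(hv _).real]
    exact (Complex.continuous_conj.tendsto _).comp (happ k r)
  · have h1 := tendsto_finsetSum (Finset.univ : Finset (Fin d))
      fun s _ => (happ k s).const_mul (k s : ℂ)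
    simp only [(hv _).div] at h1
    exact tendsto_nhds_unique h1 tendsto_const_nhds
  · ext1; funext k
    rw [embW_apply hsum, hsw]

lemma MemH.sumW_tailW {p K : ℝ} (hK : 0 < K) {v : VField d} (hv : MemH p v) :
    SumW (tailW p K) v := by
  refine (norm_embW_mono hv.sumW fun k => ?_).1
  have := tailW_nonneg p hK k
  gcongr
  exact mul_le_of_le_one_right (Real.rpow_nonneg (kabs_nonneg k) _) (min_le_right _ _)

/-- Dominated convergence: at each fixed `k` the factor `min(|k|/K, 1)` tends to `0`. -/
lemma MemH.tendsto_norm_tailW {p : ℝ} {v : VField d} (hv : MemH p v) :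
    Tendsto (fun K => ‖embW (tailW p K) v‖ ^ 2) atTop (𝓝 0) := by
  simp only [norm_embW_sq]
  have h := tendsto_tsum_of_dominated_convergence (𝓕 := atTop)
    (f := fun K k => tailW p K k ^ 2 * ‖v k‖ ^ 2) (g := fun _ : Fin d → ℤ => (0 : ℝ))
    (bound := fun k => kabs k ^ (2 * p) * ‖v k‖ ^ 2) hv.summable (fun k => ?_) ?_
  · simpa using h
  · have h1 : Tendsto (fun K : ℝ => min (kabs k / K) 1) atTop (𝓝 (min 0 1)) :=
      (tendsto_id.const_div_atTop (kabs k)).min tendsto_const_nhds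
    rw [min_eq_left zero_le_one] at h1
    have h2 := ((h1.const_mul (kabs k ^ p)).pow 2).mul_const (‖v k‖ ^ 2)
    simpa [tailW] using h2
  · filter_upwards [eventually_gt_atTop 0] with K hK k
    rw [Real.norm_of_nonneg (by positivity), ← sq_kabs_rpow]
    have := tailW_nonneg p hK k
    gcongr
    exact mul_le_of_le_one_right (Real.rpow_nonneg (kabs_nonneg k) _) (min_le_right _ _)

/-- Low frequencies are controlled by `L²`, high frequencies by the tail weight. -/
lemma normH_le_add_tailW {p K : ℝ} (hp : 0 ≤ p) (hK : 0 < K) {v : VField d} (hv : MemH p v) :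
    normH p v ≤ K ^ p * normH 0 v + ‖embW (tailW p K) v‖ := by
  have h0 : MemH 0 v := hv.mono hp
  have hKp : 0 < K ^ p := Real.rpow_pos_of_pos hK p
  have ht := hv.sumW_tailW hK
  have h1 : MemH p (trunc K v) := hv.trunc K
  have h2 : MemH p (v - trunc K v) := hv.sub h1
  have e : v = trunc K v + (v - trunc K v) := by abel
  have b1 : normH p (trunc K v) ≤ K ^ p * normH 0 v := by
    rw [← norm_emb, ← norm_emb, ← abs_of_pos hKp, ← Real.norm_eq_abs, ← norm_smul,
      ← embW_smul h0.sumW, ← sq_le_sq₀ (norm_nonneg _) (norm_nonneg _), norm_embW_sq, norm_embW_sq]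
    refine h1.sumW.tsum_le_tsum (fun k => ?_) (h0.smul (K ^ p)).sumW
    by_cases hk : kabs k ≤ K
    · simp only [trunc, hk, if_true, Pi.smul_apply, norm_smul, Real.norm_of_nonneg hKp.le]
      simp only [sobW, Real.rpow_zero, one_pow, one_mul, mul_pow]
      gcongr
      · exact Real.rpow_nonneg (kabs_nonneg k) p
      · exact kabs_nonneg k
    · simp only [trunc, hk, if_false, norm_zero]
      simp only [ne_eq, OfNat.ofNat_ne_zero, not_false_eq_true, zero_pow, mul_zero]
      positivity
  have b2 : normH p (v - trunc K v) ≤ ‖embW (tailW p K) v‖ := by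
    rw [← norm_emb, ← sq_le_sq₀ (norm_nonneg _) (norm_nonneg _), norm_embW_sq, norm_embW_sq]
    refine h2.sumW.tsum_le_tsum (fun k => ?_) ht
    by_cases hk : kabs k ≤ K
    · simp only [trunc, hk, if_true, Pi.sub_apply, sub_self, norm_zero]
      simp only [ne_eq, OfNat.ofNat_ne_zero, not_false_eq_true, zero_pow, mul_zero]
      positivity
    · have : tailW p K k = sobW p k := by
        rw [tailW, min_eq_right ((one_le_div hK).mpr (not_le.mp hk).le), mul_one]; rfl
      simp only [trunc, hk, if_false, Pi.sub_apply, sub_zero, this, le_refl]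
  calc normH p v = normH p (trunc K v + (v - trunc K v)) := by rw [← e]
    _ ≤ _ := (normH_add_le h1 h2).trans (add_le_add b1 b2)

/-- Differentiability of a uniform limit on a convex set. -/
lemma hasDerivWithinAt_of_uniform_limit {F : Type*} [NormedAddCommGroup F] [NormedSpace ℝ F]
    {s : Set ℝ} (hs : Convex ℝ s) {U : ℕ → ℝ → F} {U' : ℕ → ℝ → F} {V V' : ℝ → F}
    (hd : ∀ j, ∀ t ∈ s, HasDerivWithinAt (U j) (U' j t) s t)
    (hU : ∀ t ∈ s, Tendsto (fun j => U j t) atTop (𝓝 (V t)))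
    (hU' : TendstoUniformlyOn U' V' atTop s) (hV' : ContinuousOn V' s) {t : ℝ} (ht : t ∈ s) :
    HasDerivWithinAt V (V' t) s t := by
  rw [hasDerivWithinAt_iff_isLittleO, Asymptotics.isLittleO_iff]
  intro ε hε
  obtain ⟨δ, hδ, hδ'⟩ := Metric.continuousWithinAt_iff.mp (hV' t ht) (ε / 2) (by positivity)
  have hmem : s ∩ Metric.ball t δ ∈ 𝓝[s] t :=
    inter_mem_nhdsWithin s (Metric.ball_mem_nhds t hδ)
  filter_upwards [hmem] with x hx
  have hconv : Convex ℝ (s ∩ Metric.ball t δ) := hs.inter (convex_ball t δ)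
  have ht' : t ∈ s ∩ Metric.ball t δ := ⟨ht, Metric.mem_ball_self hδ⟩
  -- Mean value inequality for `U_j(r) - r V'(t)` near `t`: half of `ε` comes from uniform
  -- convergence, half from continuity of `V'`.
  have hev : ∀ᶠ j in atTop, ‖U j x - U j t - (x - t) • V' t‖ ≤ ε * ‖x - t‖ := by
    filter_upwards [Metric.tendstoUniformlyOn_iff.mp hU' (ε / 2) (by positivity)] with j hj
    have := hconv.norm_image_sub_le_of_norm_hasDerivWithin_le (f := fun r => U j r - r • V' t)
      (f' := fun r => U' j r - (1 : ℝ) • V' t) (C := ε)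
      (fun r hr => ((hd j r hr.1).mono Set.inter_subset_left).sub
        ((hasDerivWithinAt_id r _).smul_const (V' t)))
      (fun r hr => ?_) ht' hx
    · rw [sub_smul]
      convert this using 2
      abel
    · have h1 := hj r hr.1
      have h2 := hδ' hr.1 hr.2
      rw [dist_eq_norm, norm_sub_rev] at h1
      rw [dist_eq_norm] at h2
      calc ‖U' j r - (1 : ℝ) • V' t‖ = ‖(U' j r - V' r) + (V' r - V' t)‖ := by
            rw [one_smul]; congr 1; abel
        _ ≤ ‖U' j r - V' r‖ + ‖V' r - V' t‖ := norm_add_le _ _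
        _ ≤ ε := by linarith
  exact le_of_tendsto (((hU x hx.1).sub (hU t ht)).sub tendsto_const_nhds).norm hev

/-! ### Uniform Galerkin bounds and local existence. -/

/-- The constant in the Galerkin energy inequality with the weight `|k|^p`. -/
def energyConst (d : ℕ) (n p : ℝ) : ℝ :=
  4 * fourierNormalization d * weightConst p * wienerConst d n

lemma energyConst_nonneg (d : ℕ) (n : ℝ) {p : ℝ} (hp : 0 ≤ p) : 0 ≤ energyConst d n p := by
  have := (fourierNormalization_pos d).le
  have := wienerConst_nonneg d n
  unfold energyConst weightConst; positivity

lemma galerkin_energy_tailW {n p K ν N : ℝ} (hn : (d : ℝ) / 2 + 1 < n) (hp : 0 ≤ p) (hK : 0 < K)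
    (hν : 0 ≤ ν) {v : VField d} (hv : IsTrig N v) :
    2 * inner ℝ (embW (tailW p K) v) (embW (tailW p K) (galerkinRHS ν N v)) ≤
      energyConst d n p * normH n v * ‖embW (tailW p K) v‖ ^ 2 :=
  galerkin_energy hn hν (by unfold weightConst; positivity) (isEnergyWeight_tailW hp hK) hv

lemma embW_tailW_one {p : ℝ} (hp : p ≠ 0) (v : VField d) : embW (tailW p 1) v = embW (sobW p) v := by
  congr 1; funext k; exact tailW_one hp k

/-- A time of existence depending only on the size `R` of the datum in `H^n`. -/
def lifespan (d : ℕ) (n R : ℝ) : ℝ := 3 * R ^ 2 / (8 * energyConst d n n * R ^ 3 + 1)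

lemma lifespan_pos {n R : ℝ} (hn : 0 ≤ n) (hR : 0 < R) : 0 < lifespan d n R := by
  have := energyConst_nonneg d n hn
  unfold lifespan; positivity

/-- A curve of trigonometric polynomials solving the Galerkin system on `[0, τ]`. -/
structure IsGalerkin (ν N τ : ℝ) (u₀ : VField d) (u : ℝ → VField d) : Prop where
  init : u 0 = trunc N u₀
  trig : ∀ t, IsTrig N (u t)
  deriv : ∀ φ : (Fin d → ℤ) → ℝ, ∀ t ∈ Set.Icc 0 τ, HasDerivWithinAt (fun t => embW φ (u t))
    (embW φ (galerkinRHS ν N (u t))) (Set.Icc 0 τ) t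

/-- While `‖u‖_n ≤ 2R`, the squared norm grows at rate at most `E(2R)³ = 8ER³`. The room to grow is
`(2R)² - R² = 3R²`, and the `+ 1` makes the comparison strict: this is the choice of `lifespan`,
independent of `N`. -/
lemma IsGalerkin.normH_le {n ν N R : ℝ} (hn : (d : ℝ) / 2 + 1 < n) (hν : 0 ≤ ν) (hR : 0 < R)
    {u₀ : VField d} (hu₀ : MemH n u₀) (hR₀ : normH n u₀ ≤ R) {u : ℝ → VField d}
    (hu : IsGalerkin ν N (lifespan d n R) u₀ u) {t : ℝ} (ht : t ∈ Set.Icc 0 (lifespan d n R)) :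
    normH n (u t) ≤ 2 * R := by
  have hd : (0 : ℝ) ≤ d := Nat.cast_nonneg d
  have hn0 : 0 < n := by linarith
  have hE := energyConst_nonneg d n hn0.le
  set E := energyConst d n n with hEdef
  set τ := lifespan d n R with hτ
  have hB : ∀ s ∈ Set.Icc 0 τ, R ^ 2 + (8 * E * R ^ 3 + 1) * s ≤ (2 * R) ^ 2 := fun s hs => by
    have hp : 0 < 8 * E * R ^ 3 + 1 := by positivity
    have h1 : s ≤ 3 * R ^ 2 / (8 * E * R ^ 3 + 1) := hs.2
    rw [le_div_iff₀ hp] at h1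
    nlinarith
  have key := image_le_of_deriv_right_lt_deriv_boundary' (a := 0) (b := τ)
    (f := fun s => ‖embW (sobW n) (u s)‖ ^ 2)
    (B := fun s => R ^ 2 + (8 * E * R ^ 3 + 1) * s) (B' := fun _ => 8 * E * R ^ 3 + 1)
    (fun s hs => (hu.deriv _ s hs).norm_sq.continuousWithinAt)
    (fun s hs => hasDerivWithinAt_Ici_of_Icc
      (hu.deriv _ s (Set.Ico_subset_Icc_self hs)).norm_sq hs)
    (by
      simp only [norm_emb, hu.init, mul_zero, add_zero]
      have := normH_nonneg n (trunc N u₀)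
      gcongr
      exact (normH_trunc_le hu₀ N).trans hR₀)
    (by fun_prop)
    (fun s _ => by
      have := ((hasDerivAt_id s).const_mul (8 * E * R ^ 3 + 1)).const_add (R ^ 2)
      simpa using this.hasDerivWithinAt)
    (fun s hs heq => by
      have h1 := galerkin_energy_tailW (p := n) (K := 1) hn hn0.le one_pos hν (hu.trig s)
      rw [embW_tailW_one hn0.ne', embW_tailW_one hn0.ne'] at h1
      refine lt_of_le_of_lt h1 ?_
      have h2 := hB s (Set.Ico_subset_Icc_self hs)
      rw [← heq, norm_emb] at h2
      have h3 := abs_le_of_sq_le_sq h2 (by positivity)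
      rw [abs_of_nonneg (normH_nonneg _ _)] at h3
      have h4 := normH_nonneg n (u s)
      rw [norm_emb]
      calc _ ≤ E * (2 * R) * (2 * R) ^ 2 := by gcongr
        _ < _ := by nlinarith)
    ht
  have := key.trans (hB t ht)
  rw [norm_emb] at this
  have h3 := abs_le_of_sq_le_sq this (by positivity)
  rwa [abs_of_nonneg (normH_nonneg _ _)] at h3

/-- Once `‖u‖_n ≤ 2R`, the energy inequality is linear in the weighted norm, so higher regularity
persists on the same interval. The factor is independent of `K` and `N`, so the smallness of the
tails of `u₀` passes to all approximations. -/
lemma IsGalerkin.norm_tailW_le {n p K ν N R : ℝ} (hn : (d : ℝ) / 2 + 1 < n) (hp : 0 ≤ p)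
    (hK : 0 < K) (hν : 0 ≤ ν) (hR : 0 < R) {u₀ : VField d} (hu₀ : MemH n u₀) (hup : MemH p u₀)
    (hR₀ : normH n u₀ ≤ R) {u : ℝ → VField d} (hu : IsGalerkin ν N (lifespan d n R) u₀ u) {t : ℝ}
    (ht : t ∈ Set.Icc 0 (lifespan d n R)) :
    ‖embW (tailW p K) (u t)‖ ^ 2 ≤ Real.exp ((2 * energyConst d n p * R + 1) * lifespan d n R) *
      ‖embW (tailW p K) u₀‖ ^ 2 := by
  have hE := energyConst_nonneg d n hp
  have h1 := le_mul_exp_of_deriv_le (f := fun s => ‖embW (tailW p K) (u s)‖ ^ 2) (ε := 0)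
    (K := 2 * energyConst d n p * R + 1) (by nlinarith [mul_nonneg hE hR.le]) le_rfl
    (fun s hs => (hu.deriv (tailW p K) s hs).norm_sq)
    (fun s hs => by
      refine (galerkin_energy_tailW hn hp hK hν (hu.trig s)).trans ?_
      have h2 := hu.normH_le hn hν hR hu₀ hR₀ hs
      have h3 : energyConst d n p * normH n (u s) * ‖embW (tailW p K) (u s)‖ ^ 2 ≤
        energyConst d n p * (2 * R) * ‖embW (tailW p K) (u s)‖ ^ 2 := by gcongr
      nlinarith [sq_nonneg ‖embW (tailW p K) (u s)‖]) ht
  refine h1.trans ?_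
  rw [add_zero, sub_zero, hu.init, mul_comm]
  gcongr
  · exact ht.2
  · exact (norm_embW_trunc_le (hup.sumW_tailW hK) N).2

/-- Local existence, on a time interval controlled by the norm of the datum in `H^n`. -/
theorem exists_local {n ν R : ℝ} (hn : (d : ℝ) / 2 + 1 < n) (hν : 0 ≤ ν) (hR : 0 < R)
    {u₀ : VField d} (hu₀ : MemH (n + 2) u₀) (hR₀ : normH n u₀ ≤ R) :
    ∃ u : ℝ → VField d, u 0 = u₀ ∧ (∀ t ∈ Set.Icc 0 (lifespan d n R), MemH (n + 2) (u t)) ∧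
      ContinuousOn (fun t => embW (sobW (n + 2)) (u t)) (Set.Icc 0 (lifespan d n R)) ∧
      ∀ t ∈ Set.Icc 0 (lifespan d n R), HasDerivWithinAt (fun t => embW (sobW n) (u t))
        (embW (sobW n) (rhs ν (u t))) (Set.Icc 0 (lifespan d n R)) t := by
  have hd : (0 : ℝ) ≤ d := Nat.cast_nonneg d
  have hn0 : 0 < n := by linarith
  have hτ := lifespan_pos (d := d) hn0.le hR
  set τ := lifespan d n R with hτdef
  have un : MemH n u₀ := hu₀.mono (by linarith)
  -- the Galerkin approximations
  have hex : ∀ j : ℕ, ∃ u : ℝ → VField d, IsGalerkin ν (j + 1) τ u₀ u := fun j => by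
    obtain ⟨u, h1, h2, h3⟩ := exists_galerkin hν hτ.le ((j : ℝ) + 1) hu₀
    exact ⟨u, h1, h2, h3⟩
  choose v hv using hex
  set L := Real.exp ((2 * energyConst d n (n + 2) * R + 1) * τ) with hL
  have hL0 : 0 < L := Real.exp_pos _
  have htail : ∀ K > 0, ∀ j, ∀ t ∈ Set.Icc 0 τ, ‖embW (tailW (n + 2) K) (v j t)‖ ^ 2 ≤
      L * ‖embW (tailW (n + 2) K) u₀‖ ^ 2 := fun K hK j t ht =>
    (hv j).norm_tailW_le hn (by linarith) hK hν hR un hu₀ hR₀ ht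
  set D := √(L * normH (n + 2) u₀ ^ 2) with hDdef
  have hD0 : 0 ≤ D := Real.sqrt_nonneg _
  have hD : ∀ j, ∀ t ∈ Set.Icc 0 τ, normH (n + 2) (v j t) ≤ D := fun j t ht => by
    have := htail 1 one_pos j t ht
    rw [embW_tailW_one (by linarith), embW_tailW_one (by linarith), norm_emb, norm_emb] at this
    exact Real.le_sqrt_of_sq_le this
  have hmem : ∀ j t p, MemH p (v j t) := fun j t p => ((hv j).trig t).memH p
  -- residuals
  set f : ℕ → ℝ → VField d := fun j t =>
    truncBilin (j + 1) (v j t) (v j t) - bilin (v j t) (v j t) with hf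
  have hbm : ∀ j t, MemH (n + 1) (bilin (v j t) (v j t)) := fun j t =>
    (bilin_sobolev (n := n + 1) (by linarith) (hmem j t _) (hmem j t _)).1
  have hfm : ∀ j t, MemH n (f j t) := fun j t =>
    ((hbm j t).mono (by linarith)).trunc _ |>.sub ((hbm j t).mono (by linarith))
  have hrhs : ∀ (j : ℕ) t, galerkinRHS ν (j + 1) (v j t) = rhs ν (v j t) + f j t := fun j t => by
    simp only [hf, galerkinRHS, rhs]; abel
  set C := bilinConst d (n + 1) * D * D with hC
  have hC0 : 0 ≤ C := by have := bilinConst_nonneg d (n + 1); positivity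
  -- The `H^{n+2}` bound controls the nonlinearity one order above `H^n`, so truncating it costs
  -- only `1/(j+1)` in `H^n`.
  have hb : ∀ j, ∀ t ∈ Set.Icc 0 τ, normH (n + 1) (bilin (v j t) (v j t)) ≤ C := fun j t ht => by
    have h1 := (bilin_sobolev (n := n + 1) (by linarith) (hmem j t _) (hmem j t _)).2
    have h2 : normH (n + 1) (v j t) ≤ D :=
      ((hmem j t (n + 2)).normH_mono (by linarith)).trans (hD j t ht)
    have h3 : normH (n + 1 + 1) (v j t) ≤ D := by
      rw [add_assoc, one_add_one_eq_two]; exact hD j t ht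
    have := bilinConst_nonneg d (n + 1)
    have := normH_nonneg (n + 1) (v j t)
    refine h1.trans ?_
    have := normH_nonneg (n + 1 + 1) (v j t)
    rw [hC]
    gcongr
  have hj0 : ∀ j : ℕ, (0 : ℝ) < (j : ℝ) + 1 := fun j => by positivity
  have hfn : ∀ j, ∀ t ∈ Set.Icc 0 τ, normH n (f j t) ≤ ((j : ℝ) + 1)⁻¹ * C := fun j t ht => by
    simp only [hf]
    rw [normH_sub_comm]
    refine (normH_sub_trunc_le (hj0 j) (hbm j t)).trans ?_
    have := hj0 j
    gcongr
    exact hb j t ht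
  have hfz : ∀ j, ∀ t ∈ Set.Icc 0 τ, normH 0 (f j t) ≤ ((j : ℝ) + 1)⁻¹ * C := fun j t ht =>
    ((hfm j t).normH_mono hn0.le).trans (hfn j t ht)
  -- closeness in `L²`
  set M := Real.exp ((2 * bilinConst d n * D + 1) * τ) with hM
  set A := normH (0 + 1) u₀ with hA
  have hA0 : 0 ≤ A := normH_nonneg _ _
  have hl2 : ∀ i j, ∀ t ∈ Set.Icc 0 τ, normH 0 (v i t - v j t) ^ 2 ≤
      ((((i : ℝ) + 1)⁻¹ + ((j : ℝ) + 1)⁻¹) ^ 2 * (A ^ 2 + C ^ 2)) * M := by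
    intro i j t ht
    have hi := inv_nonneg.mpr (hj0 i).le
    have hj := inv_nonneg.mpr (hj0 j).le
    have h1 := l2_stability (a := 0) (b := τ) (R := D)
      (ε := (((i : ℝ) + 1)⁻¹ + ((j : ℝ) + 1)⁻¹) * C) hn hν hD0
      (fun s _ => hmem i s _) (fun s _ => hmem j s _)
      (fun s _ => (hfm i s).mono hn0.le) (fun s _ => (hfm j s).mono hn0.le)
      (fun s hs => by rw [← hrhs]; exact (hv i).deriv _ s hs)
      (fun s hs => by rw [← hrhs]; exact (hv j).deriv _ s hs)
      (fun s hs => ((hmem j s (n + 2)).normH_mono (by linarith)).trans (hD j s hs))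
      (fun s hs => (normH_sub_le ((hfm i s).mono hn0.le) ((hfm j s).mono hn0.le)).trans (by
        rw [add_mul]; exact add_le_add (hfz i s hs) (hfz j s hs))) ht
    refine h1.trans ?_
    have hu1 : MemH (0 + 1) u₀ := hu₀.mono (by linarith)
    have hu0 : MemH 0 u₀ := hu₀.mono (by linarith)
    have h2 : normH 0 (v i 0 - v j 0) ≤ (((i : ℝ) + 1)⁻¹ + ((j : ℝ) + 1)⁻¹) * A := by
      rw [(hv i).init, (hv j).init]
      have e : trunc ((i : ℝ) + 1) u₀ - trunc ((j : ℝ) + 1) u₀ =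
        (u₀ - trunc ((j : ℝ) + 1) u₀) - (u₀ - trunc ((i : ℝ) + 1) u₀) := by abel
      rw [e]
      refine (normH_sub_le (hu0.sub (hu0.trunc _)) (hu0.sub (hu0.trunc _))).trans ?_
      have h3 := normH_sub_trunc_le (hj0 i) hu1
      have h4 := normH_sub_trunc_le (hj0 j) hu1
      rw [← hA] at h3 h4
      rw [add_mul]
      linarith
    have hbc := bilinConst_nonneg d n
    have := normH_nonneg 0 (v i 0 - v j 0)
    rw [sub_zero]
    calc _ ≤ (((((i : ℝ) + 1)⁻¹ + ((j : ℝ) + 1)⁻¹) * A) ^ 2 +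
            ((((i : ℝ) + 1)⁻¹ + ((j : ℝ) + 1)⁻¹) * C) ^ 2) * M := by
          rw [hM]
          gcongr
          exact ht.2
      _ = _ := by ring
  -- Cauchy property in `H^{n+2}`
  have hcauchy : UniformCauchySeqOn (fun j t => embW (sobW (n + 2)) (v j t)) atTop (Set.Icc 0 τ) := by
    rw [Metric.uniformCauchySeqOn_iff]
    intro ε hε
    have ht1 := (hu₀.tendsto_norm_tailW).const_mul L
    rw [mul_zero] at ht1
    -- `K` is fixed first, making all tails small. Only then is `J` chosen, so that `L²` closeness
    -- beats the factor `K^(n+2)` on the low frequencies.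
    obtain ⟨K, hK1, hK0⟩ := ((ht1.eventually (gt_mem_nhds (show 0 < (ε / 4) ^ 2 by positivity))).and
      (eventually_gt_atTop 0)).exists
    have hKp : 0 < K ^ (n + 2) := Real.rpow_pos_of_pos hK0 _
    have ht2 : Tendsto (fun J : ℕ => ((2 * ((J : ℝ) + 1)⁻¹) ^ 2 * (A ^ 2 + C ^ 2)) * M) atTop (𝓝 0) := by
      have h := (tendsto_one_div_add_atTop_nhds_zero_nat (𝕜 := ℝ))
      have := (((h.const_mul 2).pow 2).mul_const (A ^ 2 + C ^ 2)).mul_const M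
      simpa [one_div] using this
    obtain ⟨J, hJ⟩ := (ht2.eventually (gt_mem_nhds
      (show 0 < (ε / (4 * K ^ (n + 2))) ^ 2 by positivity))).exists
    refine ⟨J, fun i hi j hj t ht => ?_⟩
    have hdiff := (hmem i t (n + 2)).sub (hmem j t (n + 2))
    rw [dist_eq_norm, ← embW_sub (hmem i t _).sumW (hmem j t _).sumW, norm_emb]
    have htl : ∀ i, ‖embW (tailW (n + 2) K) (v i t)‖ < ε / 4 := fun i =>
      lt_of_pow_lt_pow_left₀ 2 (by positivity) ((htail K hK0 i t ht).trans_lt hK1)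
    have hlow : normH 0 (v i t - v j t) < ε / (4 * K ^ (n + 2)) := by
      refine lt_of_pow_lt_pow_left₀ 2 (by positivity) ((hl2 i j t ht).trans_lt
        (lt_of_le_of_lt ?_ hJ))
      have hi' : ((i : ℝ) + 1)⁻¹ ≤ ((J : ℝ) + 1)⁻¹ := by gcongr
      have hj' : ((j : ℝ) + 1)⁻¹ ≤ ((J : ℝ) + 1)⁻¹ := by gcongr
      have := inv_nonneg.mpr (hj0 i).le
      have := inv_nonneg.mpr (hj0 j).le
      gcongr
      linarith
    have h1 := normH_le_add_tailW (p := n + 2) (by linarith) hK0 hdiff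
    have h2 : ‖embW (tailW (n + 2) K) (v i t - v j t)‖ ≤
        ‖embW (tailW (n + 2) K) (v i t)‖ + ‖embW (tailW (n + 2) K) (v j t)‖ := by
      rw [embW_sub (((hv i).trig t).sumW _) (((hv j).trig t).sumW _)]
      exact norm_sub_le _ _
    have h3 : K ^ (n + 2) * normH 0 (v i t - v j t) < ε / 4 := by
      calc _ < K ^ (n + 2) * (ε / (4 * K ^ (n + 2))) := by gcongr
        _ = ε / 4 := by field_simp
    linarith [htl i, htl j]
  -- the limit
  have hlim : ∀ t, ∃ w : VField d, t ∈ Set.Icc 0 τ → MemH (n + 2) w ∧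
      Tendsto (fun j => embW (sobW (n + 2)) (v j t)) atTop (𝓝 (embW (sobW (n + 2)) w)) ∧
      ∀ k, Tendsto (fun j => v j t k) atTop (𝓝 (w k)) := by
    intro t
    by_cases ht : t ∈ Set.Icc 0 τ
    · obtain ⟨U, hU⟩ := cauchySeq_tendsto_of_complete (hcauchy.cauchySeq ht)
      obtain ⟨w, h1, h2, h3⟩ := exists_limit (fun j => hmem j t _) hU
      exact ⟨w, fun _ => ⟨h1, h2 ▸ hU, h3⟩⟩
    · exact ⟨0, fun h => absurd h ht⟩
  choose u hu using hlim
  have hunif : TendstoUniformlyOn (fun j t => embW (sobW (n + 2)) (v j t))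
      (fun t => embW (sobW (n + 2)) (u t)) atTop (Set.Icc 0 τ) :=
    hcauchy.tendstoUniformlyOn_of_tendsto fun t ht => (hu t ht).2.1
  have hcontv : ∀ j, ContinuousOn (fun t => embW (sobW (n + 2)) (v j t)) (Set.Icc 0 τ) :=
    fun j t ht => ((hv j).deriv _ t ht).continuousWithinAt
  have hcont : ContinuousOn (fun t => embW (sobW (n + 2)) (u t)) (Set.Icc 0 τ) :=
    hunif.continuousOn (Frequently.of_forall hcontv)
  have huD : ∀ t ∈ Set.Icc 0 τ, normH (n + 2) (u t) ≤ D := fun t ht => by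
    rw [← norm_emb]
    refine le_of_tendsto (hu t ht).2.1.norm (Eventually.of_forall fun j => ?_)
    rw [norm_emb]; exact hD j t ht
  have hlip : ∀ {a b : VField d}, MemH (n + 2) a → MemH (n + 2) b → normH (n + 2) a ≤ D →
      normH (n + 2) b ≤ D → ‖embW (sobW n) (rhs ν a) - embW (sobW n) (rhs ν b)‖ ≤
        (ν + 2 * bilinConst d n * D) * ‖embW (sobW (n + 2)) a - embW (sobW (n + 2)) b‖ := by
    intro a b ha hb haD hbD
    rw [← embW_sub (ha.rhs hn ν).sumW (hb.rhs hn ν).sumW, ← embW_sub ha.sumW hb.sumW, norm_emb,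
      norm_emb]
    exact normH_rhs_sub_le hn hν ha hb haD hbD
  set Λ := ν + 2 * bilinConst d n * D with hΛ
  have hΛ0 : 0 ≤ Λ := by have := bilinConst_nonneg d n; positivity
  have hcont' : ContinuousOn (fun t => embW (sobW n) (rhs ν (u t))) (Set.Icc 0 τ) := by
    intro t ht
    rw [ContinuousWithinAt, tendsto_iff_norm_sub_tendsto_zero]
    have h1 := (tendsto_iff_norm_sub_tendsto_zero.mp (hcont t ht)).const_mul Λ
    rw [mul_zero] at h1
    refine squeeze_zero' (Eventually.of_forall fun _ => norm_nonneg _) ?_ h1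
    filter_upwards [self_mem_nhdsWithin] with s hs
    exact hlip (hu s hs).1 (hu t ht).1 (huD s hs) (huD t ht)
  have hn2 : ∀ {a : VField d}, MemH (n + 2) a → SumW (sobW n) a := fun ha =>
    (ha.mono (by linarith)).sumW
  refine ⟨u, ?_, fun t ht => (hu t ht).1, hcont, fun t ht =>
    hasDerivWithinAt_of_uniform_limit (convex_Icc 0 τ) (fun j => (hv j).deriv (sobW n)) ?_ ?_ hcont' ht⟩
  · funext k
    refine tendsto_nhds_unique ((hu 0 ⟨le_rfl, hτ.le⟩).2.2 k) ?_
    refine tendsto_const_nhds.congr' ?_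
    obtain ⟨J, hJ⟩ := exists_nat_ge (kabs k)
    filter_upwards [eventually_ge_atTop J] with j hj
    rw [(hv j).init, trunc, if_pos]
    have : (J : ℝ) ≤ j := by exact_mod_cast hj
    linarith
  · intro s hs
    rw [tendsto_iff_norm_sub_tendsto_zero]
    refine squeeze_zero (fun _ => norm_nonneg _) (fun j => ?_)
      (tendsto_iff_norm_sub_tendsto_zero.mp (hu s hs).2.1)
    rw [← embW_sub (hn2 (hmem j s _)) (hn2 (hu s hs).1),
      ← embW_sub (hmem j s _).sumW (hu s hs).1.sumW, norm_emb, norm_emb]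
    exact ((hmem j s _).sub (hu s hs).1).normH_mono (by linarith)
  -- The derivatives converge uniformly in `H^n`: the right-hand side is Lipschitz on the `H^{n+2}`
  -- ball of radius `D`, and the residuals tend to `0`.
  · rw [Metric.tendstoUniformlyOn_iff]
    intro ε hε
    have h1 := Metric.tendstoUniformlyOn_iff.mp hunif (ε / (2 * (Λ + 1))) (by positivity)
    have h2 : Tendsto (fun j : ℕ => ((j : ℝ) + 1)⁻¹ * C) atTop (𝓝 0) := by
      have := (tendsto_one_div_add_atTop_nhds_zero_nat (𝕜 := ℝ)).mul_const C
      simpa [one_div] using this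
    filter_upwards [h1, h2.eventually (gt_mem_nhds (show 0 < ε / 2 by positivity))] with j hj1 hj2 s hs
    have g1 := hj1 s hs
    rw [dist_eq_norm] at g1 ⊢
    have hrj := (hmem j s (n + 2)).rhs hn ν
    rw [hrhs, embW_add hrj.sumW (hfm j s).sumW, ← sub_sub]
    have g2 := hlip (hu s hs).1 (hmem j s _) (huD s hs) (hD j s hs)
    have g3 := hfn j s hs
    have g4 : Λ * ‖embW (sobW (n + 2)) (u s) - embW (sobW (n + 2)) (v j s)‖ ≤ ε / 2 := by
      calc _ ≤ (Λ + 1) * (ε / (2 * (Λ + 1))) := by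
            gcongr
            linarith
        _ = ε / 2 := by field_simp
    refine (norm_sub_le _ _).trans_lt ?_
    rw [norm_emb n (f j s)]
    linarith

/-! ### Gluing, uniqueness, maximal solutions and continuation. -/

/-- `u` solves the unforced equations on the set of times `I`, in terms of weighted `ℓ²` spaces. -/
structure SolvesOn (n ν : ℝ) (I : Set ℝ) (u : ℝ → VField d) : Prop where
  mem : ∀ t ∈ I, MemH (n + 2) (u t)
  cont : ContinuousOn (fun t => embW (sobW (n + 2)) (u t)) I
  deriv : ∀ t ∈ I, HasDerivWithinAt (fun t => embW (sobW n) (u t)) (embW (sobW n) (rhs ν (u t))) I t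

lemma SolvesOn.mono {n ν : ℝ} {I J : Set ℝ} {u : ℝ → VField d} (h : SolvesOn n ν J u)
    (hIJ : I ⊆ J) : SolvesOn n ν I u :=
  ⟨fun t ht => h.mem t (hIJ ht), h.cont.mono hIJ, fun t ht => (h.deriv t (hIJ ht)).mono hIJ⟩

lemma SolvesOn.of_local {n ν : ℝ} {I : Set ℝ} {u : ℝ → VField d}
    (h : ∀ t ∈ I, ∃ (J : Set ℝ) (v : ℝ → VField d), J ∈ 𝓝[I] t ∧ SolvesOn n ν J v ∧
      Set.EqOn u v J) : SolvesOn n ν I u := by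
  have key : ∀ t ∈ I, ∃ J : Set ℝ, J ∈ 𝓝[I] t ∧ t ∈ J ∧ SolvesOn n ν J u := by
    intro t ht
    obtain ⟨J, v, hJ, hv, heq⟩ := h t ht
    refine ⟨J, hJ, mem_of_mem_nhdsWithin ht hJ, fun s hs => heq hs ▸ hv.mem s hs,
      hv.cont.congr fun s hs => ?_, fun s hs => ?_⟩
    · simp only [heq hs]
    · rw [heq hs]
      exact (hv.deriv s hs).congr (fun r hr => by simp only [heq hr]) (by simp only [heq hs])
  refine ⟨fun t ht => ?_, fun t ht => ?_, fun t ht => ?_⟩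
  · obtain ⟨J, -, htJ, hJ⟩ := key t ht
    exact hJ.mem t htJ
  · obtain ⟨J, hn, htJ, hJ⟩ := key t ht
    exact (hJ.cont t htJ).mono_of_mem_nhdsWithin hn
  · obtain ⟨J, hn, htJ, hJ⟩ := key t ht
    exact (hJ.deriv t htJ).mono_of_mem_nhdsWithin hn

lemma SolvesOn.shift {n ν : ℝ} {I : Set ℝ} {u : ℝ → VField d} (h : SolvesOn n ν I u) (c : ℝ) :
    SolvesOn n ν ((fun t => t - c) ⁻¹' I) (fun t => u (t - c)) := by
  refine ⟨fun t ht => h.mem _ ht, ?_, fun t ht => ?_⟩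
  · exact h.cont.comp (f := fun t : ℝ => t - c) (by fun_prop) (fun t ht => ht)
  · have h1 : HasDerivWithinAt (fun t : ℝ => t - c) 1 ((fun t => t - c) ⁻¹' I) t :=
      (hasDerivWithinAt_id t _).sub_const c
    have := (h.deriv _ ht).scomp t h1 (fun s hs => hs)
    rwa [one_smul] at this

lemma continuousOn_rhs {n ν : ℝ} (hn : (d : ℝ) / 2 + 1 < n) (hν : 0 ≤ ν) {I : Set ℝ}
    {u : ℝ → VField d} (hm : ∀ t ∈ I, MemH (n + 2) (u t))
    (hc : ContinuousOn (fun t => embW (sobW (n + 2)) (u t)) I) :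
    ContinuousOn (fun t => embW (sobW n) (rhs ν (u t))) I := by
  intro t ht
  rw [ContinuousWithinAt, tendsto_iff_norm_sub_tendsto_zero]
  set D := normH (n + 2) (u t) + 1 with hD
  have h1 := (tendsto_iff_norm_sub_tendsto_zero.mp (hc t ht)).const_mul
    (ν + 2 * bilinConst d n * D)
  rw [mul_zero] at h1
  have h2 : ∀ᶠ s in 𝓝[I] t, ‖embW (sobW (n + 2)) (u s)‖ < D :=
    (hc t ht).norm.eventually (gt_mem_nhds (by simp only [norm_emb, hD]; linarith))
  refine squeeze_zero' (Eventually.of_forall fun _ => norm_nonneg _) ?_ h1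
  filter_upwards [self_mem_nhdsWithin, h2] with s hs hsD
  rw [norm_emb] at hsD
  rw [← embW_sub ((hm s hs).rhs hn ν).sumW ((hm t ht).rhs hn ν).sumW,
    ← embW_sub (hm s hs).sumW (hm t ht).sumW, norm_emb, norm_emb]
  exact normH_rhs_sub_le hn hν (hm s hs) (hm t ht) hsD.le (by rw [hD]; linarith)

lemma tendsto_normH_sub_iff {n : ℝ} {I : Set ℝ} {u : ℝ → VField d} (hm : ∀ t ∈ I, MemH n (u t))
    {t : ℝ} (ht : t ∈ I) :
    Tendsto (fun s => normH n (u s - u t)) (𝓝[I] t) (𝓝 0) ↔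
      ContinuousWithinAt (fun s => embW (sobW n) (u s)) I t := by
  rw [ContinuousWithinAt,
    tendsto_iff_norm_sub_tendsto_zero (f := fun s => embW (sobW n) (u s))]
  refine tendsto_congr' ?_
  filter_upwards [self_mem_nhdsWithin] with s hs
  rw [← norm_emb, embW_sub (hm s hs).sumW (hm t ht).sumW]

lemma tendsto_slope_iff {n : ℝ} {I : Set ℝ} {u : ℝ → VField d} (hm : ∀ t ∈ I, MemH n (u t))
    {t : ℝ} (ht : t ∈ I) {w : VField d} (hw : MemH n w) :
    Tendsto (fun s => normH n ((s - t)⁻¹ • (u s - u t) - w)) (𝓝[I \ {t}] t) (𝓝 0) ↔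
      HasDerivWithinAt (fun s => embW (sobW n) (u s)) (embW (sobW n) w) I t := by
  rw [hasDerivWithinAt_iff_tendsto_slope,
    tendsto_iff_norm_sub_tendsto_zero (b := embW (sobW n) w)]
  refine tendsto_congr' ?_
  filter_upwards [self_mem_nhdsWithin] with s hs
  have h1 := (hm s hs.1).sub (hm t ht)
  rw [← norm_emb, embW_sub (h1.smul _).sumW hw.sumW, embW_smul h1.sumW,
    embW_sub (hm s hs.1).sumW (hm t ht).sumW, slope_def_module]

/-- Translation into calculus in `L2 d`. Continuity of the derivative comes for free, since the
right-hand side is continuous from `H^{n+2}` to `H^n`. -/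
lemma isSolution_iff {n ν : ℝ} (hn : (d : ℝ) / 2 + 1 < n) (hν : 0 ≤ ν) {u₀ : VField d} {T : EReal}
    {u : ℝ → VField d} :
    IsSolution n ν (fun _ => 0) u₀ T u ↔ 0 < T ∧ SolvesOn n ν (timeIco T) u ∧ u 0 = u₀ := by
  have hmn : (∀ t ∈ timeIco T, MemH (n + 2) (u t)) → ∀ t ∈ timeIco T, MemH n (u t) :=
    fun h t ht => (h t ht).mono (by linarith)
  constructor
  · intro h
    obtain ⟨u', -, hd', heq⟩ := h.eqn
    have heq' : ∀ t ∈ timeIco T, u' t = rhs ν (u t) := fun t ht => by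
      rw [heq t ht, rhs]; simp
    refine ⟨h.pos, ⟨h.cont.1, fun t ht => (tendsto_normH_sub_iff h.cont.1 ht).mp (h.cont.2 t ht),
      fun t ht => ?_⟩, h.init⟩
    have := hd' t ht
    rw [heq' t ht] at this
    exact (tendsto_slope_iff (hmn h.cont.1) ht ((h.cont.1 t ht).rhs hn ν)).mp this
  · rintro ⟨hT, h, h0⟩
    have hr : ∀ t ∈ timeIco T, MemH n (rhs ν (u t)) := fun t ht => (h.mem t ht).rhs hn ν
    refine ⟨hT, ⟨h.mem, fun t ht => (tendsto_normH_sub_iff h.mem ht).mpr (h.cont t ht)⟩,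
      ⟨fun t => rhs ν (u t), ⟨hr, fun t ht => (tendsto_normH_sub_iff hr ht).mpr
        (continuousOn_rhs hn hν h.mem h.cont t ht)⟩,
        fun t ht => (tendsto_slope_iff (hmn h.mem) ht (hr t ht)).mpr (h.deriv t ht),
        fun t ht => by simp [rhs]⟩, h0⟩

/-- Differentiability in `H^n` implies differentiability in `L²`. -/
lemma SolvesOn.deriv_L2 {n ν : ℝ} (hn : (d : ℝ) / 2 + 1 < n) {I : Set ℝ} {u : ℝ → VField d}
    (h : SolvesOn n ν I u) {t : ℝ} (ht : t ∈ I) :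
    HasDerivWithinAt (fun t => embW (sobW 0) (u t)) (embW (sobW 0) (rhs ν (u t))) I t := by
  have hn0 : 0 ≤ n := by have : (0 : ℝ) ≤ d := Nat.cast_nonneg d; linarith
  have hm : ∀ t ∈ I, MemH n (u t) := fun t ht => (h.mem t ht).mono (by linarith)
  have hr := (h.mem t ht).rhs hn ν
  rw [← tendsto_slope_iff (fun t ht => (hm t ht).mono hn0) ht (hr.mono hn0)]
  refine squeeze_zero' (Eventually.of_forall fun _ => normH_nonneg _ _) ?_
    ((tendsto_slope_iff hm ht hr).mpr (h.deriv t ht))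
  filter_upwards [self_mem_nhdsWithin] with s hs
  exact ((((hm s hs.1).sub (hm t ht)).smul _).sub hr).normH_mono hn0

lemma SolvesOn.continuousOn_normH {n ν : ℝ} {I : Set ℝ} {u : ℝ → VField d}
    (h : SolvesOn n ν I u) : ContinuousOn (fun t => normH n (u t)) I := by
  simp only [← norm_emb]
  exact fun t ht => (h.deriv t ht).continuousWithinAt.norm

lemma SolvesOn.exists_bound {n ν a b : ℝ} {u : ℝ → VField d} (h : SolvesOn n ν (Set.Icc a b) u) :
    ∃ R, 0 ≤ R ∧ ∀ t ∈ Set.Icc a b, normH n (u t) ≤ R := by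
  obtain ⟨R, hR⟩ := isCompact_Icc.exists_bound_of_continuousOn h.continuousOn_normH
  exact ⟨max R 0, le_max_right _ _, fun t ht =>
    (Real.le_norm_self _).trans ((hR t ht).trans (le_max_left _ _))⟩

/-- Uniqueness of solutions. -/
theorem SolvesOn.unique {n ν a b : ℝ} (hn : (d : ℝ) / 2 + 1 < n) (hν : 0 ≤ ν)
    {u v : ℝ → VField d} (hu : SolvesOn n ν (Set.Icc a b) u) (hv : SolvesOn n ν (Set.Icc a b) v)
    (h0 : u a = v a) : Set.EqOn u v (Set.Icc a b) := by
  intro t ht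
  have hn0 : 0 ≤ n + 2 := by have : (0 : ℝ) ≤ d := Nat.cast_nonneg d; linarith
  obtain ⟨R, hR0, hR⟩ := hv.exists_bound
  have h1 := l2_stability (f := fun _ => 0) (g := fun _ => 0) (ε := 0) hn hν hR0 hu.mem hv.mem
    (fun _ _ => MemH.zero 0) (fun _ _ => MemH.zero 0)
    (fun t ht => by rw [add_zero]; exact hu.deriv_L2 hn ht)
    (fun t ht => by rw [add_zero]; exact hv.deriv_L2 hn ht) hR
    (fun _ _ => by rw [sub_zero, normH_zero]) ht
  rw [h0, sub_self, normH_zero] at h1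
  have h2 : normH 0 (u t - v t) = 0 := by
    have : normH 0 (u t - v t) ^ 2 ≤ 0 := by simpa using h1
    exact pow_eq_zero_iff (two_ne_zero) |>.mp (le_antisymm this (sq_nonneg _))
  exact sub_eq_zero.mp ((((hu.mem t ht).sub (hv.mem t ht)).mono hn0).eq_zero_of_normH_eq_zero h2)

lemma Icc_subset_timeIco {T : EReal} {a t : ℝ} (ha : 0 ≤ a) (ht : (t : EReal) < T) :
    Set.Icc a t ⊆ timeIco T := fun _ hs =>
  ⟨ha.trans hs.1, lt_of_le_of_lt (EReal.coe_le_coe_iff.mpr hs.2) ht⟩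

lemma timeIco_mem_nhdsWithin {T T' : EReal} {t : ℝ} (ht : (t : EReal) < T) :
    timeIco T ∈ 𝓝[timeIco T'] t := by
  have h1 : {s : ℝ | (s : EReal) < T} ∈ 𝓝 t :=
    (isOpen_Iio.preimage continuous_coe_real_ereal).mem_nhds ht
  filter_upwards [self_mem_nhdsWithin, mem_nhdsWithin_of_mem_nhds h1] with s hs hs'
  exact ⟨hs.1, hs'⟩

lemma isSolution_unique {n ν : ℝ} (hn : (d : ℝ) / 2 + 1 < n) (hν : 0 ≤ ν) {u₀ : VField d}
    {T T' : EReal} {u v : ℝ → VField d} (hu : IsSolution n ν (fun _ => 0) u₀ T u)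
    (hv : IsSolution n ν (fun _ => 0) u₀ T' v) {t : ℝ} (ht : t ∈ timeIco T)
    (ht' : t ∈ timeIco T') : u t = v t := by
  obtain ⟨-, hu', hu0⟩ := (isSolution_iff hn hν).mp hu
  obtain ⟨-, hv', hv0⟩ := (isSolution_iff hn hν).mp hv
  exact SolvesOn.unique hn hν (hu'.mono (Icc_subset_timeIco le_rfl ht.2))
    (hv'.mono (Icc_subset_timeIco le_rfl ht'.2)) (hu0.trans hv0.symm) ⟨ht.1, le_rfl⟩

lemma exists_solvesOn {n ν R : ℝ} (hn : (d : ℝ) / 2 + 1 < n) (hν : 0 ≤ ν) (hR : 0 < R)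
    {u₀ : VField d} (hu₀ : MemH (n + 2) u₀) (hR₀ : normH n u₀ ≤ R) :
    ∃ u : ℝ → VField d, u 0 = u₀ ∧ SolvesOn n ν (Set.Icc 0 (lifespan d n R)) u := by
  obtain ⟨u, h0, h1, h2, h3⟩ := exists_local hn hν hR hu₀ hR₀
  exact ⟨u, h0, h1, h2, h3⟩

/-- Existence of a maximal solution. -/
theorem exists_maximal {n ν : ℝ} (hn : (d : ℝ) / 2 + 1 < n) (hν : 0 ≤ ν) {u₀ : VField d}
    (hu₀ : MemH (n + 2) u₀) :
    ∃ (T : EReal) (u : ℝ → VField d), IsMaximalSolution n ν (fun _ => 0) u₀ T u := by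
  classical
  have hn0 : 0 ≤ n := by have : (0 : ℝ) ≤ d := Nat.cast_nonneg d; linarith
  let S : Set EReal := {T | ∃ u : ℝ → VField d, IsSolution n ν (fun _ => 0) u₀ T u}
  have hR : 0 < normH n u₀ + 1 := by have := normH_nonneg n u₀; linarith
  have hτ := lifespan_pos (d := d) hn0 hR
  have hS : ((lifespan d n (normH n u₀ + 1) : ℝ) : EReal) ∈ S := by
    obtain ⟨u, h0, hu⟩ := exists_solvesOn hn hν hR hu₀ (by linarith)
    refine ⟨u, (isSolution_iff hn hν).mpr ⟨by exact_mod_cast hτ, hu.mono fun t ht => ?_, h0⟩⟩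
    exact ⟨ht.1, (EReal.coe_lt_coe_iff.mp ht.2).le⟩
  have hpos : 0 < sSup S := lt_of_lt_of_le (by exact_mod_cast hτ) (le_sSup hS)
  -- All solutions are glued by choice; uniqueness makes the value at `t` independent of the one
  -- chosen.
  let U : ℝ → VField d := fun t =>
    if h : ∃ p : EReal × (ℝ → VField d), IsSolution n ν (fun _ => 0) u₀ p.1 p.2 ∧ t ∈ timeIco p.1
    then h.choose.2 t else 0
  have hU : ∀ T v, IsSolution n ν (fun _ => 0) u₀ T v → Set.EqOn U v (timeIco T) := by
    intro T v hv t ht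
    have h : ∃ p : EReal × (ℝ → VField d), IsSolution n ν (fun _ => 0) u₀ p.1 p.2 ∧
      t ∈ timeIco p.1 := ⟨(T, v), hv, ht⟩
    simp only [U, dif_pos h]
    exact isSolution_unique hn hν h.choose_spec.1 hv h.choose_spec.2 ht
  refine ⟨sSup S, U, (isSolution_iff hn hν).mpr ⟨hpos, SolvesOn.of_local fun t ht => ?_, ?_⟩, ?_⟩
  · obtain ⟨T, ⟨v, hv⟩, hT⟩ := lt_sSup_iff.mp ht.2
    exact ⟨timeIco T, v, timeIco_mem_nhdsWithin hT, ((isSolution_iff hn hν).mp hv).2.1, hU T v hv⟩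
  · obtain ⟨u, hu⟩ := hS
    rw [hU _ u hu ⟨le_rfl, by exact_mod_cast hτ⟩, hu.init]
  · rintro ⟨T', v, hT', hv, -⟩
    exact absurd (le_sSup (show T' ∈ S from ⟨v, hv⟩)) hT'.not_ge

/-- A solution bounded in `H^n` on a bounded interval can be continued. -/
theorem exists_continuation {n ν R b : ℝ} (hn : (d : ℝ) / 2 + 1 < n) (hν : 0 ≤ ν) (hR : 0 < R)
    {u₀ : VField d} {u : ℝ → VField d} (hu : IsSolution n ν (fun _ => 0) u₀ (b : EReal) u)
    (hb : ∀ t ∈ timeIco (b : EReal), normH n (u t) ≤ R) :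
    ∃ (T' : EReal) (v : ℝ → VField d), (b : EReal) < T' ∧ IsSolution n ν (fun _ => 0) u₀ T' v ∧
      Set.EqOn v u (timeIco (b : EReal)) := by
  classical
  have hn0 : 0 ≤ n := by have : (0 : ℝ) ≤ d := Nat.cast_nonneg d; linarith
  have hτ := lifespan_pos (d := d) hn0 hR
  set τ := lifespan d n R with hτdef
  obtain ⟨hpos, hs, h0⟩ := (isSolution_iff hn hν).mp hu
  have hb0 : 0 < b := by exact_mod_cast hpos
  -- Restarting within `τ/2` of `b` overshoots `b`, since `τ` depends only on the `H^n` bound `R`.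
  set c := max 0 (b - τ / 2) with hc
  have hc0 : 0 ≤ c := le_max_left _ _
  have hcb : c < b := max_lt hb0 (by linarith)
  have hcτ : b < c + τ := by have := le_max_right 0 (b - τ / 2); linarith
  have hct : c ∈ timeIco (b : EReal) := ⟨hc0, EReal.coe_lt_coe_iff.mpr hcb⟩
  obtain ⟨v, hv0, hv⟩ := exists_solvesOn hn hν hR (hs.mem c hct) (hb c hct)
  have hvs := hv.shift c
  have hpre : (fun t => t - c) ⁻¹' Set.Icc 0 τ = Set.Icc c (c + τ) := by
    ext t; simp [add_comm]
  rw [← hτdef, hpre] at hvs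
  let w : ℝ → VField d := fun t => if t < b then u t else v (t - c)
  have hwu : Set.EqOn w u (timeIco (b : EReal)) := fun t ht =>
    if_pos (EReal.coe_lt_coe_iff.mp ht.2)
  have hwv : Set.EqOn w (fun t => v (t - c)) (Set.Icc c (c + τ)) := by
    intro t ht
    by_cases htb : t < b
    · simp only [w, if_pos htb]
      refine SolvesOn.unique (a := c) (b := t) hn hν
        (hs.mono (Icc_subset_timeIco hc0 (EReal.coe_lt_coe_iff.mpr htb)))
        (hvs.mono (Set.Icc_subset_Icc_right ht.2)) ?_ ⟨ht.1, le_rfl⟩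
      simp [hv0]
    · simp only [w, if_neg htb]
  refine ⟨((c + τ : ℝ) : EReal), w, EReal.coe_lt_coe_iff.mpr hcτ, (isSolution_iff hn hν).mpr
    ⟨hpos.trans (EReal.coe_lt_coe_iff.mpr hcτ), SolvesOn.of_local fun t ht => ?_, ?_⟩, hwu⟩
  · by_cases htb : t < b
    · exact ⟨timeIco (b : EReal), u, timeIco_mem_nhdsWithin (EReal.coe_lt_coe_iff.mpr htb), hs, hwu⟩
    · refine ⟨Set.Icc c (c + τ), _, ?_, hvs, hwv⟩
      exact mem_nhdsWithin_of_mem_nhds (Icc_mem_nhds (by linarith) (EReal.coe_lt_coe_iff.mp ht.2))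
  · rw [hwu ⟨le_rfl, hpos⟩, h0]

/-! ### Riccati comparison and the time `T_c`. -/

lemma eNu_zero_right (ν : ℝ) : eNu ν 0 = 0 := by simp [eNu]

lemma hasDerivAt_eNu (ν t : ℝ) : HasDerivAt (eNu ν) (Real.exp (-ν * t)) t := by
  by_cases hν : ν = 0
  · subst hν
    have : eNu 0 = id := by funext s; simp [eNu]
    rw [this]; simpa using hasDerivAt_id t
  · have : eNu ν = fun s => (1 - Real.exp (-ν * s)) / ν := by funext s; simp [eNu, hν]
    rw [this]
    have h0 : HasDerivAt (fun s : ℝ => -ν * s) (-ν) t := by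
      simpa using (hasDerivAt_id' t).const_mul (-ν)
    refine ((h0.exp.const_sub 1).div_const ν).congr_deriv ?_
    field_simp

lemma eNu_mono (ν : ℝ) : Monotone (eNu ν) :=
  monotone_of_deriv_nonneg (fun t => (hasDerivAt_eNu ν t).differentiableAt)
    (fun t => by rw [(hasDerivAt_eNu ν t).deriv]; exact (Real.exp_pos _).le)

/-- The solution `A e^{-νt} / (1 - G A e_ν(t))` of the control problem `B' = -νB + GB²`. -/
def barrier (ν G A t : ℝ) : ℝ := A * Real.exp (-ν * t) / (1 - G * A * eNu ν t)

lemma hasDerivAt_barrier {ν G A t : ℝ} (h : 1 - G * A * eNu ν t ≠ 0) :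
    HasDerivAt (barrier ν G A) (-ν * barrier ν G A t + G * barrier ν G A t ^ 2) t := by
  have h0 : HasDerivAt (fun s : ℝ => -ν * s) (-ν) t := by
    simpa using (hasDerivAt_id' t).const_mul (-ν)
  have h2 := ((hasDerivAt_eNu ν t).const_mul (G * A)).const_sub 1
  refine ((h0.exp.const_mul A).div h2 h).congr_deriv ?_
  simp only [barrier]
  field_simp
  ring

/-- The control inequality for a solution of a differential inequality of Riccati type. -/
lemma le_barrier {ν G A a b : ℝ} (hG : 0 ≤ G) (hA : 0 ≤ A) (hab : a ≤ b) {g D : ℝ → ℝ}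
    (hg : ∀ t ∈ Set.Icc a b, 0 ≤ g t) (hga : g a ≤ A)
    (hD : ∀ t ∈ Set.Icc a b, HasDerivWithinAt (fun t => g t ^ 2) (D t) (Set.Icc a b) t)
    (hle : ∀ t ∈ Set.Icc a b, D t ≤ -2 * ν * g t ^ 2 + 2 * G * g t ^ 3)
    (hpos : 0 < 1 - G * A * eNu ν (b - a)) : g b ≤ barrier ν G A (b - a) := by
  -- Raising `G` and `A` by `ε` makes the barrier positive and the comparison strict at a point of
  -- contact; `ε → 0` at the end.
  have hcont : Tendsto (fun ε => 1 - (G + ε) * (A + ε) * eNu ν (b - a)) (𝓝[>] (0 : ℝ))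
      (𝓝 (1 - G * A * eNu ν (b - a))) := by
    have : Continuous fun ε : ℝ => 1 - (G + ε) * (A + ε) * eNu ν (b - a) := by fun_prop
    simpa using (this.tendsto 0).mono_left nhdsWithin_le_nhds
  have hlim : Tendsto (fun ε => barrier ν (G + ε) (A + ε) (b - a)) (𝓝[>] (0 : ℝ))
      (𝓝 (barrier ν G A (b - a))) := by
    have : Tendsto (fun ε : ℝ => (A + ε) * Real.exp (-ν * (b - a))) (𝓝[>] (0 : ℝ))
        (𝓝 (A * Real.exp (-ν * (b - a)))) := by
      have : Continuous fun ε : ℝ => (A + ε) * Real.exp (-ν * (b - a)) := by fun_prop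
      simpa using (this.tendsto 0).mono_left nhdsWithin_le_nhds
    exact this.div hcont hpos.ne'
  refine ge_of_tendsto hlim ?_
  filter_upwards [hcont.eventually (lt_mem_nhds hpos), self_mem_nhdsWithin] with ε hε hε0
  have hε0' : (0 : ℝ) < ε := hε0
  have hq : ∀ t ∈ Set.Icc a b, 0 < 1 - (G + ε) * (A + ε) * eNu ν (t - a) := fun t ht => by
    have : eNu ν (t - a) ≤ eNu ν (b - a) := eNu_mono ν (by linarith [ht.2])
    have := mul_le_mul_of_nonneg_left this (show 0 ≤ (G + ε) * (A + ε) by positivity)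
    linarith
  have hBpos : ∀ t ∈ Set.Icc a b, 0 < barrier ν (G + ε) (A + ε) (t - a) := fun t ht => by
    have := hq t ht
    unfold barrier; positivity
  have hBd : ∀ t ∈ Set.Icc a b, HasDerivAt (fun t => barrier ν (G + ε) (A + ε) (t - a) ^ 2)
      (2 * barrier ν (G + ε) (A + ε) (t - a) * (-ν * barrier ν (G + ε) (A + ε) (t - a) +
        (G + ε) * barrier ν (G + ε) (A + ε) (t - a) ^ 2)) t := fun t ht => by
    have := ((hasDerivAt_barrier (hq t ht).ne').comp_sub_const t a).fun_pow 2
    exact this.congr_deriv (by norm_num)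
  -- Squares are compared, since `g` itself need not be differentiable where it vanishes.
  have key := image_le_of_deriv_right_lt_deriv_boundary' (a := a) (b := b) (f := fun t => g t ^ 2)
    (f' := D) (B := fun t => barrier ν (G + ε) (A + ε) (t - a) ^ 2)
    (fun t ht => (hD t ht).continuousWithinAt)
    (fun t ht => hasDerivWithinAt_Ici_of_Icc (hD t (Set.Ico_subset_Icc_self ht)) ht)
    (by
      simp only [barrier, sub_self, eNu_zero_right, mul_zero, Real.exp_zero, mul_one, sub_zero, div_one]
      have := hg a ⟨le_rfl, hab⟩
      gcongr
      linarith)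
    (fun t ht => (hBd t ht).continuousAt.continuousWithinAt)
    (fun t ht => (hBd t (Set.Ico_subset_Icc_self ht)).hasDerivWithinAt)
    (fun t ht heq => by
      have ht' := Set.Ico_subset_Icc_self ht
      have hB := hBpos t ht'
      have hgB : g t = barrier ν (G + ε) (A + ε) (t - a) :=
        (pow_left_inj₀ (hg t ht') hB.le two_ne_zero).mp heq
      have h1 := hle t ht'
      rw [hgB] at h1
      have h2 : 0 < ε * barrier ν (G + ε) (A + ε) (t - a) ^ 3 := by positivity
      nlinarith)
    (Set.right_mem_Icc.mpr hab)
  exact (pow_le_pow_iff_left₀ (hg b ⟨hab, le_rfl⟩) (hBpos b ⟨hab, le_rfl⟩).le two_ne_zero).mp key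

/-- `T_c` is the first zero of `1 - G a e_ν`. There is none if `ν > 0` and `a ≤ ν/G`, because `e_ν <
1/ν`. -/
lemma pos_of_mem_timeIco_Tc {ν G a t : ℝ} (hν : 0 ≤ ν) (hG : 0 < G) (ha : 0 ≤ a)
    (ht : t ∈ timeIco (Tc ν G a)) : 0 < 1 - G * a * eNu ν t := by
  obtain ⟨ht0, ht⟩ := ht
  unfold Tc at ht
  split_ifs at ht with h1 h2 h3
  · simp [h2]
  · have ha' : 0 < a := lt_of_le_of_ne ha (Ne.symm h2)
    have := EReal.coe_lt_coe_iff.mp ht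
    rw [lt_div_iff₀ (by positivity)] at this
    simp only [eNu, h1, if_true]
    linarith
  · have hν' : 0 < ν := lt_of_le_of_ne hν (Ne.symm h1)
    rw [le_div_iff₀ hG] at h3
    simp only [eNu, h1, if_false]
    have he := Real.exp_pos (-ν * t)
    have he1 : Real.exp (-ν * t) ≤ 1 := Real.exp_le_one_iff.mpr (by nlinarith)
    have : G * a * ((1 - Real.exp (-ν * t)) / ν) ≤ 1 - Real.exp (-ν * t) := by
      rw [← mul_div_assoc, div_le_iff₀ hν']
      nlinarith
    linarith
  · have hν' : 0 < ν := lt_of_le_of_ne hν (Ne.symm h1)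
    have h3' := not_le.mp h3
    rw [div_lt_iff₀ hG] at h3'
    have hGa : 0 < G * a := by nlinarith
    have hx : 0 < 1 - ν / (G * a) := by
      have : ν / (G * a) < 1 := by rw [div_lt_one hGa]; linarith
      linarith
    have h4 := EReal.coe_lt_coe_iff.mp ht
    have h5 : Real.log (1 - ν / (G * a)) < -ν * t := by
      have := mul_lt_mul_of_pos_left h4 hν'
      have e : ν * (-(1 / ν) * Real.log (1 - ν / (G * a))) = -Real.log (1 - ν / (G * a)) := by
        field_simp
      rw [e] at this
      linarith
    have h6 := (Real.log_lt_iff_lt_exp hx).mp h5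
    simp only [eNu, h1, if_false]
    have h7 : 1 - Real.exp (-ν * t) < ν / (G * a) := by linarith
    rw [lt_div_iff₀ hGa] at h7
    have : G * a * ((1 - Real.exp (-ν * t)) / ν) < 1 := by
      rw [← mul_div_assoc, div_lt_one hν']; linarith
    linarith

lemma Tc_eq_top {ν G a : ℝ} (ha : 0 ≤ a) (h : a ≤ ν / G) : Tc ν G a = ⊤ := by
  unfold Tc
  split_ifs with h1 h2
  · rfl
  · rw [h1, zero_div] at h
    exact absurd (le_antisymm h ha) h2
  · rfl

/-! ### A priori bound, exponential decay and the lower bound for the lifetime. -/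

lemma innerH_rhs {n ν : ℝ} (hn : (d : ℝ) / 2 + 1 < n) {u : VField d} (hu : MemH (n + 2) u) :
    innerH n (rhs ν u) u = -ν * normH (n + 1) u ^ 2 + innerH n (bilin u u) u := by
  have h0 : MemH n u := hu.mono (by linarith)
  have hb := (bilin_sobolev hn h0 (hu.mono (by linarith))).1
  rw [rhs, innerH_add_left (hu.lap.1.smul ν) hb h0, innerH_smul_left hu.lap.1 h0, innerH_lap hu]
  ring

lemma SolvesOn.deriv_normH_sq {n ν : ℝ} (hn : (d : ℝ) / 2 + 1 < n) {I : Set ℝ} {u : ℝ → VField d}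
    (h : SolvesOn n ν I u) {t : ℝ} (ht : t ∈ I) :
    HasDerivWithinAt (fun t => normH n (u t) ^ 2) (2 * innerH n (rhs ν (u t)) (u t)) I t := by
  have h1 := (h.deriv t ht).norm_sq
  rw [real_inner_comm, inner_emb ((h.mem t ht).rhs hn ν) ((h.mem t ht).mono (by linarith))] at h1
  simpa only [norm_emb] using h1

lemma IsKatoConstant.innerH_rhs_le {n ν G : ℝ} (hG : IsKatoConstant d n G)
    (hn : (d : ℝ) / 2 + 1 < n) (hν : 0 ≤ ν) {u : VField d} (hu : MemH (n + 2) u) :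
    2 * innerH n (rhs ν u) u ≤ -2 * ν * normH n u ^ 2 + 2 * G * normH n u ^ 3 := by
  have h1 := (abs_le.mp (hG.2 u u (hu.mono (by linarith)) (hu.mono (by linarith)))).2
  have h2 : normH n u ^ 2 ≤ normH (n + 1) u ^ 2 := by
    have := normH_nonneg n u
    gcongr
    exact (hu.mono (by linarith : n + 1 ≤ n + 2)).normH_mono (by linarith)
  have h3 := mul_le_mul_of_nonneg_left h2 hν
  rw [innerH_rhs hn hu]
  nlinarith

/-- The energy inequality is strict for nonzero fields and positive viscosity: equality of the
norms of orders `n` and `n + 1` forces the field to be supported on `|k| = 1`, and then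
`⟨𝒫(u,u) | u⟩_n = ⟨𝒫(u,u) | u⟩_{L²} = 0`. -/
lemma IsKatoConstant.innerH_rhs_lt {n ν G : ℝ} (hG : IsKatoConstant d n G)
    (hn : (d : ℝ) / 2 + 1 < n) (hν : 0 < ν) {u : VField d} (hu : MemH (n + 2) u)
    (h0 : 0 < normH n u) :
    2 * innerH n (rhs ν u) u < -2 * ν * normH n u ^ 2 + 2 * G * normH n u ^ 3 := by
  have un : MemH n u := hu.mono (by linarith)
  have un1 : MemH (n + 1) u := hu.mono (by linarith)
  have h1 := (abs_le.mp (hG.2 u u un un1)).2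
  have hle : normH n u ^ 2 ≤ normH (n + 1) u ^ 2 := by
    gcongr
    exact un1.normH_mono (by linarith)
  rw [innerH_rhs hn hu]
  rcases hle.lt_or_eq with hlt | heq
  · have := mul_lt_mul_of_pos_left hlt hν
    nlinarith
  · have hz : innerH n (bilin u u) u = 0 := by
      rw [← innerH_zero_bilin hn un un]
      refine tsum_congr fun k => ?_
      by_cases hk : u k = 0
      · simp [hk]
      have hk0 : k ≠ 0 := fun h => hk (h ▸ un.mean)
      have hpt : kabs k ^ (2 * n) * ‖u k‖ ^ 2 = kabs k ^ (2 * (n + 1)) * ‖u k‖ ^ 2 := by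
        rw [normH_sq, normH_sq] at heq
        have hmono := rpow_weight_mono (m := n) (n := n + 1) (by linarith) un.mean
        by_contra hne
        exact absurd heq (un.summable.tsum_lt_tsum hmono
          (lt_of_le_of_ne (hmono k) hne) un1.summable).ne
      have hp := kabs_pos hk0
      have hu' : 0 < ‖u k‖ ^ 2 := by have := norm_pos_iff.mpr hk; positivity
      have h2 := mul_right_cancel₀ hu'.ne' hpt
      rw [show 2 * (n + 1) = 2 * n + (2 : ℕ) by push_cast; ring, Real.rpow_add_natCast hp.ne'] at h2
      have h3 : kabs k ^ 2 = 1 := by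
        have := Real.rpow_pos_of_pos hp (2 * n)
        have h4 : kabs k ^ (2 * n) * (kabs k ^ 2 - 1) = 0 := by linarith
        rcases mul_eq_zero.mp h4 with h5 | h5 <;> linarith
      have h5 : kabs k = 1 := by nlinarith
      simp [h5]
    rw [hz, ← heq]
    have := hG.1
    have : 0 < G * normH n u ^ 3 := by positivity
    linarith

/-- The a priori bound from the Kato inequality. -/
theorem SolvesOn.normH_le_barrier {n ν G a b : ℝ} (hG : IsKatoConstant d n G)
    (hn : (d : ℝ) / 2 + 1 < n) (hν : 0 ≤ ν) (hab : a ≤ b) {u : ℝ → VField d}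
    (h : SolvesOn n ν (Set.Icc a b) u)
    (hpos : 0 < 1 - G * normH n (u a) * eNu ν (b - a)) :
    normH n (u b) ≤ barrier ν G (normH n (u a)) (b - a) :=
  le_barrier hG.1.le (normH_nonneg _ _) hab (fun _ _ => normH_nonneg _ _) le_rfl
    (fun _ ht => h.deriv_normH_sq hn ht) (fun t ht => hG.innerH_rhs_le hn hν (h.mem t ht)) hpos

/-- At any time a global solution with `‖u‖_n ≤ ν/G` and `ν > 0` enters the set `‖u‖_n < ν/G`. -/
lemma exists_normH_lt {n ν G : ℝ} (hG : IsKatoConstant d n G) (hn : (d : ℝ) / 2 + 1 < n)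
    (hν : 0 < ν) {u : ℝ → VField d} (h : SolvesOn n ν (timeIco ⊤) u)
    (h0 : normH n (u 0) ≤ ν / G) : ∃ a, 0 ≤ a ∧ normH n (u a) < ν / G := by
  have hm0 : (0 : ℝ) ∈ timeIco ⊤ := ⟨le_rfl, EReal.coe_lt_top 0⟩
  rcases h0.lt_or_eq with hlt | heq
  · exact ⟨0, le_rfl, hlt⟩
  have hpos : 0 < normH n (u 0) := by rw [heq]; exact div_pos hν hG.1
  have hd := h.deriv_normH_sq hn hm0
  -- At `‖u₀‖_n = ν/G` the two terms of the Riccati bound cancel exactly, so strictness gives a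
  -- negative derivative.
  have hneg : 2 * innerH n (rhs ν (u 0)) (u 0) < 0 := by
    refine lt_of_lt_of_le (hG.innerH_rhs_lt hn hν (h.mem 0 hm0) hpos) (le_of_eq ?_)
    have := hG.1.ne'
    rw [heq]; field_simp; ring
  have hd' : HasDerivWithinAt (fun t => normH n (u t) ^ 2) (2 * innerH n (rhs ν (u 0)) (u 0))
      (Set.Ioi 0) 0 := hd.mono fun t ht => ⟨le_of_lt ht, EReal.coe_lt_top t⟩
  rw [hasDerivWithinAt_iff_tendsto_slope' (by simp)] at hd'
  obtain ⟨a, ha, ha0⟩ := ((hd'.eventually (gt_mem_nhds hneg)).and self_mem_nhdsWithin).exists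
  have ha0' : 0 < a := ha0
  refine ⟨a, ha0'.le, ?_⟩
  rw [slope_def_field, sub_zero, div_neg_iff] at ha
  have h1 : normH n (u a) ^ 2 < normH n (u 0) ^ 2 := by
    rcases ha with ⟨-, h⟩ | ⟨h, -⟩ <;> linarith
  rw [← heq]
  exact lt_of_pow_lt_pow_left₀ 2 hpos.le h1

/-- Exponential decay of small solutions. -/
lemma exists_exponential_decay {n ν G : ℝ} (hG : IsKatoConstant d n G) (hn : (d : ℝ) / 2 + 1 < n)
    (hν : 0 < ν) {u : ℝ → VField d} (h : SolvesOn n ν (timeIco ⊤) u)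
    (h0 : normH n (u 0) ≤ ν / G) :
    ∃ C : ℝ, ∀ t : ℝ, 0 ≤ t → normH n (u t) ≤ C * Real.exp (-ν * t) := by
  obtain ⟨a, ha0, ha⟩ := exists_normH_lt hG hn hν h h0
  have hsub : ∀ b : ℝ, ∀ c : ℝ, 0 ≤ b → SolvesOn n ν (Set.Icc b c) u := fun b c hb =>
    h.mono (Icc_subset_timeIco hb (EReal.coe_lt_top c))
  obtain ⟨R, hR0, hR⟩ := (hsub 0 a le_rfl).exists_bound
  set A := normH n (u a) with hA
  have hA0 : 0 ≤ A := normH_nonneg _ _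
  have hG0 := hG.1
  rw [lt_div_iff₀ hG0] at ha
  have hden : 0 < 1 - G * A / ν := by
    have : G * A / ν < 1 := by rw [div_lt_one hν]; linarith
    linarith
  -- `R` covers `[0, a]`, the second summand covers `t ≥ a` through the barrier started at `a`, and
  -- `e^{νa}` accounts for the shifted origin.
  refine ⟨(R + A / (1 - G * A / ν)) * Real.exp (ν * a), fun t ht => ?_⟩
  rw [mul_assoc, ← Real.exp_add]
  have hAd : 0 ≤ A / (1 - G * A / ν) := by positivity
  rcases le_total t a with hta | hta
  · have h1 := hR t ⟨ht, hta⟩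
    have h2 : 1 ≤ Real.exp (ν * a + -ν * t) := Real.one_le_exp (by nlinarith)
    nlinarith
  · have he : eNu ν (t - a) ≤ 1 / ν := by
      simp only [eNu, hν.ne', if_false]
      gcongr
      linarith [Real.exp_pos (-ν * (t - a))]
    have hq : 1 - G * A / ν ≤ 1 - G * A * eNu ν (t - a) := by
      have := mul_le_mul_of_nonneg_left he (show 0 ≤ G * A by positivity)
      have e : G * A * (1 / ν) = G * A / ν := by ring
      linarith
    have h1 := (hsub a t ha0).normH_le_barrier hG hn hν.le hta (hden.trans_le hq)
    have h2 : barrier ν G A (t - a) ≤ A / (1 - G * A / ν) * Real.exp (ν * a + -ν * t) := by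
      have e : -ν * (t - a) = ν * a + -ν * t := by ring
      rw [barrier, e, div_mul_eq_mul_div]
      gcongr
    have h3 : 0 ≤ R * Real.exp (ν * a + -ν * t) := by positivity
    rw [add_mul]
    linarith

/-- A maximal solution exists up to the time `T_c`. -/
theorem Tc_le_of_maximal {n ν G : ℝ} (hG : IsKatoConstant d n G) (hn : (d : ℝ) / 2 + 1 < n)
    (hν : 0 ≤ ν) {u₀ : VField d} {T : EReal} {u : ℝ → VField d}
    (hu : IsMaximalSolution n ν (fun _ => 0) u₀ T u) : Tc ν G (normH n u₀) ≤ T := by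
  by_contra hlt
  rw [not_le] at hlt
  obtain ⟨hpos, hs, h0⟩ := (isSolution_iff hn hν).mp hu.1
  have hG0 := hG.1
  have ha := normH_nonneg n u₀
  induction T with
  | bot => exact absurd hpos (by simp)
  | top => exact absurd hlt (by simp)
  | coe b =>
    have hb0 : 0 < b := by exact_mod_cast hpos
    have hq := pos_of_mem_timeIco_Tc hν hG0 ha (t := b) ⟨hb0.le, hlt⟩
    -- If `T = b < T_c`, the barrier on `[0, b)` is bounded by its denominator at `b`, since `e_ν`
    -- increases. The `+ 1` keeps `R` positive when `u₀ = 0`.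
    refine hu.2 (exists_continuation (R := normH n u₀ / (1 - G * normH n u₀ * eNu ν b) + 1) hn hν
      (by positivity) hu.1 fun t ht => ?_)
    have hqt : 1 - G * normH n u₀ * eNu ν b ≤ 1 - G * normH n u₀ * eNu ν t := by
      have h1 := eNu_mono ν (EReal.coe_lt_coe_iff.mp ht.2).le
      have := mul_le_mul_of_nonneg_left h1 (show 0 ≤ G * normH n u₀ by positivity)
      linarith
    have h1 := (hs.mono (Icc_subset_timeIco le_rfl ht.2)).normH_le_barrier hG hn hν ht.1
      (by rw [h0, sub_zero]; exact hq.trans_le hqt)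
    rw [h0, sub_zero] at h1
    refine h1.trans ?_
    have h2 : barrier ν G (normH n u₀) t ≤ normH n u₀ / (1 - G * normH n u₀ * eNu ν b) := by
      unfold barrier
      gcongr
      exact mul_le_of_le_one_right ha (Real.exp_le_one_iff.mpr (by nlinarith [ht.1]))
    linarith

end EulerNS

end

theorem mainTheorem2 (d : ℕ) (hd : 2 ≤ d) (n ν G : ℝ) (hn : (d : ℝ) / 2 + 1 < n) (hν : 0 ≤ ν)
    (hG : IsKatoConstant d n G) (u₀ : VField d) (hu₀ : MemH (n + 2) u₀) :
    (∃ (T : EReal) (u : ℝ → VField d), IsMaximalSolution n ν (fun _ => 0) u₀ T u) ∧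
    ∀ (T : EReal) (u : ℝ → VField d), IsMaximalSolution n ν (fun _ => 0) u₀ T u →
      Tc ν G (normH n u₀) ≤ T ∧
      (∀ t ∈ timeIco (Tc ν G (normH n u₀)),
        0 < 1 - G * normH n u₀ * eNu ν t ∧
        normH n (u t) ≤
          normH n u₀ * Real.exp (-ν * t) / (1 - G * normH n u₀ * eNu ν t)) ∧
      (normH n u₀ ≤ ν / G →
        T = ⊤ ∧ Tc ν G (normH n u₀) = ⊤ ∧
        (0 < ν → ∃ C : ℝ, ∀ t : ℝ, 0 ≤ t → normH n (u t) ≤ C * Real.exp (-ν * t))) := by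
  refine ⟨exists_maximal hn hν hu₀, fun T u hu => ?_⟩
  have hT := Tc_le_of_maximal hG hn hν hu
  obtain ⟨-, hs, h0⟩ := (isSolution_iff hn hν).mp hu.1
  have ha := normH_nonneg n u₀
  refine ⟨hT, fun t ht => ?_, fun hsmall => ?_⟩
  · have hq := pos_of_mem_timeIco_Tc hν hG.1 ha ht
    refine ⟨hq, ?_⟩
    have h1 := (hs.mono (Icc_subset_timeIco le_rfl (ht.2.trans_le hT))).normH_le_barrier hG hn hν ht.1
      (by rw [h0, sub_zero]; exact hq)
    rwa [h0, sub_zero] at h1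
  · have htop := Tc_eq_top ha hsmall
    have hTtop : T = ⊤ := top_le_iff.mp (htop ▸ hT)
    refine ⟨hTtop, htop, fun hν' => ?_⟩
    rw [hTtop] at hs
    exact exists_exponential_decay hG hn hν' hs (h0.symm ▸ hsmall)
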